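/- **Setting.** Let $n\ge 1$, let $Q\in\mathbb R^{n\times n}$ be symmetric positive definite, $c\in\mathbb R^n$, and $\lambda\in\mathbb R^n$ with $\lambda_i>0$ for all $i$. Suppose that the support graph of $Q$ (nodes $1,\dots,n$; $i\ne j$ adjacent iff $Q_{ij}\neq 0$) is a tree. Consider $$\min_{x\in\mathbb R^n,\ z\in\{0,1\}^n}\ \tfrac12 x^\top Qx+c^\top x+\lambda^\top z\qquad\text{s.t. } x_i(1-z_i)=0,\ i=1,\dots,n. \tag{P}$$ Root the tree at any node $r$, let $\mathrm{child}(u)$ be the neighbour of $u\neq r$ on the path from $u$ to $r$, and let $\mathrm{par}(u)$ be the set of the other neighbours of $u$ (all neighbours if $u=r$). Let $\mathbb 1_\alpha=0$ for $\alpha=0$ and $\mathbb 1_\alpha=1$ otherwise, and let $f^*(\beta)=\sup_\alpha\{\alpha\beta-f(\alpha)\}$. A piecewise-quadratic function is stored as the ordered list of its breakpoints and of the coefficients of its pieces. **Parametric algorithm.** 1. Order the nodes topologically (every $u\ne r$ precedes $\mathrm{child}(u)$). 2. For each node $u$ in this order, form $$f_u(\alpha)=\tilde f_u(\alpha)+\lambda_u\mathbb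 1_\alpha,\qquad \tilde f_u(\alpha)=\tfrac12Q_{uu}\alpha^2+c_u\alpha-\sum_{v\in\mathrm{par}(u)}f_v^*(-Q_{uv}\alpha),$$ where the breakpoint lists are merged, and then obtain $f_u^*$ from $f_u$ by the breakpoint algorithm below. 3. Set $f^\star=\min_\alpha f_r(\alpha)$ and $x^\star_r\in\arg\min_\alpha f_r(\alpha)$, by comparing the value at $0$ with the minima of all pieces. 4. Going from the root to the leaves, set $x^\star_u\in\arg\min_\alpha\{f_u(\alpha)+Q_{\mathrm{child}(u),u}\,x^\star_{\mathrm{child}(u)}\,\alpha\}$ in the same way. Return $f^\star$ and $x^\star$. **Breakpoint algorithm.** The input is $g+\lambda\mathbb 1_\alpha$, where $g$ is equal to the quadratic $p_k$ on $[\tau_{k-1},\tau_k]$, $k=1,\dots,N$, $-\infty=\tau_0<\dots<\tau_N=+\infty$. Start with the lists $\Gamma=[-\infty]$, $\Pi=[1]$. For $j=2,\dots,N$: as long as $s_{ij}\le \mathrm{end}(\Gamma)$ for the last element $i$ of $\Pi$, delete the last elements of $\Gamma$ and $\Pi$; then append $s_{ij}$ to $\Gamma$ and $j$ to $\Pi$.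 Finally append $+\infty$ to $\Gamma$; let $g^*=p^*_{\Pi(k)}$ on $[\Gamma(k),\Gamma(k+1)]$; find the roots $\beta_1<\beta_2$ of $g^*(\beta)-\lambda=-g(0)$; and return the function equal to $-g(0)$ on $[\beta_1,\beta_2]$ and to $g^*-\lambda$ elsewhere (equal to $g^*-\lambda$ everywhere if there are no two such roots). Here $s_{kl}$ ($k<l$) is computed in constant time: it is the slope of a common tangent of $p_k$ and $p_l$ (a root of $p_l^*-p_k^*$) that touches $p_k$ in $[\tau_{k-1},\tau_k]$ and $p_l$ in $[\tau_{l-1},\tau_l]$ if there is one, and otherwise the root at which $p_l^*-p_k^*$ changes sign from negative to positive. **Theorem.** There is an absolute constant $C$ such that for all such $n,Q,c,\lambda,r$ the parametric algorithm returns an optimal solution and the optimal value of (P): with $z^\star_i=1$ iff $x^\star_i\ne0$, the pair $(x^\star,z^\star)$ is optimal for (P) and has objective value $f^\star$. It executes at most $Cn^2$ elementary operations and uses at most $Cn^2$ words of memory, on a real-number machine with unit-cost arithmetic ($+,-,\times,/,\sqrt{\ }$), comparisons and memory accesses. -/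

import Mathlib

/-!
# The parametric algorithm for quadratic optimization with indicators over a tree

The optimization problem, a unit-cost real-number machine (given by a monad that
counts time and memory), and the parametric algorithm written as a program of that machine.
-/

noncomputable section

namespace TreeMIQP

/-! ## The optimization problem -/

/-- The support graph of `Q`: distinct `i`, `j` are joined iff `Q i j ≠ 0` (`Q` symmetric). -/
def supportGraph {n : ℕ} (Q : Matrix (Fin n) (Fin n) ℝ) : SimpleGraph (Fin n) :=
  SimpleGraph.fromRel fun i j => Q i j ≠ 0

/-- The objective `(1/2) xᵀ Q x + cᵀ x + λᵀ z`. -/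
def objective {n : ℕ} (Q : Matrix (Fin n) (Fin n) ℝ) (c lam x z : Fin n → ℝ) : ℝ :=
  1 / 2 * (x ⬝ᵥ Matrix.mulVec Q x) + c ⬝ᵥ x + lam ⬝ᵥ z

/-- The constraints `z ∈ {0,1}ⁿ` and `x i (1 - z i) = 0` for all `i`. -/
def Feasible {n : ℕ} (x z : Fin n → ℝ) : Prop :=
  (∀ i, z i = 0 ∨ z i = 1) ∧ ∀ i, x i * (1 - z i) = 0

/-- `(x, z)` is an optimal solution. -/
def IsOptimal {n : ℕ} (Q : Matrix (Fin n) (Fin n) ℝ) (c lam x z : Fin n → ℝ) : Prop :=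
  Feasible x z ∧
    ∀ x' z' : Fin n → ℝ, Feasible x' z' → objective Q c lam x z ≤ objective Q c lam x' z'

open Classical in
/-- The binary vector with `z i = 1` iff `x i ≠ 0`. -/
def supportVector {n : ℕ} (x : Fin n → ℝ) : Fin n → ℝ :=
  fun i => if x i = 0 then 0 else 1

/-! ## The machine

A program is a term of `Comp α`; it has a result, a number of executed unit-cost instructions, and
a number of memory words written.  A word that has been written is never released or reused, so
`mem` bounds the memory in use at every moment of the run.

Programs below handle real numbers, extended reals and node labels only through the instructions
of this section.  Every function call and every round of a loop pays in addition for one `step`,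
which covers the transfer of control, the inspection of the arguments' outermost constructors,
and one word of stack. -/

/-- A computation: result, time, and number of memory words written. -/
structure Comp (α : Type) where
  val : α
  time : ℕ
  mem : ℕ

instance : Monad Comp where
  pure x := ⟨x, 0, 0⟩
  bind m f := ⟨(f m.val).val, m.time + (f m.val).time, m.mem + (f m.val).mem⟩

/-- One control step (function call or loop round). -/
def step : Comp Unit := ⟨(), 1, 1⟩

/-- A unit-cost instruction that writes its result to a new word. -/
def instr {α : Type} (x : α) : Comp α := ⟨x, 1, 1⟩

/-- Storing a record (or list cell) that consists of `w` words. -/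
def store {α : Type} (w : ℕ) (x : α) : Comp α := ⟨x, w, w⟩

def add (x y : ℝ) : Comp ℝ := instr (x + y)
def sub (x y : ℝ) : Comp ℝ := instr (x - y)
def mul (x y : ℝ) : Comp ℝ := instr (x * y)
def div (x y : ℝ) : Comp ℝ := instr (x / y)
def neg (x : ℝ) : Comp ℝ := instr (-x)
def sqrt (x : ℝ) : Comp ℝ := instr (Real.sqrt x)

/-- A real number as an extended real (breakpoints are extended reals). -/
def toExt (x : ℝ) : Comp EReal := instr (x : EReal)
/-- Product of an extended real and a real number. -/
def mulExt (t : EReal) (x : ℝ) : Comp EReal := instr (t * (x : EReal))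

open Classical in
def isLt (x y : ℝ) : Comp Bool := instr (decide (x < y))
open Classical in
def isEq (x y : ℝ) : Comp Bool := instr (decide (x = y))
open Classical in
def isLtExt (s t : EReal) : Comp Bool := instr (decide (s < t))
open Classical in
def isLeExt (s t : EReal) : Comp Bool := instr (decide (s ≤ t))

/-- Comparison of two node labels. -/
def sameNode {n : ℕ} (u v : Fin n) : Comp Bool := instr (decide (u = v))

/-- Arrays indexed by the nodes, with unit-cost access.  Every program below uses an array only
in its latest version, so that writing is in place. -/
abbrev Arr (n : ℕ) (α : Type) : Type := Fin n → α

def newArr (n : ℕ) {α : Type} (x : α) : Comp (Arr n α) := store n fun _ => x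
def read {n : ℕ} {α : Type} (A : Arr n α) (i : Fin n) : Comp α := instr (A i)
def write {n : ℕ} {α : Type} (A : Arr n α) (i : Fin n) (x : α) : Comp (Arr n α) :=
  instr (Function.update A i x)

/-- Reading an entry of the input matrix. -/
def entry {n : ℕ} (Q : Matrix (Fin n) (Fin n) ℝ) (i j : Fin n) : Comp ℝ := instr (Q i j)

/-! ## Quadratic and piecewise-quadratic functions -/

/-- The quadratic function `a α² + b α + c`. -/
structure Quad where
  a : ℝ
  b : ℝ
  c : ℝ

/-- A piece of a piecewise-quadratic function: its right breakpoint and its quadratic.  Its left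
breakpoint is the right breakpoint of the preceding piece (`-∞` for the first piece). -/
structure Piece where
  hi : EReal
  q : Quad

/-- A piecewise-quadratic function: the ordered list of its pieces, the last right breakpoint
being `+∞`. -/
abbrev PWQ : Type := List Piece

def newQuad (a b c : ℝ) : Comp Quad := store 3 ⟨a, b, c⟩

/-- Puts the piece `q` with right breakpoint `hi` in front of `f`: five words, namely the
breakpoint, three coefficients and a link. -/
def consPiece (hi : EReal) (q : Quad) (f : PWQ) : Comp PWQ := store 5 (⟨hi, q⟩ :: f)

def addQuad (p q : Quad) : Comp Quad := do
  step
  let a ← add p.a q.a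
  let b ← add p.b q.b
  let c ← add p.c q.c
  newQuad a b c

def subQuad (p q : Quad) : Comp Quad := do
  step
  let a ← sub p.a q.a
  let b ← sub p.b q.b
  let c ← sub p.c q.c
  newQuad a b c

/-- The value of `p` at `x`. -/
def evalQuad (p : Quad) (x : ℝ) : Comp ℝ := do
  step
  let s ← mul p.a x
  let s ← add s p.b
  let s ← mul s x
  add s p.c

/-- `argmax_α {β α - p(α)} = (β - b) / (2 a)`, the point where `p` has slope `β`. -/
def tangentPoint (p : Quad) (β : ℝ) : Comp ℝ := do
  step
  let s ← sub β p.b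
  let d ← mul 2 p.a
  div s d

/-- The conjugate `β² / (4 a) - (b / (2 a)) β + b² / (4 a) - c` of a strongly convex quadratic. -/
def conjQuad (p : Quad) : Comp Quad := do
  step
  let d ← mul 4 p.a
  let a ← div 1 d
  let e ← mul 2 p.a
  let b ← div p.b e
  let b ← neg b
  let s ← mul p.b p.b
  let s ← div s d
  let c ← sub s p.c
  newQuad a b c

/-- The real roots of `p`, the smaller one first; a single root is returned twice, and `none`
stands for no root (also if `p = 0`). -/
def rootsQuad (p : Quad) : Comp (Option (ℝ × ℝ)) := do
  step
  if ← isEq p.a 0 then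
    if ← isEq p.b 0 then
      pure none
    else do
      let m ← neg p.c
      let r ← div m p.b
      store 2 (some (r, r))
  else do
    let s ← mul p.b p.b
    let t ← mul p.a p.c
    let t ← mul 4 t
    let D ← sub s t
    if ← isLt D 0 then
      pure none
    else do
      let D ← sqrt D
      let m ← neg p.b
      let d ← mul 2 p.a
      let r ← sub m D
      let r ← div r d
      let t ← add m D
      let t ← div t d
      if ← isLt r t then
        store 2 (some (r, t))
      else
        store 2 (some (t, r))

/-- The value at `x` of a piecewise-quadratic function. -/
def evalPW (x : ℝ) : PWQ → Comp ℝ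
  | [] => do
    step
    pure 0
  | p :: f => do
    step
    let t ← toExt x
    if ← isLeExt t p.hi then
      evalQuad p.q x
    else
      evalPW x f

/-- The sum of two piecewise-quadratic functions, by merging the ordered lists of breakpoints. -/
def addPW : PWQ → PWQ → Comp PWQ
  | [], _ => do
    step
    pure []
  | _ :: _, [] => do
    step
    pure []
  | p :: f, q :: g => do
    step
    let s ← addQuad p.q q.q
    if ← isLtExt p.hi q.hi then do
      let r ← addPW f (q :: g)
      consPiece p.hi s r
    else if ← isLtExt q.hi p.hi then do
      let r ← addPW (p :: f) g
      consPiece q.hi s r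
    else do
      let r ← addPW f g
      consPiece p.hi s r
termination_by f g => f.length + g.length

/-- The quadratic `α ↦ p(κ α)`. -/
def scaleQuad (κ : ℝ) (p : Quad) : Comp Quad := do
  step
  let k ← mul κ κ
  let a ← mul p.a k
  let b ← mul p.b κ
  newQuad a b p.c

/-- The function `α ↦ f(κ α)` for `κ > 0`, where `inv = 1 / κ`. -/
def scalePos (κ inv : ℝ) : PWQ → Comp PWQ
  | [] => do
    step
    pure []
  | p :: f => do
    step
    let hi ← mulExt p.hi inv
    let q ← scaleQuad κ p.q
    let r ← scalePos κ inv f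
    consPiece hi q r

/-- The function `α ↦ f(κ α)` for `κ < 0`, where `inv = 1 / κ`: the order of the pieces is
reversed.  Here `lo` is the left breakpoint of the first remaining piece, and `acc` collects the
pieces that have been treated. -/
def scaleNeg (κ inv : ℝ) (lo : EReal) (acc : PWQ) : PWQ → Comp PWQ
  | [] => do
    step
    pure acc
  | p :: f => do
    step
    let hi ← mulExt lo inv
    let q ← scaleQuad κ p.q
    let acc ← consPiece hi q acc
    scaleNeg κ inv p.hi acc f

/-- The function `α ↦ f(κ α)` for `κ ≠ 0`. -/
def scalePW (κ : ℝ) (f : PWQ) : Comp PWQ := do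
  step
  let inv ← div 1 κ
  if ← isLt 0 κ then
    scalePos κ inv f
  else
    scaleNeg κ inv ⊥ [] f

/-- The function `f - l` for a constant `l`. -/
def shiftPW (l : ℝ) : PWQ → Comp PWQ
  | [] => do
    step
    pure []
  | p :: f => do
    step
    let c ← sub p.q.c l
    let q ← newQuad p.q.a p.q.b c
    let r ← shiftPW l f
    consPiece p.hi q r

/-- The function `p - f` for a quadratic `p`. -/
def subFromQuad (p : Quad) : PWQ → Comp PWQ
  | [] => do
    step
    pure []
  | r :: f => do
    step
    let q ← subQuad p r.q
    let g ← subFromQuad p f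
    consPiece r.hi q g

/-! ## Feasible common tangents and the breakpoint algorithm -/

/-- A quadratic together with the interval on which it is a piece. -/
structure Seg where
  lo : EReal
  hi : EReal
  q : Quad

/-- Whether the tangent of slope `β` touches the quadratic inside the interval of its piece. -/
def touchesInside (k : Seg) (β : ℝ) : Comp Bool := do
  step
  let x ← tangentPoint k.q β
  let t ← toExt x
  if ← isLeExt k.lo t then
    isLeExt t k.hi
  else
    pure false

/-- Whether the tangents of slope `β` touch both quadratics inside the intervals. -/
def feasibleSlope (k l : Seg) (β : ℝ) : Comp Bool := do
  step
  if ← touchesInside k β then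
    touchesInside l β
  else
    pure false

/-- The slope of the feasible common tangent of the pieces `k` and `l` (`k` to the left of `l`).
The slopes of the common tangents of `p_k` and `p_l` are the roots of `p_l^* - p_k^*`; the first
one that is feasible is returned.  If none is feasible, the root at which `p_l^*` overtakes
`p_k^*`, that is, at which `p_l^* - p_k^*` turns from negative to positive, is returned. -/
def slope (k l : Seg) : Comp EReal := do
  step
  let pk ← conjQuad k.q
  let pl ← conjQuad l.q
  let d ← subQuad pl pk
  match ← rootsQuad d with
  | none => instr ⊤
  | some (r₁, r₂) =>
    if ← feasibleSlope k l r₁ then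
      toExt r₁
    else if ← feasibleSlope k l r₂ then
      toExt r₂
    else if ← isLt 0 d.a then
      toExt r₂
    else
      toExt r₁

/-- An entry of the stack of the breakpoint algorithm: a piece (an element of the list `Π`) with
the candidate breakpoint to its left (the corresponding element of the list `Γ`). -/
structure Cand where
  gam : EReal
  seg : Seg

/-- Treats the new piece `j`: the last elements of `Π` and `Γ` are deleted as long as the slope
between the last element of `Π` and `j` is at most the last element of `Γ`; then `j` is added. The
last elements of `Π` and `Γ` are the head of the list. -/
def insertPiece (j : Seg) : List Cand → Comp (List Cand)
  | [] => do
    step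
    store 3 [⟨⊥, j⟩]
  | i :: st => do
    step
    let s ← slope i.seg j
    if ← isLtExt i.gam s then
      store 3 (⟨s, j⟩ :: i :: st)
    else
      insertPiece j st

/-- Treats all pieces from left to right; `lo` is the left breakpoint of the next piece. -/
def scanPieces (lo : EReal) : PWQ → List Cand → Comp (List Cand)
  | [], st => do
    step
    pure st
  | p :: f, st => do
    step
    let j ← store 5 (⟨lo, p.hi, p.q⟩ : Seg)
    let st ← insertPiece j st
    scanPieces p.hi f st

/-- The piecewise-quadratic function whose pieces are the conjugates of the elements of `Π`, with
the elements of `Γ` as breakpoints.  Here `hi` is the right breakpoint of the head of the stack. -/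
def conjFromStack (hi : EReal) (acc : PWQ) : List Cand → Comp PWQ
  | [] => do
    step
    pure acc
  | k :: st => do
    step
    let q ← conjQuad k.seg.q
    let acc ← consPiece hi q acc
    conjFromStack k.gam acc st

/-- Puts `r` in front of `rs` if it lies in the interval from `lo` to `hi`. -/
def consIfInside (lo hi : EReal) (r : ℝ) (rs : List ℝ) : Comp (List ℝ) := do
  step
  let t ← toExt r
  if ← isLeExt lo t then
    if ← isLeExt t hi then
      store 2 (r :: rs)
    else
      pure rs
  else
    pure rs

/-- The list, from left to right, of the roots of `h = m` for a piecewise-quadratic function `h`,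
where `lo` is the left breakpoint of the next piece. -/
def levelRoots (m : ℝ) (lo : EReal) : PWQ → Comp (List ℝ)
  | [] => do
    step
    pure []
  | p :: h => do
    step
    let c ← sub p.q.c m
    let d ← newQuad p.q.a p.q.b c
    let r ← rootsQuad d
    let rest ← levelRoots m p.hi h
    match r with
    | none => pure rest
    | some (r₁, r₂) => do
      let rest ← consIfInside lo p.hi r₂ rest
      consIfInside lo p.hi r₁ rest

/-- The last element of the list `r :: rs`. -/
def lastRoot (r : ℝ) : List ℝ → Comp ℝ
  | [] => do
    step
    pure r
  | s :: rs => do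
    step
    lastRoot s rs

/-- The pieces of `h` on `(-∞, β]`, followed by the pieces `right`. -/
def keepBelow (β : EReal) (right : PWQ) : PWQ → Comp PWQ
  | [] => do
    step
    pure right
  | p :: h => do
    step
    if ← isLtExt p.hi β then do
      let r ← keepBelow β right h
      consPiece p.hi p.q r
    else
      consPiece β p.q right

/-- The pieces of `h` that reach beyond `β`. -/
def dropBelow (β : EReal) : PWQ → Comp PWQ
  | [] => do
    step
    pure []
  | p :: h => do
    step
    if ← isLeExt p.hi β then
      dropBelow β h
    else
      pure (p :: h)

/-- The breakpoint algorithm: from `g`, the conjugate of `g + l·𝟙`, where `𝟙` is `0` at `0` and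
`1` elsewhere.  It computes `g^*`, finds the roots `β₁ < β₂` of `g^* - l = -g(0)`, and returns
`-g(0)` on `[β₁, β₂]` and `g^* - l` elsewhere.  If there are no two such roots, then
`g^* - l ≥ -g(0)` everywhere, and `g^* - l` is returned. -/
def breakpointAlgorithm (g : PWQ) (l : ℝ) : Comp PWQ := do
  step
  let st ← scanPieces ⊥ g []
  let gs ← conjFromStack ⊤ [] st
  let h ← shiftPW l gs
  let g0 ← evalPW 0 g
  let m ← neg g0
  let rs ← levelRoots m ⊥ h
  match rs with
  | [] => pure h
  | β₁ :: rs => do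
    let β₂ ← lastRoot β₁ rs
    if ← isLt β₁ β₂ then do
      let e₁ ← toExt β₁
      let e₂ ← toExt β₂
      let right ← dropBelow e₂ h
      let q ← newQuad 0 0 m
      let right ← consPiece e₂ q right
      keepBelow e₁ right h
    else
      pure h

/-! ## Topological labeling

The tree is oriented towards the root.  The child of a node is its neighbour on the way to the
root; the other neighbours are its parents. -/

/-- The rooted tree: the nodes in topological order (every node before its child, so the root is
last), the child of every node except the root (a dummy value at the root), and the list of
parents of every node. -/
structure Rooted (n : ℕ) where
  order : List (Fin n)
  child : Arr n (Fin n)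
  par : Arr n (List (Fin n))

/-- The neighbours of `u`, apart from `v`, among the nodes of the given list. -/
def neighbours {n : ℕ} (Q : Matrix (Fin n) (Fin n) ℝ) (u v : Fin n) :
    List (Fin n) → Comp (List (Fin n))
  | [] => do
    step
    pure []
  | w :: ws => do
    step
    let rest ← neighbours Q u v ws
    if ← sameNode w u then
      pure rest
    else if ← sameNode w v then
      pure rest
    else do
      let x ← entry Q u w
      if ← isEq x 0 then
        pure rest
      else
        store 2 (w :: rest)

/-- Pushes the pairs `(w, u)`, for `w` in a list, on a stack of pairs (node, child of the node). -/
def pushPairs {n : ℕ} (u : Fin n) : List (Fin n) → List (Fin n × Fin n) →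
    Comp (List (Fin n × Fin n))
  | [], st => do
    step
    pure st
  | w :: ws, st => do
    step
    let st ← store 3 ((w, u) :: st)
    pushPairs u ws st

/-- Graph search with at most the given number of rounds, each of which visits a node. -/
def labelLoop {n : ℕ} (Q : Matrix (Fin n) (Fin n) ℝ) :
    ℕ → List (Fin n × Fin n) → Rooted n → Comp (Rooted n)
  | 0, _, T => do
    step
    pure T
  | _ + 1, [], T => do
    step
    pure T
  | k + 1, (u, v) :: st, T => do
    step
    let ps ← neighbours Q u v (List.finRange n)
    let st ← pushPairs u ps st
    let ord ← store 2 (u :: T.order)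
    let ch ← write T.child u v
    let pa ← write T.par u ps
    labelLoop Q k st ⟨ord, ch, pa⟩

/-- The topological labeling of the support graph of `Q`, rooted at `root`. -/
def topologicalLabeling {n : ℕ} (Q : Matrix (Fin n) (Fin n) ℝ) (root : Fin n) :
    Comp (Rooted n) := do
  step
  let ch ← newArr n root
  let pa ← newArr n []
  let st ← store 3 [(root, root)]
  labelLoop Q n st ⟨[], ch, pa⟩

/-! ## The parametric algorithm over trees -/

/-- `g + ∑ f_v^*(-Q_{uv} α)`, the sum being over the nodes `v` of the given list, where `fs` holds
the conjugates `f_v^*`. -/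
def sumConjugates {n : ℕ} (Q : Matrix (Fin n) (Fin n) ℝ) (u : Fin n) (fs : Arr n PWQ) :
    List (Fin n) → PWQ → Comp PWQ
  | [], g => do
    step
    pure g
  | v :: vs, g => do
    step
    let f ← read fs v
    let x ← entry Q u v
    let κ ← neg x
    let r ← scalePW κ f
    let g ← addPW g r
    sumConjugates Q u fs vs g

/-- The piecewise-quadratic function
`(1/2) Q_{uu} α² + c_u α - ∑_{v ∈ par(u)} f_v^*(-Q_{uv} α)`.  The parametric cost `f_u` is the sum
of this function and `λ_u 𝟙`, and is stored as this function. -/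
def parametricCost {n : ℕ} (Q : Matrix (Fin n) (Fin n) ℝ) (c : Arr n ℝ) (u : Fin n)
    (par : List (Fin n)) (fs : Arr n PWQ) : Comp PWQ := do
  step
  let z ← newQuad 0 0 0
  let g ← consPiece ⊤ z []
  let g ← sumConjugates Q u fs par g
  let a ← entry Q u u
  let a ← div a 2
  let b ← read c u
  let p ← newQuad a b 0
  subFromQuad p g

/-- The first phase: along the topological order, computes and stores `f_u` and `f_u^*`. The
result is the array of the `f_u`. -/
def forwardPass {n : ℕ} (Q : Matrix (Fin n) (Fin n) ℝ) (c lam : Arr n ℝ)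
    (par : Arr n (List (Fin n))) : List (Fin n) → Arr n PWQ → Arr n PWQ → Comp (Arr n PWQ)
  | [], f, _ => do
    step
    pure f
  | u :: us, f, fs => do
    step
    let pa ← read par u
    let fu ← parametricCost Q c u pa fs
    let l ← read lam u
    let fsu ← breakpointAlgorithm fu l
    let f ← write f u fu
    let fs ← write fs u fsu
    forwardPass Q c lam par us f fs

/-- Compares a pair (value, point) with the minima of the functions `p_k(α) + b α + l`, where
`p_k` runs through the pieces of a list, and returns a best pair. -/
def minLoop (b l : ℝ) : PWQ → ℝ × ℝ → Comp (ℝ × ℝ)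
  | [], best => do
    step
    pure best
  | p :: f, best => do
    step
    let s ← neg b
    let x ← tangentPoint p.q s
    let v ← evalQuad p.q x
    let t ← mul b x
    let v ← add v t
    let v ← add v l
    if ← isLt v best.1 then do
      let best ← store 2 (v, x)
      minLoop b l f best
    else
      minLoop b l f best

/-- The minimum of `f(α) + l 𝟙_α + b α` over all `α`, and a point where it is attained, by
comparison of the value at `0` with the minima of the pieces. -/
def minimize (f : PWQ) (l b : ℝ) : Comp (ℝ × ℝ) := do
  step
  let v ← evalPW 0 f
  let best ← store 2 (v, (0 : ℝ))
  minLoop b l f best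

/-- Pushes the elements of a list on the list `J`. -/
def pushNodes {n : ℕ} : List (Fin n) → List (Fin n) → Comp (List (Fin n))
  | [], J => do
    step
    pure J
  | w :: ws, J => do
    step
    let J ← store 2 (w :: J)
    pushNodes ws J

/-- The second phase: as long as `J` is not empty (and for at most the given number of rounds),
takes a node `u` out of `J`, sets `x_u` to a minimizer of
`f_u(α) + Q_{child(u),u} x_{child(u)} α`, and puts `par(u)` into `J`. -/
def backwardPass {n : ℕ} (Q : Matrix (Fin n) (Fin n) ℝ) (lam : Arr n ℝ) (T : Rooted n)
    (f : Arr n PWQ) : ℕ → List (Fin n) → Arr n ℝ → Comp (Arr n ℝ)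
  | 0, _, x => do
    step
    pure x
  | _ + 1, [], x => do
    step
    pure x
  | k + 1, u :: J, x => do
    step
    let v ← read T.child u
    let xv ← read x v
    let y ← entry Q v u
    let b ← mul y xv
    let fu ← read f u
    let l ← read lam u
    let r ← minimize fu l b
    let x ← write x u r.2
    let pa ← read T.par u
    let J ← pushNodes pa J
    backwardPass Q lam T f k J x

/-- The output: an optimal solution `x` and the optimal cost. -/
structure Output (n : ℕ) where
  x : Fin n → ℝ
  cost : ℝ

/-- The parametric algorithm over general trees, for the tree rooted at `root`. -/
def treeAlgorithm {n : ℕ} (Q : Matrix (Fin n) (Fin n) ℝ) (c lam : Fin n → ℝ) (root : Fin n) :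
    Comp (Output n) := do
  step
  let T ← topologicalLabeling Q root
  let f ← newArr n []
  let fs ← newArr n []
  let f ← forwardPass Q c lam T.par T.order f fs
  let fr ← read f root
  let l ← read lam root
  let r ← minimize fr l 0
  let x ← newArr n 0
  let x ← write x root r.2
  let pa ← read T.par root
  let J ← pushNodes pa []
  let x ← backwardPass Q lam T f n J x
  pure ⟨x, r.1⟩

end TreeMIQP

end

/-!
# The parametric algorithm solves the tree problem in quadratic time

Orient the tree towards the root, and write `ch v` for the child of `v` and `𝟙` for the function
that is `0` at `0` and `1` elsewhere.

**Optimality.** Let `F u` be the function `(1/2) Q_{uu} α² + c_u α - ∑_{v ∈ par(u)} FS v (-Q_{uv}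
α)` and let `FS u` be the conjugate of `F u + λ_u 𝟙`. Every node except the root is a parent
exactly once, so the terms `FS v` cancel when the objective is summed up along the tree
(`Oriented.objective_eq`): with `z` the support vector of `x`, the objective at `x` is `F r (x_r) +
λ_r 𝟙(x_r)` plus, for every `v ≠ r`, the gap in Fenchel's inequality for `F v + λ_v 𝟙` at the point
`x_v` and the slope `-Q_{ch v, v} x_{ch v}`. The gaps are nonnegative, so the minimum of `F r + λ_r
𝟙` is a lower bound. The second phase chooses every `x_v` so that its gap vanishes, and the bound
is attained.

**Representation.** Conjugates are stored as pointwise maxima of quadratics whose derivative jumps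
upwards at every breakpoint (`MaxRep`), and the `F u` as pointwise minima of strongly convex
quadratics (`MinRep`). Sums and rescalings preserve the first property, and a quadratic minus a
maximum of quadratics has the second one, provided that curvatures remain positive. For this, let
`D` be the pivots of the elimination of the variables in topological order. They are values of the
positive definite form (`Oriented.exists_pivots`), and inductively all pieces of `F u` have leading
coefficient at least `D u / 2`.

**The breakpoint algorithm.** Given a slope `β`, some piece of `g` has the lowest tangent of slope
`β` and is touched inside its interval; call it active. Except for finitely many `β` its quadratic
is unique. Comparing an active piece with another one shows on which side of `β` their conjugates
cross (`slope_lt_of_active`, `lt_slope_of_active`), although conjugates of different curvature may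
cross twice. Hence the stack never loses an active piece, and the interval assigned to a piece
contains all generic slopes for which it is active (`insertPiece_spec`). By continuity the stack describes
the conjugate of `g` exactly (`conjFromStack_scanPieces`). The conjugate of `g + λ 𝟙` is the
maximum of `g^* - λ` and the constant `-g(0)` (`IsConj.add_indicator`), and since `g^*` is convex
and coercive, the constant prevails exactly between the extreme solutions of `g^* - λ = -g(0)`
(`breakpointAlgorithm_spec`).

**Complexity.** The stack algorithm is linear, because every deletion is paid for by an insertion,
and its output has at most two pieces more than its input (`cost_breakpointAlgorithm`). Merging
lists adds numbers of breakpoints, so that the list of `F u` has fewer than `2 s` pieces when the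
subtree above `u` has `s` nodes. As the lists of parents have fewer than `n` elements altogether,
the first phase consists of `O(n)` operations on lists of `O(n)` pieces; the search and the second
phase are quadratic as well.
-/

noncomputable section

namespace TreeMIQP

/-! ### Costs of programs -/

@[simp] theorem pure_val {α : Type} (x : α) : (pure x : Comp α).val = x := rfl
@[simp] theorem bind_val {α β : Type} (m : Comp α) (f : α → Comp β) :
    (m >>= f).val = (f m.val).val := rfl
@[simp] theorem ite_val {α : Type} (b : Prop) [Decidable b] (m k : Comp α) :
    (if b then m else k).val = if b then m.val else k.val := by split <;> rfl

/-- The program `m` runs within time `B` and memory `B`. -/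
structure Cost {α : Type} (m : Comp α) (B : ℕ) : Prop where
  time_le : m.time ≤ B
  mem_le : m.mem ≤ B

theorem Cost.mono {α : Type} {m : Comp α} {B B' : ℕ} (h : Cost m B) (hB : B ≤ B') : Cost m B' :=
  ⟨h.1.trans hB, h.2.trans hB⟩

theorem Cost.bind {α β : Type} {m : Comp α} {f : α → Comp β} {B₁ B₂ : ℕ}
    (h₁ : Cost m B₁) (h₂ : Cost (f m.val) B₂) : Cost (m >>= f) (B₁ + B₂) :=
  ⟨Nat.add_le_add h₁.1 h₂.1, Nat.add_le_add h₁.2 h₂.2⟩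

theorem Cost.pure {α : Type} (x : α) : Cost (pure x : Comp α) 0 := ⟨le_rfl, le_rfl⟩

theorem Cost.step : Cost step 1 := ⟨le_rfl, le_rfl⟩

theorem Cost.instr {α : Type} (x : α) : Cost (instr x) 1 := ⟨le_rfl, le_rfl⟩

theorem Cost.store {α : Type} (w : ℕ) (x : α) : Cost (store w x) w := ⟨le_rfl, le_rfl⟩

theorem Cost.ite {α : Type} {b : Prop} [Decidable b] {m k : Comp α} {B : ℕ}
    (h₁ : b → Cost m B) (h₂ : ¬b → Cost k B) : Cost (if b then m else k) B := by
  split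
  · exact h₁ ‹_›
  · exact h₂ ‹_›

theorem cost_addQuad (p q : Quad) : Cost (addQuad p q) 7 := ⟨le_rfl, le_rfl⟩
theorem cost_subQuad (p q : Quad) : Cost (subQuad p q) 7 := ⟨le_rfl, le_rfl⟩
theorem cost_evalQuad (p : Quad) (x : ℝ) : Cost (evalQuad p x) 5 := ⟨le_rfl, le_rfl⟩
theorem cost_tangentPoint (p : Quad) (x : ℝ) : Cost (tangentPoint p x) 4 := ⟨le_rfl, le_rfl⟩
theorem cost_conjQuad (p : Quad) : Cost (conjQuad p) 12 := ⟨le_rfl, le_rfl⟩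
theorem cost_scaleQuad (k : ℝ) (p : Quad) : Cost (scaleQuad k p) 7 := ⟨le_rfl, le_rfl⟩

theorem cost_rootsQuad (p : Quad) : Cost (rootsQuad p) 17 := by
  unfold rootsQuad
  refine Cost.step.bind (B₂ := 16) ((Cost.instr _).bind (B₂ := 15)
    (Cost.ite (fun _ => ?_) fun _ => ?_))
  · refine ((Cost.instr _).bind (B₂ := 4) (Cost.ite (fun _ => (Cost.pure _).mono (by simp))
      fun _ => ?_)).mono (by simp)
    exact (Cost.instr _).bind ((Cost.instr _).bind (Cost.store _ _))
  · refine (Cost.instr _).bind (B₂ := 14) ((Cost.instr _).bind (B₂ := 13) ((Cost.instr _).bind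
      (B₂ := 12) ((Cost.instr _).bind (B₂ := 11) ((Cost.instr _).bind (B₂ := 10)
      (Cost.ite (fun _ => (Cost.pure _).mono (by simp)) fun _ => ?_)))))
    exact (Cost.instr _).bind (B₂ := 9) ((Cost.instr _).bind (B₂ := 8) ((Cost.instr _).bind
      (B₂ := 7) ((Cost.instr _).bind (B₂ := 6) ((Cost.instr _).bind (B₂ := 5) ((Cost.instr _).bind
      (B₂ := 4) ((Cost.instr _).bind (B₂ := 3) ((Cost.instr _).bind (B₂ := 2)
      (Cost.ite (fun _ => Cost.store _ _) fun _ => Cost.store _ _))))))))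

theorem cost_touchesInside (k : Seg) (b : ℝ) : Cost (touchesInside k b) 8 := by
  unfold touchesInside
  refine (Cost.step.bind ((cost_tangentPoint _ _).bind ((Cost.instr _).bind
    ((Cost.instr _).bind (Cost.ite (B := 1) (fun _ => Cost.instr _)
      fun _ => (Cost.pure _).mono (by simp)))))).mono (by simp)

theorem cost_feasibleSlope (k l : Seg) (b : ℝ) : Cost (feasibleSlope k l b) 17 := by
  unfold feasibleSlope
  exact Cost.step.bind (B₂ := 16) ((cost_touchesInside _ _).bind (B₂ := 8)
    (Cost.ite (fun _ => cost_touchesInside _ _) fun _ => (Cost.pure _).mono (by simp)))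

theorem cost_slope (k l : Seg) : Cost (slope k l) 86 := by
  unfold slope
  refine (Cost.step.bind ((cost_conjQuad _).bind ((cost_conjQuad _).bind ((cost_subQuad _ _).bind
    ((cost_rootsQuad _).bind (B₂ := 36) ?_))))).mono (by simp)
  split
  · exact (Cost.instr _).mono (by simp)
  · refine ((cost_feasibleSlope _ _ _).bind (Cost.ite (B := 19)
      (fun _ => (Cost.instr _).mono (by simp)) fun _ => ?_)).mono (by simp)
    refine ((cost_feasibleSlope _ _ _).bind (Cost.ite (B := 2)
      (fun _ => (Cost.instr _).mono (by simp)) fun _ => ?_)).mono (by simp)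
    exact ((Cost.instr _).bind (Cost.ite (B := 1) (fun _ => Cost.instr _) fun _ => Cost.instr _))

/-! ### Quadratics and their conjugates -/

namespace Quad

/-- The value of the quadratic at `x`, in Horner form. -/
def eval (p : Quad) (x : ℝ) : ℝ := (p.a * x + p.b) * x + p.c

/-- The derivative of the quadratic at `x`. -/
def slopeAt (p : Quad) (x : ℝ) : ℝ := 2 * p.a * x + p.b

/-- The coefficients of the conjugate of a strongly convex quadratic. -/
def conj (p : Quad) : Quad := ⟨1 / (4 * p.a), -(p.b / (2 * p.a)), p.b * p.b / (4 * p.a) - p.c⟩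

/-- The point where the quadratic has slope `β`. -/
def touch (p : Quad) (β : ℝ) : ℝ := (β - p.b) / (2 * p.a)

/-- The coefficients of the difference of two quadratics. -/
def diff (p q : Quad) : Quad := ⟨p.a - q.a, p.b - q.b, p.c - q.c⟩

/-- The discriminant. -/
def disc (p : Quad) : ℝ := p.b * p.b - 4 * (p.a * p.c)

theorem eval_diff (p q : Quad) (x : ℝ) : (p.diff q).eval x = p.eval x - q.eval x := by
  simp only [eval, diff]; ring

theorem slopeAt_diff (p q : Quad) (x : ℝ) :
    (p.diff q).slopeAt x = p.slopeAt x - q.slopeAt x := by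
  simp only [slopeAt, diff]; ring

theorem eval_taylor (p : Quad) (x y : ℝ) :
    p.eval y = p.eval x + p.slopeAt x * (y - x) + p.a * (y - x) ^ 2 := by
  simp only [eval, slopeAt]; ring

theorem slopeAt_touch {p : Quad} (h : 0 < p.a) (β : ℝ) : p.slopeAt (p.touch β) = β := by
  simp only [slopeAt, touch]; field_simp; ring

theorem touch_slopeAt {p : Quad} (h : 0 < p.a) (x : ℝ) : p.touch (p.slopeAt x) = x := by
  simp only [slopeAt, touch]; field_simp; ring

theorem slopeAt_conj {p : Quad} (h : 0 < p.a) (β : ℝ) : p.conj.slopeAt β = p.touch β := by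
  simp only [slopeAt, touch, conj]; field_simp; ring

theorem touch_lt_touch {p : Quad} (h : 0 < p.a) {β γ : ℝ} (hβ : β < γ) :
    p.touch β < p.touch γ := by
  unfold touch
  gcongr

theorem touch_le_touch {p : Quad} (h : 0 < p.a) {β γ : ℝ} (hβ : β ≤ γ) :
    p.touch β ≤ p.touch γ := by
  unfold touch
  gcongr

/-- The gap in Fenchel's inequality is the quadratic term of `p` around the touching point. -/
theorem fenchel_eq {p : Quad} (h : 0 < p.a) (β x : ℝ) :
    p.conj.eval β = β * x - p.eval x + p.a * (x - p.touch β) ^ 2 := by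
  simp only [eval, touch, conj]; field_simp; ring

theorem fenchel_le {p : Quad} (h : 0 < p.a) (β x : ℝ) : β * x - p.eval x ≤ p.conj.eval β := by
  rw [fenchel_eq h β x]
  have := mul_nonneg h.le (sq_nonneg (x - p.touch β))
  linarith

theorem fenchel_touch {p : Quad} (h : 0 < p.a) (β : ℝ) :
    p.conj.eval β = β * p.touch β - p.eval (p.touch β) := by
  rw [fenchel_eq h β (p.touch β)]; ring

theorem conj_a_pos {p : Quad} (h : 0 < p.a) : 0 < p.conj.a := by
  simp only [conj]; positivity

/-- Common tangents correspond to crossings: the discriminants of the difference of two quadratics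
and of the difference of their conjugates agree up to a positive factor. -/
theorem disc_conj_diff {p q : Quad} (hp : 0 < p.a) (hq : 0 < q.a) :
    (q.conj.diff p.conj).disc = (q.diff p).disc / (4 * p.a * q.a) := by
  simp only [disc, diff, conj]; field_simp; ring

theorem slopeAt_sq_of_root {p : Quad} {x : ℝ} (h : p.eval x = 0) : p.slopeAt x ^ 2 = p.disc := by
  have : p.slopeAt x ^ 2 = p.disc + 4 * p.a * p.eval x := by
    simp only [slopeAt, disc, eval]; ring
  rw [this, h]; ring

/-- A quadratic that is nonnegative at two points and nonpositive at two further points to the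
right vanishes identically, or has positive discriminant and, if it is affine, decreases. -/
theorem disc_pos_of_sign {p : Quad} {y₁ y₂ z₁ z₂ : ℝ} (hy : y₁ < y₂) (hyz : y₂ ≤ z₁)
    (hz : z₁ < z₂) (h₁ : 0 ≤ p.eval y₁) (h₂ : 0 ≤ p.eval y₂) (h₃ : p.eval z₁ ≤ 0)
    (h₄ : p.eval z₂ ≤ 0) :
    (p.a = 0 ∧ p.b = 0 ∧ p.c = 0) ∨ (0 < p.disc ∧ (p.a = 0 → p.b < 0)) := by
  have key : ∀ x, 4 * p.a * p.eval x = p.slopeAt x ^ 2 - p.disc := by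
    intro x; simp only [slopeAt, disc, eval]; ring
  rcases lt_trichotomy p.a 0 with ha | ha | ha
  · right
    refine ⟨?_, fun h => absurd h ha.ne⟩
    by_contra hd
    have k₁ := key y₁
    have k₂ := key y₂
    have e₁ : 4 * p.a * p.eval y₁ ≤ 0 := mul_nonpos_of_nonpos_of_nonneg (by linarith) h₁
    have e₂ : 4 * p.a * p.eval y₂ ≤ 0 := mul_nonpos_of_nonpos_of_nonneg (by linarith) h₂
    have s₁ : p.slopeAt y₁ = 0 := by
      have : p.slopeAt y₁ ^ 2 = 0 := le_antisymm (by linarith) (sq_nonneg _)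
      exact pow_eq_zero_iff (two_ne_zero) |>.1 this
    have s₂ : p.slopeAt y₂ = 0 := by
      have : p.slopeAt y₂ ^ 2 = 0 := le_antisymm (by linarith) (sq_nonneg _)
      exact pow_eq_zero_iff (two_ne_zero) |>.1 this
    simp only [slopeAt] at s₁ s₂
    nlinarith
  · simp only [eval, ha, zero_mul, zero_add] at h₁ h₂ h₃ h₄
    rcases lt_trichotomy p.b 0 with hb | hb | hb
    · right
      refine ⟨?_, fun _ => hb⟩
      simp only [disc, ha]; nlinarith
    · left
      simp only [hb] at h₁ h₃
      exact ⟨ha, hb, by linarith⟩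
    · nlinarith
  · right
    refine ⟨?_, fun h => absurd h ha.ne'⟩
    by_contra hd
    have k₁ := key z₁
    have k₂ := key z₂
    have e₁ : 4 * p.a * p.eval z₁ ≤ 0 := mul_nonpos_of_nonneg_of_nonpos (by linarith) h₃
    have e₂ : 4 * p.a * p.eval z₂ ≤ 0 := mul_nonpos_of_nonneg_of_nonpos (by linarith) h₄
    have s₁ : p.slopeAt z₁ = 0 := by
      have : p.slopeAt z₁ ^ 2 = 0 := le_antisymm (by linarith) (sq_nonneg _)
      exact pow_eq_zero_iff (two_ne_zero) |>.1 this
    have s₂ : p.slopeAt z₂ = 0 := by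
      have : p.slopeAt z₂ ^ 2 = 0 := le_antisymm (by linarith) (sq_nonneg _)
      exact pow_eq_zero_iff (two_ne_zero) |>.1 this
    simp only [slopeAt] at s₁ s₂
    nlinarith

theorem eq_of_diff_eq_zero {p q : Quad} (ha : (q.diff p).a = 0) (hb : (q.diff p).b = 0)
    (hc : (q.diff p).c = 0) : p = q := by
  cases p; cases q
  simp only [diff] at ha hb hc
  simp only [Quad.mk.injEq]
  refine ⟨by linarith, by linarith, by linarith⟩

theorem conj_injective {p q : Quad} (hp : 0 < p.a) (hq : 0 < q.a) (h : p.conj = q.conj) :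
    p = q := by
  cases p; cases q
  simp only [conj, Quad.mk.injEq] at h hp hq ⊢
  obtain ⟨h₁, h₂, h₃⟩ := h
  rename_i a b c a' b' c'
  have ha : a = a' := by field_simp at h₁; linarith
  subst ha
  have hb : b = b' := by field_simp at h₂; linarith
  subst hb
  exact ⟨rfl, rfl, by linarith⟩

/-- Two quadratics with distinct coefficients agree in finitely many points only. -/
theorem finite_eval_eq {p q : Quad} (h : p ≠ q) : {x | p.eval x = q.eval x}.Finite := by
  classical
  let P : Polynomial ℝ := Polynomial.C (q.a - p.a) * Polynomial.X ^ 2 +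
    Polynomial.C (q.b - p.b) * Polynomial.X + Polynomial.C (q.c - p.c)
  have hP : P ≠ 0 := by
    intro h0
    apply h
    have e2 : P.coeff 2 = 0 := by rw [h0]; simp
    have e1 : P.coeff 1 = 0 := by rw [h0]; simp
    have e0 : P.coeff 0 = 0 := by rw [h0]; simp
    simp only [P, Polynomial.coeff_add, Polynomial.coeff_C_mul, Polynomial.coeff_X_pow,
      Polynomial.coeff_X, Polynomial.coeff_C] at e2 e1 e0
    norm_num at e2 e1 e0
    cases p; cases q
    simp only [Quad.mk.injEq]
    simp only at e2 e1 e0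
    refine ⟨by linarith, by linarith, by linarith⟩
  refine (P.roots.toFinset.finite_toSet).subset fun x hx => ?_
  simp only [Finset.mem_coe, Multiset.mem_toFinset, Polynomial.mem_roots hP, Polynomial.IsRoot.def]
  simp only [Set.mem_ofPred_eq, eval] at hx
  simp only [P, Polynomial.eval_add, Polynomial.eval_mul, Polynomial.eval_C, Polynomial.eval_pow,
    Polynomial.eval_X]
  linarith

theorem continuous_eval (p : Quad) : Continuous p.eval := by
  unfold eval; fun_prop

end Quad

@[simp] theorem addQuad_val (p q : Quad) : (addQuad p q).val = ⟨p.a + q.a, p.b + q.b, p.c + q.c⟩ :=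
  rfl
@[simp] theorem subQuad_val (p q : Quad) : (subQuad p q).val = p.diff q := rfl
@[simp] theorem evalQuad_val (p : Quad) (x : ℝ) : (evalQuad p x).val = p.eval x := rfl
@[simp] theorem tangentPoint_val (p : Quad) (β : ℝ) : (tangentPoint p β).val = p.touch β := rfl
@[simp] theorem conjQuad_val (p : Quad) : (conjQuad p).val = p.conj := rfl
@[simp] theorem instr_val {α : Type} (x : α) : (instr x).val = x := rfl
@[simp] theorem store_val {α : Type} (w : ℕ) (x : α) : (store w x).val = x := rfl
@[simp] theorem isLt_val (x y : ℝ) : ((isLt x y).val = true) = (x < y) := by simp [isLt]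
@[simp] theorem isEq_val (x y : ℝ) : ((isEq x y).val = true) = (x = y) := by simp [isEq]
@[simp] theorem isLtExt_val (x y : EReal) : ((isLtExt x y).val = true) = (x < y) := by
  simp [isLtExt]
@[simp] theorem isLeExt_val (x y : EReal) : ((isLeExt x y).val = true) = (x ≤ y) := by
  simp [isLeExt]
@[simp] theorem toExt_val (x : ℝ) : (toExt x).val = (x : EReal) := rfl
@[simp] theorem consPiece_val (hi : EReal) (q : Quad) (f : PWQ) :
    (consPiece hi q f).val = ⟨hi, q⟩ :: f := rfl

/-- The root finder on a quadratic with nonnegative discriminant that is not constant: both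
returned numbers are roots, they are ordered, they exhaust the roots, and the slope at the left
(right) one has the sign opposite (equal) to the leading coefficient. -/
theorem rootsQuad_spec {p : Quad} (hab : p.a ≠ 0 ∨ p.b ≠ 0) (hd : 0 ≤ p.disc) :
    ∃ r₁ r₂, (rootsQuad p).val = some (r₁, r₂) ∧ r₁ ≤ r₂ ∧ p.eval r₁ = 0 ∧ p.eval r₂ = 0 ∧
      (∀ x, p.eval x = 0 → x = r₁ ∨ x = r₂) ∧ (p.a ≠ 0 → p.a * (r₁ + r₂) + p.b = 0) := by
  by_cases ha : p.a = 0
  · have hb : p.b ≠ 0 := hab.resolve_left (not_not_intro ha)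
    have hr : p.eval (-p.c / p.b) = 0 := by
      simp only [Quad.eval, ha]; field_simp; ring
    refine ⟨-p.c / p.b, -p.c / p.b, ?_, le_rfl, hr, hr, fun x hx => ?_, fun h => absurd ha h⟩
    · simp [rootsQuad, ha, hb, neg, div]
    · left
      simp only [Quad.eval, ha] at hx
      field_simp; linarith
  · set s := Real.sqrt p.disc with hs
    have hss : s * s = p.disc := Real.mul_self_sqrt hd
    have hs0 : 0 ≤ s := Real.sqrt_nonneg _
    have fac : ∀ x, 4 * p.a * p.eval x = (2 * p.a * x + p.b - s) * (2 * p.a * x + p.b + s) := by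
      intro x
      have : (2 * p.a * x + p.b - s) * (2 * p.a * x + p.b + s) = (2 * p.a * x + p.b) ^ 2 - s * s :=
        by ring
      rw [this, hss]; simp only [Quad.eval, Quad.disc]; ring
    have h4 : (4 * p.a) ≠ 0 := by simpa using ha
    have r₁ : p.eval ((-p.b - s) / (2 * p.a)) = 0 := by
      have := fac ((-p.b - s) / (2 * p.a))
      have e : 2 * p.a * ((-p.b - s) / (2 * p.a)) + p.b + s = 0 := by field_simp; ring
      rw [e, mul_zero] at this
      exact (mul_eq_zero.1 this).resolve_left h4
    have r₂ : p.eval ((-p.b + s) / (2 * p.a)) = 0 := by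
      have := fac ((-p.b + s) / (2 * p.a))
      have e : 2 * p.a * ((-p.b + s) / (2 * p.a)) + p.b - s = 0 := by field_simp; ring
      rw [e, zero_mul] at this
      exact (mul_eq_zero.1 this).resolve_left h4
    have all : ∀ x, p.eval x = 0 → x = (-p.b - s) / (2 * p.a) ∨ x = (-p.b + s) / (2 * p.a) := by
      intro x hx
      have := fac x
      rw [hx, mul_zero] at this
      rcases mul_eq_zero.1 this.symm with h | h
      · right; field_simp; linarith
      · left; field_simp; linarith
    have sum : p.a * ((-p.b - s) / (2 * p.a) + (-p.b + s) / (2 * p.a)) + p.b = 0 := by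
      field_simp; ring
    have hD : ¬ p.disc < 0 := not_lt.2 hd
    have hD' : ¬ p.b * p.b - 4 * (p.a * p.c) < 0 := hD
    have val : (rootsQuad p).val = if (-p.b - s) / (2 * p.a) < (-p.b + s) / (2 * p.a) then
        some ((-p.b - s) / (2 * p.a), (-p.b + s) / (2 * p.a)) else
        some ((-p.b + s) / (2 * p.a), (-p.b - s) / (2 * p.a)) := by
      simp only [rootsQuad, bind_val, ite_val, isEq_val, isLt_val, ha, if_false, mul, sub,
        instr_val, hD', sqrt, neg, add, div, store_val]
      rfl
    rw [val]
    split_ifs with h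
    · exact ⟨_, _, rfl, h.le, r₁, r₂, all, fun _ => sum⟩
    · exact ⟨_, _, rfl, not_lt.1 h, r₂, r₁, fun x hx => (all x hx).symm, fun _ => by
        rw [add_comm ((-p.b + s) / (2 * p.a))]; exact sum⟩

theorem rootsQuad_eq_none {p : Quad} (h : (p.a = 0 ∧ p.b = 0) ∨ (p.a ≠ 0 ∧ p.disc < 0)) :
    (rootsQuad p).val = none := by
  rcases h with ⟨ha, hb⟩ | ⟨ha, hd⟩
  · simp [rootsQuad, ha, hb]
  · have hD' : p.b * p.b - 4 * (p.a * p.c) < 0 := hd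
    simp only [rootsQuad, bind_val, isEq_val, isLt_val, ha, if_false, mul, sub, instr_val,
        hD', if_true, pure_val]

/-! ### Slopes of common tangents -/

/-- The segment `k` is a piece of the function `g`, has a nondegenerate interval, is strongly
convex and majorizes `g` everywhere. -/
structure Seg.Good (g : ℝ → ℝ) (k : Seg) : Prop where
  lt : k.lo < k.hi
  eq : ∀ x : ℝ, k.lo ≤ x → (x : EReal) ≤ k.hi → k.q.eval x = g x
  le : ∀ x, g x ≤ k.q.eval x
  pos : 0 < k.q.a

/-- The tangent of slope `β` touches the quadratic of `k` inside the interval of `k`. -/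
def Seg.Touches (k : Seg) (β : ℝ) : Prop :=
  k.lo ≤ (k.q.touch β : EReal) ∧ (k.q.touch β : EReal) ≤ k.hi

/-- `s` is the slope that separates the piece `k` from a piece `l` to its right: `⊤` if both pieces
carry the same quadratic, and otherwise the real root at which the conjugate of `l` overtakes the
conjugate of `k`. -/
def IsSlope (k l : Seg) (s : EReal) : Prop :=
  (k.q = l.q ∧ s = ⊤) ∨ ∃ σ : ℝ, s = σ ∧ l.q.conj.eval σ = k.q.conj.eval σ ∧
    k.q.touch σ < l.q.touch σ

theorem Seg.Good.exists_pair {g : ℝ → ℝ} {k : Seg} (h : k.Good g) :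
    ∃ y z : ℝ, y < z ∧ k.lo ≤ y ∧ (z : EReal) ≤ k.hi := by
  obtain ⟨y, hy₁, hy₂⟩ := EReal.lt_iff_exists_real_btwn.1 h.lt
  obtain ⟨z, hz₁, hz₂⟩ := EReal.lt_iff_exists_real_btwn.1 hy₂
  exact ⟨y, z, EReal.coe_lt_coe_iff.1 hz₁, hy₁.le, hz₂.le⟩

theorem coe_le_of_le_of_le {x y : ℝ} {t t' : EReal} (h₁ : (x : EReal) ≤ t) (h : t ≤ t')
    (h₂ : t' ≤ y) : x ≤ y := EReal.coe_le_coe_iff.1 (h₁.trans (h.trans h₂))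

theorem touchesInside_val (k : Seg) (β : ℝ) :
    ((touchesInside k β).val = true) ↔ k.Touches β := by
  simp only [touchesInside, bind_val, tangentPoint_val, toExt_val, ite_val, isLeExt_val, pure_val,
    Seg.Touches]
  split_ifs with h <;> simp [h]

theorem feasibleSlope_val (k l : Seg) (β : ℝ) :
    ((feasibleSlope k l β).val = true) ↔ k.Touches β ∧ l.Touches β := by
  simp only [feasibleSlope, bind_val, ite_val, pure_val, ← touchesInside_val]
  split_ifs with h <;> simp [h]

/-- The two pieces cross, so that either their quadratics agree or there are two common tangents
(one, if the curvatures are equal). -/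
theorem Seg.Good.disc_pos {g : ℝ → ℝ} {k l : Seg} (hk : k.Good g) (hl : l.Good g)
    (hkl : k.hi ≤ l.lo) (hne : k.q ≠ l.q) :
    0 < (l.q.diff k.q).disc ∧ ((l.q.diff k.q).a = 0 → (l.q.diff k.q).b < 0) := by
  obtain ⟨y₁, y₂, hy, hy₁, hy₂⟩ := hk.exists_pair
  obtain ⟨z₁, z₂, hz, hz₁, hz₂⟩ := hl.exists_pair
  have hyz : y₂ ≤ z₁ := coe_le_of_le_of_le hy₂ hkl hz₁
  have hyE : (y₁ : EReal) ≤ y₂ := EReal.coe_le_coe_iff.2 hy.le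
  have hzE : (z₁ : EReal) ≤ z₂ := EReal.coe_le_coe_iff.2 hz.le
  rcases Quad.disc_pos_of_sign (p := l.q.diff k.q) hy hyz hz
    (by rw [Quad.eval_diff, hk.eq y₁ hy₁ (hyE.trans hy₂)]; linarith [hl.le y₁])
    (by rw [Quad.eval_diff, hk.eq y₂ (hy₁.trans hyE) hy₂]; linarith [hl.le y₂])
    (by rw [Quad.eval_diff, hl.eq z₁ hz₁ (hzE.trans hz₂)]; linarith [hk.le z₁])
    (by rw [Quad.eval_diff, hl.eq z₂ (hz₁.trans hzE) hz₂]; linarith [hk.le z₂]) with h | h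
  · exact absurd (Quad.eq_of_diff_eq_zero h.1 h.2.1 h.2.2) hne
  · exact h

/-- The slope routine returns the separating slope. A feasible common tangent is at the root at
which the difference of the conjugates increases, because its touching points are ordered like the
pieces; so it does not matter which branch of the routine delivers the root. -/
theorem slope_spec {g : ℝ → ℝ} {k l : Seg} (hk : k.Good g) (hl : l.Good g)
    (hkl : k.hi ≤ l.lo) : IsSlope k l (slope k l).val := by
  by_cases hq : k.q = l.q
  · left
    refine ⟨hq, ?_⟩
    have h0 : (rootsQuad (l.q.conj.diff k.q.conj)).val = none :=
      rootsQuad_eq_none (Or.inl (by simp [hq, Quad.diff]))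
    simp [slope, h0]
  · right
    obtain ⟨hd, hb⟩ := hk.disc_pos hl hkl hq
    set d := l.q.conj.diff k.q.conj with hdef
    have ha1 := hk.pos
    have ha2 := hl.pos
    have hdisc : 0 < d.disc := by
      rw [hdef, Quad.disc_conj_diff hk.pos hl.pos]; positivity
    have hab : d.a ≠ 0 ∨ d.b ≠ 0 := by
      by_contra hcon
      push Not at hcon
      have : d.disc = 0 := by simp [Quad.disc, hcon.1, hcon.2]
      exact hdisc.ne' this
    obtain ⟨r₁, r₂, hval, hle, e₁, e₂, -, hsum⟩ := rootsQuad_spec hab hdisc.le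
    -- a root at which the difference of the conjugates does not decrease is the wanted one,
    -- since its slope there is a square root of the discriminant
    have main : ∀ r, d.eval r = 0 → 0 ≤ d.slopeAt r →
        l.q.conj.eval r = k.q.conj.eval r ∧ k.q.touch r < l.q.touch r := by
      intro r hr hs
      have h1 : d.slopeAt r = l.q.touch r - k.q.touch r := by
        rw [hdef, Quad.slopeAt_diff, Quad.slopeAt_conj hk.pos, Quad.slopeAt_conj hl.pos]
      have h2 := Quad.slopeAt_sq_of_root hr
      have h3 : d.slopeAt r ≠ 0 := by
        intro h0; rw [h0] at h2; rw [← h2] at hdisc; norm_num at hdisc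
      have h4 : 0 < d.slopeAt r := lt_of_le_of_ne hs h3.symm
      rw [hdef, Quad.eval_diff] at hr
      exact ⟨by linarith, by linarith⟩
    have feas : ∀ r, (feasibleSlope k l r).val = true → 0 ≤ d.slopeAt r := by
      intro r hr
      obtain ⟨h1, h2⟩ := (feasibleSlope_val k l r).1 hr
      rw [hdef, Quad.slopeAt_diff, Quad.slopeAt_conj hk.pos, Quad.slopeAt_conj hl.pos]
      have := coe_le_of_le_of_le h1.2 hkl h2.1
      linarith
    have val : (slope k l).val =
        if (feasibleSlope k l r₁).val = true then (r₁ : EReal) else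
        if (feasibleSlope k l r₂).val = true then (r₂ : EReal) else
        if 0 < d.a then (r₂ : EReal) else (r₁ : EReal) := by
      simp only [slope, bind_val, conjQuad_val, subQuad_val, ← hdef, hval, ite_val,
        toExt_val, isLt_val]
    rw [val]
    split_ifs with c₁ c₂ c₃
    · exact ⟨r₁, rfl, main _ e₁ (feas _ c₁)⟩
    · exact ⟨r₂, rfl, main _ e₂ (feas _ c₂)⟩
    · refine ⟨r₂, rfl, main _ e₂ ?_⟩
      have := hsum c₃.ne'
      simp only [Quad.slopeAt]
      nlinarith
    · refine ⟨r₁, rfl, main _ e₁ ?_⟩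
      rcases (not_lt.1 c₃).lt_or_eq with h | h
      · have := hsum h.ne
        simp only [Quad.slopeAt]
        nlinarith
      · have hla : l.q.a = k.q.a := by
          have h' : 1 / (4 * l.q.a) - 1 / (4 * k.q.a) = 0 := h
          field_simp at h'; linarith
        have hb' : l.q.b - k.q.b < 0 := hb (by simp [Quad.diff, hla])
        have : d.slopeAt r₁ = (k.q.b - l.q.b) / (2 * k.q.a) := by
          rw [hdef, Quad.slopeAt_diff, Quad.slopeAt_conj hk.pos, Quad.slopeAt_conj hl.pos,
            Quad.touch, Quad.touch, hla]
          ring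
        rw [this]
        exact div_nonneg (by linarith) (by linarith)

theorem conj_a_le {p q : Quad} (hp : 0 < p.a) (h : p.a ≤ q.a) : q.conj.a ≤ p.conj.a := by
  simp only [Quad.conj]
  gcongr

/-- If the tangent of slope `β` is lower for the piece `a` than for the earlier piece `i`, and
touches `a` inside its interval, then `a` has overtaken `i` before `β`. -/
theorem slope_lt_of_active {g : ℝ → ℝ} {i a : Seg} (hi : i.Good g) (ha : a.Good g)
    (hia : i.hi ≤ a.lo) {β σ : ℝ} (ht : a.Touches β)
    (hlt : i.q.conj.eval β < a.q.conj.eval β)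
    (hσ : a.q.conj.eval σ = i.q.conj.eval σ) (hσ' : i.q.touch σ < a.q.touch σ) : σ < β := by
  by_contra hcon
  have hcon : β ≤ σ := not_lt.1 hcon
  set d := a.q.conj.diff i.q.conj with hd
  have ev : ∀ x, d.eval x = a.q.conj.eval x - i.q.conj.eval x := Quad.eval_diff _ _
  have sl : ∀ x, d.slopeAt x = a.q.touch x - i.q.touch x := fun x => by
    rw [hd, Quad.slopeAt_diff, Quad.slopeAt_conj hi.pos, Quad.slopeAt_conj ha.pos]
  have hda : d.a = a.q.conj.a - i.q.conj.a := rfl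
  rcases le_total a.q.a i.q.a with h | h
  · -- the difference of the conjugates is convex and does not decrease at `β`
    have hc := conj_a_le ha.pos h
    have hslope : 0 ≤ d.slopeAt β := by
      rw [sl]
      obtain ⟨z, z₂, hz, hz₁, hz₂⟩ := hi.exists_pair
      have hzy : z₂ ≤ a.q.touch β := coe_le_of_le_of_le hz₂ hia ht.1
      have e1 := hi.eq z hz₁ ((EReal.coe_le_coe_iff.2 hz.le).trans hz₂)
      have e2 := ha.eq _ ht.1 ht.2
      have l1 := ha.le z
      have l2 := hi.le (a.q.touch β)
      have t := Quad.eval_taylor (i.q.diff a.q) (a.q.touch β) z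
      rw [Quad.eval_diff, Quad.eval_diff, Quad.slopeAt_diff, Quad.slopeAt_touch ha.pos] at t
      have hDa : (i.q.diff a.q).a = i.q.a - a.q.a := rfl
      rw [hDa] at t
      have hs : β ≤ i.q.slopeAt (a.q.touch β) := by
        by_contra hneg
        push Not at hneg
        nlinarith [mul_nonneg (sub_nonneg.2 h) (sq_nonneg (z - a.q.touch β)),
          mul_pos (sub_pos.2 hneg) (by linarith : 0 < a.q.touch β - z)]
      have : i.q.touch β ≤ i.q.touch (i.q.slopeAt (a.q.touch β)) :=
        Quad.touch_le_touch hi.pos hs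
      rw [Quad.touch_slopeAt hi.pos] at this
      linarith
    have t := Quad.eval_taylor d β σ
    rw [ev, ev, hda] at t
    nlinarith [mul_nonneg hslope (sub_nonneg.2 hcon),
      mul_nonneg (sub_nonneg.2 hc) (sq_nonneg (σ - β))]
  · -- the difference of the conjugates is concave and increases at its root `σ`
    have hc := conj_a_le hi.pos h
    have t := Quad.eval_taylor d σ β
    rw [ev, ev, hda, sl] at t
    nlinarith [mul_nonneg (sub_pos.2 hσ').le (sub_nonneg.2 hcon),
      mul_nonneg (sub_nonneg.2 hc) (sq_nonneg (β - σ))]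

/-- If the tangent of slope `β` is lower for the piece `a` than for the later piece `j`, and
touches `a` inside its interval, then `j` overtakes `a` after `β`. -/
theorem lt_slope_of_active {g : ℝ → ℝ} {a j : Seg} (ha : a.Good g) (hj : j.Good g)
    (haj : a.hi ≤ j.lo) {β σ : ℝ} (ht : a.Touches β)
    (hlt : j.q.conj.eval β < a.q.conj.eval β)
    (hσ : j.q.conj.eval σ = a.q.conj.eval σ) (hσ' : a.q.touch σ < j.q.touch σ) : β < σ := by
  by_contra hcon
  have hcon : σ ≤ β := not_lt.1 hcon
  set d := j.q.conj.diff a.q.conj with hd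
  have ev : ∀ x, d.eval x = j.q.conj.eval x - a.q.conj.eval x := Quad.eval_diff _ _
  have sl : ∀ x, d.slopeAt x = j.q.touch x - a.q.touch x := fun x => by
    rw [hd, Quad.slopeAt_diff, Quad.slopeAt_conj hj.pos, Quad.slopeAt_conj ha.pos]
  have hda : d.a = j.q.conj.a - a.q.conj.a := rfl
  rcases le_total a.q.a j.q.a with h | h
  · -- the difference of the conjugates is concave and does not decrease at `β`
    have hc := conj_a_le ha.pos h
    have hslope : 0 ≤ d.slopeAt β := by
      rw [sl]
      obtain ⟨z, z₂, hz, hz₁, hz₂⟩ := hj.exists_pair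
      have hzy : a.q.touch β ≤ z := coe_le_of_le_of_le ht.2 haj hz₁
      have e1 := hj.eq z₂ (hz₁.trans (EReal.coe_le_coe_iff.2 hz.le)) hz₂
      have e2 := ha.eq _ ht.1 ht.2
      have l1 := ha.le z₂
      have l2 := hj.le (a.q.touch β)
      have t := Quad.eval_taylor (j.q.diff a.q) (a.q.touch β) z₂
      rw [Quad.eval_diff, Quad.eval_diff, Quad.slopeAt_diff, Quad.slopeAt_touch ha.pos] at t
      have hDa : (j.q.diff a.q).a = j.q.a - a.q.a := rfl
      rw [hDa] at t
      have hs : j.q.slopeAt (a.q.touch β) ≤ β := by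
        by_contra hneg
        push Not at hneg
        nlinarith [mul_nonneg (sub_nonneg.2 h) (sq_nonneg (z₂ - a.q.touch β)),
          mul_pos (sub_pos.2 hneg) (by linarith : 0 < z₂ - a.q.touch β)]
      have : j.q.touch (j.q.slopeAt (a.q.touch β)) ≤ j.q.touch β :=
        Quad.touch_le_touch hj.pos hs
      rw [Quad.touch_slopeAt hj.pos] at this
      linarith
    have t := Quad.eval_taylor d β σ
    rw [ev, ev, hda] at t
    nlinarith [mul_nonneg hslope (sub_nonneg.2 hcon),
      mul_nonneg (sub_nonneg.2 hc) (sq_nonneg (σ - β))]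
  · -- the difference of the conjugates is convex and increases at its root `σ`
    have hc := conj_a_le hj.pos h
    have t := Quad.eval_taylor d σ β
    rw [ev, ev, hda, sl] at t
    nlinarith [mul_nonneg (sub_pos.2 hσ').le (sub_nonneg.2 hcon),
      mul_nonneg (sub_nonneg.2 hc) (sq_nonneg (β - σ))]

/-- At the common breakpoint of two adjacent pieces with distinct quadratics the function has a
concave kink. -/
theorem Seg.Good.kink {g : ℝ → ℝ} {i j : Seg} (hi : i.Good g) (hj : j.Good g) {t : ℝ}
    (hit : i.hi = t) (hjt : j.lo = t) (hne : i.q ≠ j.q) : j.q.slopeAt t < i.q.slopeAt t := by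
  have hti : i.q.eval t = g t := hi.eq t (by rw [← hit]; exact hi.lt.le) hit.ge
  have htj : j.q.eval t = g t := hj.eq t hjt.le (by rw [← hjt]; exact hj.lt.le)
  have hd := (hi.disc_pos hj (by rw [hit, hjt]) hne).1
  set D := j.q.diff i.q with hD
  have hroot : D.eval t = 0 := by rw [hD, Quad.eval_diff]; linarith
  have h2 := Quad.slopeAt_sq_of_root hroot
  have h3 : D.slopeAt t ≠ 0 := by
    intro h0; rw [h0] at h2; rw [← h2] at hd; norm_num at hd
  have hs : D.slopeAt t = j.q.slopeAt t - i.q.slopeAt t := Quad.slopeAt_diff _ _ _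
  rcases lt_or_gt_of_ne h3 with h | h
  · linarith
  · exfalso
    -- a point of the interval of `i` or of `j`, depending on the curvature of the difference
    rcases le_total D.a 0 with ha | ha
    · obtain ⟨y, z, hyz, hy, hz⟩ := hi.exists_pair
      have hzt : z ≤ t := EReal.coe_le_coe_iff.1 (hit ▸ hz)
      have e1 := hi.eq y hy ((EReal.coe_le_coe_iff.2 hyz.le).trans hz)
      have l1 := hj.le y
      have T := Quad.eval_taylor D t y
      rw [hroot, hD, Quad.eval_diff, ← hD] at T
      nlinarith [mul_nonneg (neg_nonneg.2 ha) (sq_nonneg (y - t)),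
        mul_pos h (by linarith : 0 < t - y)]
    · obtain ⟨y, z, hyz, hy, hz⟩ := hj.exists_pair
      have hty : t ≤ y := EReal.coe_le_coe_iff.1 (hjt ▸ hy)
      have e1 := hj.eq z (hy.trans (EReal.coe_le_coe_iff.2 hyz.le)) hz
      have l1 := hi.le z
      have T := Quad.eval_taylor D t z
      rw [hroot, hD, Quad.eval_diff, ← hD] at T
      nlinarith [mul_nonneg ha (sq_nonneg (z - t)),
        mul_pos h (by linarith : 0 < z - t)]

/-- For adjacent pieces with distinct quadratics, the separating slope is smaller than the left
derivative at the breakpoint. -/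
theorem slope_lt_slopeAt {g : ℝ → ℝ} {i j : Seg} (hi : i.Good g) (hj : j.Good g) {t : ℝ}
    (hit : i.hi = t) (hjt : j.lo = t) (hne : i.q ≠ j.q) {σ : ℝ}
    (hσ : j.q.conj.eval σ = i.q.conj.eval σ) (hσ' : i.q.touch σ < j.q.touch σ) :
    σ < i.q.slopeAt t := by
  have hk := hi.kink hj hit hjt hne
  have hti : i.q.eval t = g t := hi.eq t (by rw [← hit]; exact hi.lt.le) hit.ge
  have htj : j.q.eval t = g t := hj.eq t hjt.le (by rw [← hjt]; exact hj.lt.le)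
  by_contra hcon
  have hcon := not_lt.1 hcon
  set β := i.q.slopeAt t with hβ
  set d := j.q.conj.diff i.q.conj with hd
  have ev : ∀ x, d.eval x = j.q.conj.eval x - i.q.conj.eval x := Quad.eval_diff _ _
  have sl : ∀ x, d.slopeAt x = j.q.touch x - i.q.touch x := fun x => by
    rw [hd, Quad.slopeAt_diff, Quad.slopeAt_conj hi.pos, Quad.slopeAt_conj hj.pos]
  have hda : d.a = j.q.conj.a - i.q.conj.a := rfl
  have hit' : i.q.touch β = t := Quad.touch_slopeAt hi.pos t
  have hjt' : t < j.q.touch β := by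
    have := Quad.touch_lt_touch hj.pos hk
    rwa [Quad.touch_slopeAt hj.pos] at this
  have hpos : i.q.conj.eval β < j.q.conj.eval β := by
    rw [Quad.fenchel_touch hi.pos, hit', Quad.fenchel_eq hj.pos β t]
    have := mul_pos hj.pos (pow_pos (sub_pos.2 hjt') 2)
    nlinarith
  rcases le_total j.q.a i.q.a with h | h
  · -- the difference of the conjugates is convex, and positive and increasing at `β`
    have hc := conj_a_le hj.pos h
    have t' := Quad.eval_taylor d β σ
    rw [ev, ev, hda, sl, hit'] at t'
    nlinarith [mul_nonneg (sub_pos.2 hjt').le (sub_nonneg.2 hcon),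
      mul_nonneg (sub_nonneg.2 hc) (sq_nonneg (σ - β))]
  · -- the difference of the conjugates is concave and increases at its root `σ`
    have hc := conj_a_le hi.pos h
    have t' := Quad.eval_taylor d σ β
    rw [ev, ev, hda, sl] at t'
    nlinarith [mul_nonneg (sub_pos.2 hσ').le (sub_nonneg.2 hcon),
      mul_nonneg (sub_nonneg.2 hc) (sq_nonneg (β - σ))]

/-! ### The stack of the breakpoint algorithm -/

/-- No two distinct quadratics of the list have conjugates with the same value at `β`. -/
def Generic (all : List Seg) (β : ℝ) : Prop :=
  ∀ k ∈ all, ∀ l ∈ all, k.q.conj.eval β = l.q.conj.eval β → k.q = l.q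

/-- The tangent of slope `β` to the piece `a` touches `a` inside its interval and is lowest among
the tangents of slope `β` to the pieces of the list. -/
structure Active (all : List Seg) (β : ℝ) (a : Seg) : Prop where
  mem : a ∈ all
  touches : a.Touches β
  max : ∀ k ∈ all, k.q.conj.eval β ≤ a.q.conj.eval β

theorem finite_not_generic {all : List Seg} (hpos : ∀ k ∈ all, 0 < k.q.a) :
    {β | ¬ Generic all β}.Finite := by
  have : {β | ¬ Generic all β} ⊆ ⋃ k ∈ {k | k ∈ all}, ⋃ l ∈ {l | l ∈ all ∧ k.q ≠ l.q},
      {β | k.q.conj.eval β = l.q.conj.eval β} := by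
    intro β hβ
    simp only [Set.mem_ofPred_eq, Generic] at hβ
    push Not at hβ
    obtain ⟨k, hk, l, hl, h, hne⟩ := hβ
    simp only [Set.mem_iUnion, Set.mem_ofPred_eq]
    exact ⟨k, hk, l, ⟨hl, hne⟩, h⟩
  refine Set.Finite.subset ?_ this
  refine Set.Finite.biUnion all.finite_toSet fun k hk => ?_
  refine Set.Finite.biUnion (all.finite_toSet.subset fun l hl => hl.1) fun l hl => ?_
  exact Quad.finite_eval_eq fun h => hl.2 (Quad.conj_injective (hpos k hk) (hpos l hl.1) h)

theorem exists_generic {all : List Seg} (hpos : ∀ k ∈ all, 0 < k.q.a) {a b : ℝ} (hab : a < b) :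
    ∃ β, a < β ∧ β < b ∧ Generic all β := by
  obtain ⟨β, hβ, hg⟩ := (Set.Ioo_infinite hab).exists_notMem_finite (finite_not_generic hpos)
  exact ⟨β, hβ.1, hβ.2, by simpa using hg⟩

/-- A piece with the lowest tangent need not be touched inside its interval, but then the piece that
owns the touching point has the same tangent. -/
theorem exists_active {g : ℝ → ℝ} {all : List Seg} (hG : ∀ k ∈ all, k.Good g)
    (hcov : ∀ x : ℝ, ∃ k ∈ all, k.lo ≤ x ∧ (x : EReal) ≤ k.hi) (β : ℝ) :
    ∃ a, Active all β a := by
  classical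
  obtain ⟨k₀, hk₀, -⟩ := hcov 0
  obtain ⟨m, hm, hmax⟩ := Finset.exists_max_image (all.toFinset.image Seg.q)
    (fun q => q.conj.eval β) ⟨k₀.q, Finset.mem_image_of_mem _ (List.mem_toFinset.2 hk₀)⟩
  obtain ⟨m', hm', rfl⟩ := Finset.mem_image.1 hm
  have hmG := hG m' (List.mem_toFinset.1 hm')
  have hmax' : ∀ k ∈ all, k.q.conj.eval β ≤ m'.q.conj.eval β := fun k hk =>
    hmax _ (Finset.mem_image_of_mem _ (List.mem_toFinset.2 hk))
  -- the piece whose interval contains the touching point of a best piece is itself best, with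
  -- the same touching point
  obtain ⟨b, hb, hb₁, hb₂⟩ := hcov (m'.q.touch β)
  have hbG := hG b hb
  have e1 := hbG.eq _ hb₁ hb₂
  have l1 := hmG.le (m'.q.touch β)
  have e2 := Quad.fenchel_touch hmG.pos β
  have e3 := Quad.fenchel_eq hbG.pos β (m'.q.touch β)
  have l2 := hmax' b hb
  have hsq : 0 ≤ b.q.a * (m'.q.touch β - b.q.touch β) ^ 2 :=
    mul_nonneg hbG.pos.le (sq_nonneg _)
  have hz : b.q.a * (m'.q.touch β - b.q.touch β) ^ 2 = 0 := by linarith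
  have ht : m'.q.touch β = b.q.touch β := by
    have h0 := (mul_eq_zero.1 hz).resolve_left hbG.pos.ne'
    have := pow_eq_zero_iff (two_ne_zero) |>.1 h0
    linarith
  refine ⟨b, hb, ⟨ht ▸ hb₁, ht ▸ hb₂⟩, fun k hk => (hmax' k hk).trans ?_⟩
  linarith

/-- The stack, from its top: the candidate breakpoints decrease strictly, each separates the piece
above it from the piece below it, and the lowest one is `-∞`. -/
def StackOK : List Cand → Prop
  | [] => True
  | [e] => e.gam = ⊥
  | e :: e' :: st => (e'.gam < e.gam ∧ e'.seg.hi ≤ e.seg.lo ∧ IsSlope e'.seg e.seg e.gam) ∧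
      StackOK (e' :: st)

/-- The slope `β` lies in the interval that the stack assigns to the piece `a`. -/
def Located (β : ℝ) (a : Seg) : List Cand → Prop
  | [] => False
  | e :: st => (e.seg = a ∧ e.gam < β) ∨ ((β : EReal) < e.gam ∧ Located β a st)

theorem StackOK.tail {e : Cand} {st : List Cand} (h : StackOK (e :: st)) : StackOK st := by
  cases st with
  | nil => trivial
  | cons e' st => exact h.2

theorem IsSlope.ne_bot {k l : Seg} {s : EReal} (h : IsSlope k l s) : s ≠ ⊥ := by
  rcases h with ⟨-, rfl⟩ | ⟨σ, rfl, -⟩ <;> simp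

theorem IsSlope.lt_of_active {g : ℝ → ℝ} {all : List Seg} {i a : Seg} {s : EReal} {β : ℝ}
    (h : IsSlope i a s) (hi : i.Good g) (ha : a.Good g) (hia : i.hi ≤ a.lo)
    (hβ : Generic all β) (hact : Active all β a) (him : i ∈ all) (hne : i.q ≠ a.q) : s < β := by
  rcases h with ⟨h, -⟩ | ⟨σ, rfl, h₁, h₂⟩
  · exact absurd h hne
  · refine EReal.coe_lt_coe_iff.2 (slope_lt_of_active hi ha hia hact.touches ?_ h₁ h₂)
    exact lt_of_le_of_ne (hact.max i him) fun h => hne (hβ i him a hact.mem h)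

theorem IsSlope.gt_of_active {g : ℝ → ℝ} {all : List Seg} {a j : Seg} {s : EReal} {β : ℝ}
    (h : IsSlope a j s) (ha : a.Good g) (hj : j.Good g) (haj : a.hi ≤ j.lo)
    (hβ : Generic all β) (hact : Active all β a) (hjm : j ∈ all) : (β : EReal) < s := by
  rcases h with ⟨-, rfl⟩ | ⟨σ, rfl, h₁, h₂⟩
  · exact EReal.coe_lt_top _
  · refine EReal.coe_lt_coe_iff.2 (lt_slope_of_active ha hj haj hact.touches ?_ h₁ h₂)
    refine lt_of_le_of_ne (hact.max j hjm) fun h => ?_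
    have := hβ j hjm a hact.mem h
    rw [this] at h₂
    exact lt_irrefl _ h₂

/-- The situation in which a new piece `j` is treated: `done` are the earlier and `rest` the later
pieces. -/
structure Scan (g : ℝ → ℝ) (all done : List Seg) (j : Seg) (rest : List Seg) : Prop where
  split : all = done ++ j :: rest
  good : ∀ k ∈ all, k.Good g
  cover : ∀ x : ℝ, ∃ k ∈ all, k.lo ≤ x ∧ (x : EReal) ≤ k.hi
  before : ∀ i ∈ done, i.hi ≤ j.lo
  after : ∀ l ∈ rest, j.hi ≤ l.lo

theorem Scan.mem_all {g : ℝ → ℝ} {all done rest : List Seg} {j : Seg}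
    (h : Scan g all done j rest) {k : Seg} : k ∈ all ↔ k ∈ done ∨ k = j ∨ k ∈ rest := by
  rw [h.split]; simp

/-- The top of the stack never carries the same quadratic as a later active piece `j`. Some piece
strictly between them is lower, so a slope between the slopes of the common quadratic at the right
end of the former and at the left end of `j` belongs to a piece that must be on top of the stack. -/
theorem Scan.quad_ne_of_active {g : ℝ → ℝ} {all done rest : List Seg} {j : Seg}
    (hS : Scan g all done j rest) {e : Cand} {st : List Cand} (he : e.seg ∈ done) {t : ℝ}
    (ht : e.seg.hi = t) (htj : (t : EReal) < j.lo) (hgam : e.gam < (e.seg.q.slopeAt t : EReal))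
    (hloc : ∀ β a, Generic all β → Active all β a → a ∈ done → Located β a (e :: st))
    {β : ℝ} (hβ : Generic all β) (hact : Active all β j) : e.seg.q ≠ j.q := by
  intro hq
  have hiG := hS.good _ (hS.mem_all.2 (Or.inl he))
  have hjG := hS.good _ hact.mem
  have htop : j.lo ≠ ⊤ := fun h => by
    have := hact.touches.1; rw [h] at this; exact absurd this (by simp)
  have hbot : j.lo ≠ ⊥ := fun h => by rw [h] at htj; exact absurd htj (by simp)
  obtain ⟨w, hw⟩ : ∃ w : ℝ, j.lo = w := ⟨j.lo.toReal, (EReal.coe_toReal htop hbot).symm⟩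
  have htw : t < w := by rw [hw] at htj; exact EReal.coe_lt_coe_iff.1 htj
  have hsl : ∀ x y, x < y → e.seg.q.slopeAt x < e.seg.q.slopeAt y := fun x y hxy => by
    have := hiG.pos
    simp only [Quad.slopeAt]
    nlinarith
  have hwβ : e.seg.q.slopeAt w ≤ β := by
    by_contra hcon
    have := Quad.touch_lt_touch hjG.pos (not_le.1 hcon)
    rw [hq, Quad.touch_slopeAt hjG.pos] at this
    have h1 := hact.touches.1
    rw [hw] at h1
    linarith [EReal.coe_le_coe_iff.1 h1]
  obtain ⟨β₀, hlo, hhi, hgen⟩ := exists_generic (all := all) (fun k hk => (hS.good k hk).pos)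
    (hsl t w htw)
  obtain ⟨b, hb⟩ := exists_active hS.good hS.cover β₀
  have hbG := hS.good b hb.mem
  -- the piece `b` that is active for `β₀` can be neither an earlier nor a later one, nor `j`
  rcases hS.mem_all.1 hb.mem with hbd | rfl | hbr
  · have hne : ¬ (β₀ : EReal) < e.gam := fun h =>
      lt_asymm (h.trans hgam) (EReal.coe_lt_coe_iff.2 hlo)
    rcases hloc β₀ b hgen hb hbd with ⟨rfl, -⟩ | ⟨h, -⟩
    · have h1 := hb.touches.2
      rw [ht] at h1
      have h2 := Quad.touch_lt_touch hiG.pos hlo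
      rw [Quad.touch_slopeAt hiG.pos] at h2
      linarith [EReal.coe_le_coe_iff.1 h1]
    · exact hne h
  · have h1 := hb.touches.1
    rw [hw] at h1
    have h2 := Quad.touch_lt_touch hjG.pos hhi
    rw [hq, Quad.touch_slopeAt hjG.pos] at h2
    linarith [EReal.coe_le_coe_iff.1 h1]
  · have hjb := hS.after b hbr
    by_cases hjq : j.q = b.q
    · have h1 := coe_le_of_le_of_le hact.touches.2 hjb hb.touches.1
      have h2 := Quad.touch_lt_touch hbG.pos (hhi.trans_le hwβ)
      rw [hjq] at h1
      linarith
    · have hs := slope_spec hjG hbG hjb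
      have h1 := hs.gt_of_active hjG hbG hjb hβ hact hb.mem
      have h2 := hs.lt_of_active hjG hbG hjb hgen hb hact.mem hjq
      have := EReal.coe_lt_coe_iff.1 (h1.trans h2)
      linarith

/-- A round of the stack algorithm keeps every active piece in its place: a deleted piece is active
for no generic slope, and the slope between the remaining top and `j` separates the slopes for
which `j` is active from those for which an earlier piece is. The breakpoints on the stack are
bounded by left derivatives (`hgam`), which rules out a top with the same quadratic as `j`. -/
theorem insertPiece_spec {g : ℝ → ℝ} {all done rest : List Seg} {j : Seg}
    (hS : Scan g all done j rest) (st : List Cand) (hne : st ≠ []) (hok : StackOK st)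
    (hmem : ∀ e ∈ st, e.seg ∈ done)
    (hgam : ∀ e ∈ st, ∃ t : ℝ, e.seg.hi = t ∧
      ((e.gam < (e.seg.q.slopeAt t : EReal) ∧ (t : EReal) < j.lo) ∨
        (j.lo = t ∧ e.seg.q ≠ j.q)))
    (hloc : ∀ β a, Generic all β → Active all β a → a ∈ done → Located β a st) :
    ∃ s st', (insertPiece j st).val = ⟨s, j⟩ :: st' ∧ StackOK (⟨s, j⟩ :: st') ∧
      (∀ e ∈ st', e.seg ∈ done ∧ ∃ t : ℝ, e.seg.hi = t ∧ e.gam < (e.seg.q.slopeAt t : EReal)) ∧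
      ∀ β a, Generic all β → Active all β a → a ∈ done ∨ a = j →
        Located β a (⟨s, j⟩ :: st') := by
  induction st with
  | nil => exact absurd rfl hne
  | cons i st ih =>
    have hjm : j ∈ all := hS.mem_all.2 (Or.inr (Or.inl rfl))
    have him : i.seg ∈ all := hS.mem_all.2 (Or.inl (hmem i List.mem_cons_self))
    have hiG := hS.good _ him
    have hjG := hS.good _ hjm
    have hij := hS.before _ (hmem i List.mem_cons_self)
    have hs := slope_spec hiG hjG hij
    set s := (slope i.seg j).val with hsdef
    have hval : (insertPiece j (i :: st)).val =
        if i.gam < s then ⟨s, j⟩ :: i :: st else (insertPiece j st).val := by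
      simp only [insertPiece, bind_val, ite_val, isLtExt_val, store_val]
      rfl
    rw [hval]
    split_ifs with hlt
    · refine ⟨s, i :: st, rfl, ⟨⟨hlt, hij, hs⟩, hok⟩, fun e he => ⟨hmem e he, ?_⟩, ?_⟩
      · obtain ⟨t, ht, h | ⟨hjt, hq⟩⟩ := hgam e he
        · exact ⟨t, ht, h.1⟩
        · -- only the top of the stack is adjacent to `j`
          refine ⟨t, ht, ?_⟩
          rcases List.mem_cons.1 he with rfl | he'
          · refine hlt.trans ?_
            rcases hs with ⟨h, -⟩ | ⟨σ, h, h₁, h₂⟩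
            · exact absurd h hq
            · rw [h]
              exact EReal.coe_lt_coe_iff.2 (slope_lt_slopeAt hiG hjG ht hjt hq h₁ h₂)
          · exfalso
            have below : ∀ (st : List Cand) (i : Cand), StackOK (i :: st) →
                (∀ e ∈ i :: st, e.seg.Good g) → ∀ e ∈ st, e.seg.hi ≤ i.seg.lo := by
              intro st
              induction st with
              | nil => intro i _ _ e he; simp at he
              | cons i' st ih' =>
                intro i hok hg e he
                rcases List.mem_cons.1 he with rfl | he
                · exact hok.1.2.1
                · exact (ih' i' hok.2 (fun e he => hg e (List.mem_cons_of_mem _ he)) e he).trans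
                    ((hg i' (by simp)).lt.le.trans hok.1.2.1)
            have h1 := below st i hok
              (fun e he => hS.good _ (hS.mem_all.2 (Or.inl (hmem e he)))) e he'
            have h2 := h1.trans_lt (hiG.lt.trans_le hij)
            rw [ht, hjt] at h2
            exact lt_irrefl _ h2
      · intro β a hβ hact ha
        rcases ha with ha | rfl
        · have hl := hloc β a hβ hact ha
          refine Or.inr ⟨?_, hl⟩
          rcases hl with ⟨rfl, -⟩ | ⟨h, -⟩
          · exact hs.gt_of_active hiG hjG hij hβ hact hjm
          · exact h.trans hlt
        · refine Or.inl ⟨rfl, ?_⟩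
          have hq : i.seg.q ≠ a.q := by
            obtain ⟨t, ht, h | h⟩ := hgam i List.mem_cons_self
            · exact hS.quad_ne_of_active (hmem i List.mem_cons_self) ht h.2 h.1 hloc hβ hact
            · exact h.2
          exact hs.lt_of_active hiG hjG hij hβ hact him hq
    · -- a deleted piece could be active only above its breakpoint and below the slope `s`
      have hpop : ∀ β a, Generic all β → Active all β a → a ∈ done → Located β a st := by
        intro β a hβ hact ha
        rcases hloc β a hβ hact ha with ⟨rfl, h⟩ | ⟨-, h⟩
        · exact absurd (h.trans (hs.gt_of_active hiG hjG hij hβ hact hjm)) hlt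
        · exact h
      refine ih ?_ hok.tail (fun e he => hmem e (List.mem_cons_of_mem _ he))
        (fun e he => hgam e (List.mem_cons_of_mem _ he)) hpop
      rintro rfl
      have hb : i.gam = ⊥ := hok
      rw [hb] at hlt
      exact hlt (bot_lt_iff_ne_bot.2 hs.ne_bot)

/-- The state of the stack after the pieces `done` have been treated: the last piece is on top, and
every active piece is in its place. -/
structure StackInv (all done : List Seg) (st : List Cand) : Prop where
  ok : StackOK st
  head : done.getLast? = st.head?.map Cand.seg
  mem : ∀ e ∈ st, e.seg ∈ done
  tail : ∀ e ∈ st.tail, ∃ t : ℝ, e.seg.hi = t ∧ e.gam < (e.seg.q.slopeAt t : EReal)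
  loc : ∀ β a, Generic all β → Active all β a → a ∈ done → Located β a st

theorem StackInv.insert {g : ℝ → ℝ} {all done rest : List Seg} {j : Seg}
    (hS : Scan g all done j rest) {st : List Cand} (h : StackInv all done st)
    (hadj : ∀ i ∈ done.getLast?, i.hi = j.lo ∧ i.q ≠ j.q)
    (hlt : ∀ i ∈ done.dropLast, i.hi < j.lo)
    (htail : ∀ e ∈ st.tail, e.seg ∈ done.dropLast) :
    StackInv all (done ++ [j]) (insertPiece j st).val ∧
      ∀ e ∈ (insertPiece j st).val.tail, e.seg ∈ done := by
  have hjm : j ∈ all := hS.mem_all.2 (Or.inr (Or.inl rfl))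
  cases st with
  | nil =>
    have hd : done = [] := by simpa using h.head
    subst hd
    have hval : (insertPiece j []).val = [⟨⊥, j⟩] := rfl
    rw [hval]
    refine ⟨⟨rfl, by simp, by simp, by simp, fun β a _ _ ha => ?_⟩, by simp⟩
    exact Or.inl ⟨(by simpa using ha : a = j).symm, EReal.bot_lt_coe _⟩
  | cons e st =>
    have hg : ∀ e' ∈ e :: st, ∃ t : ℝ, e'.seg.hi = t ∧
        ((e'.gam < (e'.seg.q.slopeAt t : EReal) ∧ (t : EReal) < j.lo) ∨
          (j.lo = t ∧ e'.seg.q ≠ j.q)) := by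
      intro e' he'
      rcases List.mem_cons.1 he' with rfl | he'
      · obtain ⟨h1, h2⟩ := hadj e'.seg (by rw [h.head]; simp)
        have hjG := hS.good _ hjm
        have heG := hS.good _ (hS.mem_all.2 (Or.inl (h.mem e' List.mem_cons_self)))
        have hb : j.lo ≠ ⊥ := by rw [← h1]; exact (bot_le.trans_lt heG.lt).ne'
        have ht : j.lo ≠ ⊤ := (hjG.lt.trans_le le_top).ne
        have e := (EReal.coe_toReal ht hb).symm
        exact ⟨j.lo.toReal, h1.trans e, Or.inr ⟨e, h2⟩⟩
      · obtain ⟨t, ht, h2⟩ := h.tail e' he'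
        exact ⟨t, ht, Or.inl ⟨h2, ht ▸ hlt _ (htail e' he')⟩⟩
    obtain ⟨s, st', hval, hok', hmem', hloc'⟩ :=
      insertPiece_spec hS (e :: st) (by simp) h.ok h.mem hg h.loc
    rw [hval]
    refine ⟨⟨hok', by simp, ?_, fun e he => (hmem' e he).2, fun β a hβ ha hm =>
      hloc' β a hβ ha (by simpa using hm)⟩, fun e he => (hmem' e he).1⟩
    intro e' he'
    rcases List.mem_cons.1 he' with rfl | he'
    · simp
    · exact List.mem_append_left _ (hmem' e' he').1

/-! ### Representations of piecewise-quadratic functions -/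

/-- The list represents `F` to the right of `lo`: its breakpoints increase strictly from `lo` to
`+∞`, and every quadratic agrees with `F` on its interval. -/
def Rep (F : ℝ → ℝ) : EReal → PWQ → Prop
  | lo, [] => lo = ⊤
  | lo, p :: l => lo < p.hi ∧
      (∀ x : ℝ, lo ≤ x → (x : EReal) ≤ p.hi → p.q.eval x = F x) ∧ Rep F p.hi l

/-- The list represents `g` as a pointwise minimum of strongly convex quadratics, and adjacent
pieces are distinct. -/
structure MinRep (g : ℝ → ℝ) (l : PWQ) : Prop where
  rep : Rep g ⊥ l
  le : ∀ p ∈ l, ∀ x, g x ≤ p.q.eval x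
  pos : ∀ p ∈ l, 0 < p.q.a
  ne : l.IsChain fun p q => p.q ≠ q.q

/-- The derivative increases strictly at every breakpoint of the list. -/
def Kinked (l : PWQ) : Prop :=
  l.IsChain fun p q : Piece => ∀ t : ℝ, p.hi = (t : EReal) → p.q.slopeAt t < q.q.slopeAt t

/-- The list represents `F` as a pointwise maximum of quadratics, with strictly convex kinks. -/
structure MaxRep (F : ℝ → ℝ) (l : PWQ) : Prop where
  rep : Rep F ⊥ l
  le : ∀ p ∈ l, ∀ x, p.q.eval x ≤ F x
  kinked : Kinked l

/-- `G` is the conjugate of `g`, and the supremum in its definition is attained. -/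
structure IsConj (g G : ℝ → ℝ) : Prop where
  le : ∀ β α, β * α - g α ≤ G β
  attained : ∀ β, ∃ α, G β = β * α - g α

/-- The pieces of a list together with their left breakpoints; `lo` is the first one. -/
def segs : EReal → PWQ → List Seg
  | _, [] => []
  | lo, p :: l => ⟨lo, p.hi, p.q⟩ :: segs p.hi l

theorem segs_pairwise {g : ℝ → ℝ} {l : PWQ} {lo : EReal} (h : Rep g lo l) :
    (segs lo l).Pairwise (fun k m => k.hi ≤ m.lo) ∧ ∀ k ∈ segs lo l, lo ≤ k.lo ∧ k.lo < k.hi ∧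
      ∀ x : ℝ, k.lo ≤ x → (x : EReal) ≤ k.hi → k.q.eval x = g x := by
  induction l generalizing lo with
  | nil => simp [segs]
  | cons p l ih =>
    obtain ⟨h₁, h₂, h₃⟩ := h
    obtain ⟨i₁, i₂⟩ := ih h₃
    simp only [segs, List.pairwise_cons, List.forall_mem_cons]
    exact ⟨⟨fun k hk => (i₂ k hk).1, i₁⟩, ⟨le_rfl, h₁, h₂⟩,
      fun k hk => ⟨h₁.le.trans (i₂ k hk).1, (i₂ k hk).2⟩⟩

theorem segs_cover {g : ℝ → ℝ} {l : PWQ} {lo : EReal} (h : Rep g lo l) (x : ℝ) (hx : lo ≤ x) :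
    ∃ k ∈ segs lo l, k.lo ≤ x ∧ (x : EReal) ≤ k.hi := by
  induction l generalizing lo with
  | nil => rw [show lo = ⊤ from h] at hx; exact absurd hx (by simp)
  | cons p l ih =>
    rcases le_total (x : EReal) p.hi with hp | hp
    · exact ⟨_, List.mem_cons_self, hx, hp⟩
    · obtain ⟨k, hk, h'⟩ := ih h.2.2 hp
      exact ⟨k, List.mem_cons_of_mem _ hk, h'⟩

theorem exists_piece_of_mem_segs {l : PWQ} {lo : EReal} {k : Seg} (hk : k ∈ segs lo l) :
    ∃ p ∈ l, k.q = p.q := by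
  induction l generalizing lo with
  | nil => simp [segs] at hk
  | cons p l ih =>
    rcases List.mem_cons.1 hk with rfl | hk
    · exact ⟨p, by simp, rfl⟩
    · obtain ⟨p', hp', h⟩ := ih hk
      exact ⟨p', List.mem_cons_of_mem _ hp', h⟩

theorem segs_chain {l : PWQ} {lo : EReal} (h : l.IsChain fun p q => p.q ≠ q.q) :
    (segs lo l).IsChain fun k m => k.hi = m.lo ∧ k.q ≠ m.q := by
  induction l generalizing lo with
  | nil => simp [segs]
  | cons p l ih =>
    cases l with
    | nil => simp [segs]
    | cons p' l =>
      rw [List.isChain_cons_cons] at h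
      have := ih (lo := p.hi) h.2
      simp only [segs] at this ⊢
      exact List.isChain_cons_cons.2 ⟨⟨rfl, h.1⟩, this⟩

theorem segs_ne_nil {l : PWQ} {lo : EReal} (h : l ≠ []) : segs lo l ≠ [] := by
  cases l with
  | nil => exact absurd rfl h
  | cons p l => simp [segs]

theorem MinRep.good {g : ℝ → ℝ} {l : PWQ} (h : MinRep g l) : ∀ k ∈ segs ⊥ l, k.Good g := by
  intro k hk
  obtain ⟨-, h₁, h₂⟩ := (segs_pairwise h.rep).2 k hk
  obtain ⟨p, hp, hq⟩ := exists_piece_of_mem_segs hk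
  exact ⟨h₁, h₂, hq ▸ h.le p hp, hq ▸ h.pos p hp⟩

theorem Rep.ne_nil {g : ℝ → ℝ} {l : PWQ} (h : Rep g ⊥ l) : l ≠ [] := by
  rintro rfl
  exact bot_ne_top h

theorem scanPieces_spec {g : ℝ → ℝ} {all : List Seg} (hG : ∀ k ∈ all, k.Good g)
    (hcov : ∀ x : ℝ, ∃ k ∈ all, k.lo ≤ x ∧ (x : EReal) ≤ k.hi)
    (hp : all.Pairwise fun k m => k.hi ≤ m.lo)
    (hc : all.IsChain fun k m => k.hi = m.lo ∧ k.q ≠ m.q) (l : PWQ) (lo : EReal)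
    (done : List Seg) (st : List Cand) (hall : all = done ++ segs lo l)
    (hst : StackInv all done st) (htail : ∀ e ∈ st.tail, e.seg ∈ done.dropLast) :
    StackInv all all (scanPieces lo l st).val := by
  induction l generalizing lo done st with
  | nil =>
    have : all = done := by simpa [segs] using hall
    subst this
    exact hst
  | cons p l ih =>
    have hval : (scanPieces lo (p :: l) st).val =
        (scanPieces p.hi l (insertPiece ⟨lo, p.hi, p.q⟩ st).val).val := rfl
    rw [hval]
    simp only [segs] at hall
    have hp' := hp
    have hc' := hc
    rw [hall, List.pairwise_append] at hp'
    rw [hall, List.isChain_append] at hc'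
    have hS : Scan g all done ⟨lo, p.hi, p.q⟩ (segs p.hi l) :=
      ⟨hall, hG, hcov, fun i hi => hp'.2.2 i hi _ List.mem_cons_self,
        (List.pairwise_cons.1 hp'.2.1).1⟩
    have hadj : ∀ i ∈ done.getLast?, i.hi = lo ∧ i.q ≠ p.q := fun i hi =>
      hc'.2.2 i hi ⟨lo, p.hi, p.q⟩ (by simp)
    have hlt : ∀ i ∈ done.dropLast, i.hi < lo := by
      intro i hi
      have hne : done ≠ [] := by rintro rfl; simp at hi
      have hsplit := List.dropLast_append_getLast hne
      have hpd := hp'.1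
      rw [← hsplit, List.pairwise_append] at hpd
      have h1 := hpd.2.2 i hi _ (List.mem_singleton_self _)
      have hlast : done.getLast hne ∈ done := List.getLast_mem hne
      exact h1.trans_lt ((hG _ (hS.mem_all.2 (Or.inl hlast))).lt.trans_le (hS.before _ hlast))
    obtain ⟨h1, h2⟩ := hst.insert hS hadj hlt htail
    exact ih p.hi (done ++ [⟨lo, p.hi, p.q⟩]) _ (by simpa using hall) h1 (by simpa using h2)

/-- A closed condition that holds for all but finitely many points of an interval holds on the
closed interval. -/
theorem mem_of_cofinite {lo hi : EReal} (hlt : lo < hi) {S C : Set ℝ} (hS : S.Finite)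
    (hC : IsClosed C) (h : ∀ x : ℝ, lo < x → (x : EReal) < hi → x ∉ S → x ∈ C) {x : ℝ}
    (hx : lo ≤ x) (hx' : (x : EReal) ≤ hi) : x ∈ C := by
  by_contra hxC
  obtain ⟨ε, hε, hball⟩ := Metric.isOpen_iff.1 hC.isOpen_compl x hxC
  have hmax : max lo ((x - ε : ℝ) : EReal) < min hi ((x + ε : ℝ) : EReal) := by
    have h1 : ((x - ε : ℝ) : EReal) < x := EReal.coe_lt_coe_iff.2 (by linarith)
    have h2 : (x : EReal) < ((x + ε : ℝ) : EReal) := EReal.coe_lt_coe_iff.2 (by linarith)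
    exact max_lt (lt_min hlt (hx.trans_lt h2)) (lt_min (h1.trans_le hx') (h1.trans h2))
  obtain ⟨a, ha, hab⟩ := EReal.lt_iff_exists_real_btwn.1 hmax
  obtain ⟨b, hb, hbm⟩ := EReal.lt_iff_exists_real_btwn.1 hab
  obtain ⟨y, hy, hyS⟩ :=
    (Set.Ioo_infinite (EReal.coe_lt_coe_iff.1 hb)).exists_notMem_finite hS
  have hay : (a : EReal) < y := EReal.coe_lt_coe_iff.2 hy.1
  have hyb : (y : EReal) < b := EReal.coe_lt_coe_iff.2 hy.2
  have h1 := ha.trans hay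
  have h2 := hyb.trans hbm
  refine hball ?_ (h y ((le_max_left _ _).trans_lt h1) (h2.trans_le (min_le_left _ _)) hyS)
  rw [Metric.mem_ball, Real.dist_eq, abs_lt]
  have h3 := EReal.coe_lt_coe_iff.1 ((le_max_right _ _).trans_lt h1)
  have h4 := EReal.coe_lt_coe_iff.1 (h2.trans_le (min_le_right _ _))
  exact ⟨by linarith, by linarith⟩

theorem conj_eval_le {g G : ℝ → ℝ} (h : IsConj g G) {q : Quad} (hq : 0 < q.a)
    (hle : ∀ x, g x ≤ q.eval x) (β : ℝ) : q.conj.eval β ≤ G β := by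
  rw [Quad.fenchel_touch hq]
  exact le_trans (by linarith [hle (q.touch β)]) (h.le β (q.touch β))

/-- On the interval of a stack entry the conjugate of its quadratic agrees with `G`: for generic
slopes because the entry is active, and for all slopes by continuity. -/
theorem conjFromStack_spec {g G : ℝ → ℝ} {all : List Seg} (hG : ∀ k ∈ all, k.Good g)
    (hcov : ∀ x : ℝ, ∃ k ∈ all, k.lo ≤ x ∧ (x : EReal) ≤ k.hi) (hconj : IsConj g G)
    (st : List Cand) (hi : EReal) (acc : PWQ) (hok : StackOK st) (hne : st ≠ [])
    (hmem : ∀ e ∈ st, e.seg ∈ all) (htop : ∀ e ∈ st.head?, e.gam < hi) (hacc : Rep G hi acc)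
    (hkink : Kinked acc) (hhead : ∀ e ∈ st.head?, ∀ p ∈ acc.head?, ∀ t : ℝ, hi = t →
      e.seg.q.conj.slopeAt t < p.q.slopeAt t)
    (hloc : ∀ β a, Generic all β → Active all β a → (β : EReal) < hi → Located β a st) :
    Rep G ⊥ (conjFromStack hi acc st).val ∧ Kinked (conjFromStack hi acc st).val := by
  induction st generalizing hi acc with
  | nil => exact absurd rfl hne
  | cons e st ih =>
    have heG := hG e.seg (hmem e List.mem_cons_self)
    have hlt : e.gam < hi := htop e (by simp)
    have hrep : ∀ x : ℝ, e.gam ≤ x → (x : EReal) ≤ hi → e.seg.q.conj.eval x = G x := by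
      intro x hx hx'
      refine le_antisymm (conj_eval_le hconj heG.pos heG.le x) ?_
      obtain ⟨α, hα⟩ := hconj.attained x
      rw [hα]
      have hcl : IsClosed {β : ℝ | β * α - g α ≤ e.seg.q.conj.eval β} :=
        isClosed_le (by fun_prop) (Quad.continuous_eval _)
      refine mem_of_cofinite hlt (finite_not_generic (all := all) fun k hk => (hG k hk).pos) hcl
        (fun β h₁ h₂ hgen => ?_) hx hx'
      have hgen : Generic all β := by simpa using hgen
      obtain ⟨a, ha⟩ := exists_active hG hcov β
      rcases hloc β a hgen ha h₂ with ⟨h, -⟩ | ⟨h, -⟩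
      · rw [h]
        obtain ⟨k, hk, hk₁, hk₂⟩ := hcov α
        have hkG := hG k hk
        rw [Set.mem_ofPred_eq, ← hkG.eq α hk₁ hk₂]
        exact (Quad.fenchel_le hkG.pos β α).trans (ha.max k hk)
      · exact absurd h₁ (not_lt.2 h.le)
    have hval : (conjFromStack hi acc (e :: st)).val =
        (conjFromStack e.gam (⟨hi, e.seg.q.conj⟩ :: acc) st).val := rfl
    rw [hval]
    have hacc' : Rep G e.gam (⟨hi, e.seg.q.conj⟩ :: acc) := ⟨hlt, hrep, hacc⟩
    have hkink' : Kinked (⟨hi, e.seg.q.conj⟩ :: acc) := by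
      rw [Kinked, List.isChain_cons]
      exact ⟨fun p hp t ht => hhead e (by simp) p hp t ht, hkink⟩
    cases st with
    | nil =>
      have hb : e.gam = ⊥ := hok
      rw [hb] at hacc' ⊢
      exact ⟨hacc', hkink'⟩
    | cons e' st =>
      have he'G := hG e'.seg (hmem e' (by simp))
      obtain ⟨⟨h₁, h₂, h₃⟩, h₄⟩ := hok
      refine ih e.gam _ h₄ (by simp) (fun e he => hmem e (List.mem_cons_of_mem _ he)) ?_ hacc'
        hkink' ?_ ?_
      · intro f hf
        simp only [List.head?_cons, Option.mem_def, Option.some.injEq] at hf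
        exact hf ▸ h₁
      · intro f hf p hp t ht
        simp only [List.head?_cons, Option.mem_def, Option.some.injEq] at hf hp
        subst hf hp
        rw [Quad.slopeAt_conj he'G.pos, Quad.slopeAt_conj heG.pos]
        rcases h₃ with ⟨-, h⟩ | ⟨σ, h, -, h'⟩
        · rw [h] at ht; exact absurd ht (by simp)
        · rw [h] at ht
          exact EReal.coe_injective ht ▸ h'
      · intro β a hgen ha hβ
        rcases hloc β a hgen ha (hβ.trans hlt) with ⟨-, h⟩ | ⟨-, h⟩
        · exact absurd h (not_lt.2 hβ.le)
        · exact h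

theorem mem_conjFromStack {st : List Cand} {hi : EReal} {acc : PWQ} {p : Piece}
    (hp : p ∈ (conjFromStack hi acc st).val) : p ∈ acc ∨ ∃ e ∈ st, p.q = e.seg.q.conj := by
  induction st generalizing hi acc with
  | nil => exact Or.inl hp
  | cons e st ih =>
    rcases ih (hi := e.gam) (acc := ⟨hi, e.seg.q.conj⟩ :: acc) hp with h | ⟨e', he', h⟩
    · rcases List.mem_cons.1 h with rfl | h
      · exact Or.inr ⟨e, by simp, rfl⟩
      · exact Or.inl h
    · exact Or.inr ⟨e', List.mem_cons_of_mem _ he', h⟩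

/-- For large slopes only an unbounded piece can be active. -/
theorem exists_active_hi_eq_top {all : List Seg} (hpos : ∀ k ∈ all, 0 < k.q.a) :
    ∃ M : ℝ, ∀ β a, M < β → Active all β a → a.hi = ⊤ := by
  classical
  obtain ⟨M, hM⟩ := (all.toFinset.image fun k : Seg => k.q.slopeAt k.hi.toReal).bddAbove
  refine ⟨M, fun β a hβ ha => ?_⟩
  by_contra hne
  have hb : a.hi ≠ ⊥ := by
    intro h
    have := ha.touches.2
    rw [h] at this
    exact absurd this (by simp)
  have h1 : a.q.slopeAt a.hi.toReal ≤ M :=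
    hM (Finset.mem_coe.2 (Finset.mem_image_of_mem _ (List.mem_toFinset.2 ha.mem)))
  have h2 := Quad.touch_lt_touch (hpos a ha.mem) (h1.trans_lt hβ)
  rw [Quad.touch_slopeAt (hpos a ha.mem)] at h2
  have h3 := ha.touches.2
  rw [← EReal.coe_toReal hne hb] at h3
  linarith [EReal.coe_le_coe_iff.1 h3]

/-- The first part of the breakpoint algorithm computes the conjugate. -/
theorem conjFromStack_scanPieces {g G : ℝ → ℝ} {l : PWQ} (h : MinRep g l) (hconj : IsConj g G) :
    MaxRep G (conjFromStack ⊤ [] (scanPieces ⊥ l []).val).val ∧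
      ∀ p ∈ (conjFromStack ⊤ [] (scanPieces ⊥ l []).val).val, ∃ r ∈ l, p.q = r.q.conj := by
  have hG := h.good
  have hcov : ∀ x : ℝ, ∃ k ∈ segs ⊥ l, k.lo ≤ x ∧ (x : EReal) ≤ k.hi := fun x =>
    segs_cover h.rep x bot_le
  have hpos : ∀ k ∈ segs ⊥ l, 0 < k.q.a := fun k hk => (hG k hk).pos
  have inv := scanPieces_spec hG hcov (segs_pairwise h.rep).1 (segs_chain h.ne) l ⊥ [] []
    (by simp) ⟨trivial, by simp, by simp, by simp, by simp⟩ (by simp)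
  set st := (scanPieces ⊥ l []).val with hst
  have hne : st ≠ [] := by
    intro h0
    have h1 := inv.head
    rw [h0] at h1
    exact segs_ne_nil h.rep.ne_nil (by simpa using h1)
  have hquad : ∀ p ∈ (conjFromStack ⊤ [] st).val, ∃ r ∈ l, p.q = r.q.conj := by
    intro p hp
    rcases mem_conjFromStack hp with h | ⟨e, he, h⟩
    · simp at h
    · obtain ⟨r, hr, hq⟩ := exists_piece_of_mem_segs (inv.mem e he)
      exact ⟨r, hr, by rw [h, hq]⟩
  have htop : ∀ e ∈ st.head?, e.gam < ⊤ := by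
    intro e he
    obtain ⟨M, hM⟩ := exists_active_hi_eq_top hpos
    obtain ⟨β, hβ, -, hgen⟩ := exists_generic hpos (lt_add_one M)
    obtain ⟨a, ha⟩ := exists_active hG hcov β
    have hl := inv.loc β a hgen ha ha.mem
    obtain ⟨e₀, st', hst'⟩ := List.exists_cons_of_ne_nil hne
    rw [hst'] at hl he
    simp only [List.head?_cons, Option.mem_def, Option.some.injEq] at he
    subst he
    rcases hl with ⟨-, h⟩ | ⟨-, h⟩
    · exact h.trans (EReal.coe_lt_top _)
    · -- the entries below the top have bounded pieces, which are not active for large slopes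
      exfalso
      have : ∀ s : List Cand, Located β a s → ∃ e ∈ s, e.seg = a := by
        intro s
        induction s with
        | nil => exact False.elim
        | cons e s ih =>
          rintro (⟨h, -⟩ | ⟨-, h⟩)
          · exact ⟨e, by simp, h⟩
          · obtain ⟨e', he', h'⟩ := ih h
            exact ⟨e', List.mem_cons_of_mem _ he', h'⟩
      obtain ⟨e, he, rfl⟩ := this _ h
      obtain ⟨t, ht, -⟩ := inv.tail e (by rw [hst']; exact he)
      rw [hM β _ hβ ha] at ht
      exact absurd ht (by simp)
  obtain ⟨h1, h2⟩ := conjFromStack_spec hG hcov hconj st ⊤ [] inv.ok hne inv.mem htop rfl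
    (by simp [Kinked]) (by simp) (fun β a hgen ha _ => inv.loc β a hgen ha ha.mem)
  refine ⟨⟨h1, fun p hp x => ?_, h2⟩, hquad⟩
  obtain ⟨r, hr, hq⟩ := hquad p hp
  rw [hq]
  exact conj_eval_le hconj (h.pos r hr) (h.le r hr) x

/-! ### Elementary operations on representations -/

theorem evalPW_val {F : ℝ → ℝ} {l : PWQ} {lo : EReal} (h : Rep F lo l) {x : ℝ} (hx : lo ≤ x) :
    (evalPW x l).val = F x := by
  induction l generalizing lo with
  | nil => rw [show lo = ⊤ from h] at hx; exact absurd hx (by simp)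
  | cons p l ih =>
    have hval : (evalPW x (p :: l)).val = if (x : EReal) ≤ p.hi then p.q.eval x else
        (evalPW x l).val := by
      simp only [evalPW, bind_val, toExt_val, ite_val, isLeExt_val, evalQuad_val]
    rw [hval]
    split_ifs with hp
    · exact h.2.1 x hx hp
    · exact ih h.2.2 (not_le.1 hp).le

theorem Rep.congr {F F' : ℝ → ℝ} {l : PWQ} {lo : EReal} (h : Rep F lo l)
    (hF : ∀ x : ℝ, lo ≤ x → F x = F' x) : Rep F' lo l := by
  induction l generalizing lo with
  | nil => exact h
  | cons p l ih =>
    refine ⟨h.1, fun x hx hx' => (h.2.1 x hx hx').trans (hF x hx), ih h.2.2 fun x hx =>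
      hF x (h.1.le.trans hx)⟩

theorem Rep.map {F : ℝ → ℝ} {l : PWQ} {lo : EReal} (h : Rep F lo l) {φ : Quad → Quad}
    {ψ : ℝ → ℝ → ℝ} (hφ : ∀ q x, (φ q).eval x = ψ x (q.eval x)) :
    Rep (fun x => ψ x (F x)) lo (l.map fun p => ⟨p.hi, φ p.q⟩) := by
  induction l generalizing lo with
  | nil => exact h
  | cons p l ih =>
    exact ⟨h.1, fun x hx hx' => by rw [hφ, h.2.1 x hx hx'], ih h.2.2⟩

theorem Rep.exists_piece {F : ℝ → ℝ} {l : PWQ} {lo : EReal} (h : Rep F lo l) {x : ℝ}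
    (hx : lo ≤ x) : ∃ p ∈ l, p.q.eval x = F x := by
  induction l generalizing lo with
  | nil => rw [show lo = ⊤ from h] at hx; exact absurd hx (by simp)
  | cons p l ih =>
    rcases le_total (x : EReal) p.hi with hp | hp
    · exact ⟨p, by simp, h.2.1 x hx hp⟩
    · obtain ⟨q, hq, h'⟩ := ih h.2.2 hp
      exact ⟨q, List.mem_cons_of_mem _ hq, h'⟩

theorem shiftPW_val (c : ℝ) (l : PWQ) :
    (shiftPW c l).val = l.map fun p => ⟨p.hi, ⟨p.q.a, p.q.b, p.q.c - c⟩⟩ := by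
  induction l with
  | nil => rfl
  | cons p l ih =>
    simp only [shiftPW, bind_val, consPiece_val, ih, List.map_cons]
    rfl

theorem subFromQuad_val (r : Quad) (l : PWQ) :
    (subFromQuad r l).val = l.map fun p => ⟨p.hi, r.diff p.q⟩ := by
  induction l with
  | nil => rfl
  | cons p l ih =>
    simp only [subFromQuad, bind_val, consPiece_val, ih, List.map_cons, subQuad_val]

theorem MaxRep.shift {F : ℝ → ℝ} {l : PWQ} (h : MaxRep F l) (c : ℝ) :
    MaxRep (fun x => F x - c) (shiftPW c l).val := by
  rw [shiftPW_val]
  have ev : ∀ (q : Quad) x, (⟨q.a, q.b, q.c - c⟩ : Quad).eval x = q.eval x - c := by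
    intro q x; simp only [Quad.eval]; ring
  refine ⟨h.rep.map (φ := fun q => ⟨q.a, q.b, q.c - c⟩) (ψ := fun _ y => y - c) ev, ?_, ?_⟩
  · intro p hp x
    obtain ⟨r, hr, rfl⟩ := List.mem_map.1 hp
    rw [ev]
    linarith [h.le r hr x]
  · have := h.kinked
    rw [Kinked] at this ⊢
    rw [List.isChain_map]
    exact this

/-! ### Level sets of a convex piecewise-quadratic function -/

theorem Quad.eval_le_of_mem_Icc {p : Quad} (h : 0 ≤ p.a) {x y z m : ℝ} (hxy : x ≤ y)
    (hyz : y ≤ z) (hx : p.eval x ≤ m) (hz : p.eval z ≤ m) : p.eval y ≤ m := by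
  have tx := p.eval_taylor y x
  have tz := p.eval_taylor y z
  by_contra hcon
  have hcon := not_le.1 hcon
  have h1 := mul_nonneg h (sq_nonneg (x - y))
  have h2 := mul_nonneg h (sq_nonneg (z - y))
  rcases le_total 0 (p.slopeAt y) with hs | hs
  · nlinarith [mul_nonneg hs (sub_nonneg.2 hyz)]
  · nlinarith [mul_nonneg (neg_nonneg.2 hs) (sub_nonneg.2 hxy)]

theorem MaxRep.le_of_mem_Icc {F : ℝ → ℝ} {l : PWQ} (h : MaxRep F l) (ha : ∀ p ∈ l, 0 < p.q.a)
    {x y z m : ℝ} (hxy : x ≤ y) (hyz : y ≤ z) (hx : F x ≤ m) (hz : F z ≤ m) : F y ≤ m := by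
  obtain ⟨p, hp, hpy⟩ := h.rep.exists_piece (x := y) bot_le
  rw [← hpy]
  exact Quad.eval_le_of_mem_Icc (ha p hp).le hxy hyz ((h.le p hp x).trans hx)
    ((h.le p hp z).trans hz)

theorem MaxRep.convexOn {F : ℝ → ℝ} {l : PWQ} (h : MaxRep F l) (ha : ∀ p ∈ l, 0 < p.q.a) :
    ConvexOn ℝ Set.univ F := by
  refine ⟨convex_univ, fun x _ y _ s t hs ht hst => ?_⟩
  obtain ⟨p, hp, hpy⟩ := h.rep.exists_piece (x := s • x + t • y) bot_le
  rw [← hpy]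
  simp only [smul_eq_mul]
  have h1 := mul_le_mul_of_nonneg_left (h.le p hp x) hs
  have h2 := mul_le_mul_of_nonneg_left (h.le p hp y) ht
  have hq : s * p.q.eval x + t * p.q.eval y - p.q.eval (s * x + t * y) =
      p.q.a * (s * t * (x - y) ^ 2) := by
    obtain rfl : t = 1 - s := by linarith
    simp only [Quad.eval]; ring
  have := mul_nonneg (ha p hp).le (mul_nonneg (mul_nonneg hs ht) (sq_nonneg (x - y)))
  linarith

theorem Quad.exists_eval_gt {p : Quad} (h : 0 < p.a) (x m : ℝ) :
    (∃ y < x, m < p.eval y) ∧ ∃ y > x, m < p.eval y := by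
  set K := |p.slopeAt x| + |m - p.eval x| + 1 with hK
  have h1 : p.slopeAt x ≤ |p.slopeAt x| := le_abs_self _
  have h2 : -p.slopeAt x ≤ |p.slopeAt x| := neg_le_abs _
  have h3 : m - p.eval x ≤ |m - p.eval x| := le_abs_self _
  have h4 := abs_nonneg (p.slopeAt x)
  have h5 := abs_nonneg (m - p.eval x)
  set t := K / p.a + 1 with ht
  have hKpos : 0 < K := by linarith
  have hta : p.a * t = K + p.a := by rw [ht]; field_simp
  have ht1 : 1 < t := by rw [ht]; have := div_pos hKpos h; linarith
  have key : |m - p.eval x| < (p.a * t - |p.slopeAt x|) * t := by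
    rw [hta]; nlinarith
  refine ⟨⟨x - t, by linarith, ?_⟩, ⟨x + t, by linarith, ?_⟩⟩
  · rw [p.eval_taylor x]; nlinarith
  · rw [p.eval_taylor x]; nlinarith

/-- A level above some value of the function is attained on both sides of the point. -/
theorem MaxRep.exists_roots {F : ℝ → ℝ} {l : PWQ} (h : MaxRep F l) (ha : ∀ p ∈ l, 0 < p.q.a)
    {x m : ℝ} (hx : F x < m) : ∃ r s, r < x ∧ x < s ∧ F r = m ∧ F s = m := by
  have hcont : Continuous F := by
    rw [← continuousOn_univ]
    exact (h.convexOn ha).continuousOn isOpen_univ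
  obtain ⟨p, hp, -⟩ := h.rep.exists_piece (x := x) bot_le
  obtain ⟨⟨y, hy, hym⟩, ⟨z, hz, hzm⟩⟩ := Quad.exists_eval_gt (ha p hp) x m
  obtain ⟨r, hr, hrm⟩ := intermediate_value_Icc' hy.le hcont.continuousOn
    ⟨hx.le, hym.le.trans (h.le p hp y)⟩
  obtain ⟨s, hs, hsm⟩ := intermediate_value_Icc hz.le hcont.continuousOn
    ⟨hx.le, hzm.le.trans (h.le p hp z)⟩
  refine ⟨r, s, lt_of_le_of_ne hr.2 ?_, lt_of_le_of_ne hs.1 ?_, hrm, hsm⟩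
  · rintro rfl; exact hx.ne hrm
  · rintro rfl; exact hx.ne hsm

theorem consIfInside_val (lo hi : EReal) (r : ℝ) (rs : List ℝ) :
    (consIfInside lo hi r rs).val = if lo ≤ r ∧ (r : EReal) ≤ hi then r :: rs else rs := by
  simp only [consIfInside, bind_val, toExt_val, ite_val, isLeExt_val, store_val, pure_val]
  split_ifs <;> simp_all

/-- The computed list consists of the solutions of `F = m`, in order and possibly with
repetitions. -/
theorem levelRoots_spec {F : ℝ → ℝ} {m : ℝ} {l : PWQ} {lo : EReal} (h : Rep F lo l)
    (ha : ∀ p ∈ l, 0 < p.q.a) :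
    (∀ r ∈ (levelRoots m lo l).val, lo ≤ (r : EReal) ∧ F r = m) ∧
      (levelRoots m lo l).val.Pairwise (· ≤ ·) ∧
      ∀ x : ℝ, lo ≤ x → F x = m → x ∈ (levelRoots m lo l).val := by
  induction l generalizing lo with
  | nil =>
    refine ⟨by simp [levelRoots], by simp [levelRoots], fun x hx => ?_⟩
    rw [show lo = ⊤ from h] at hx
    exact absurd hx (by simp)
  | cons p l ih =>
    obtain ⟨h₁, h₂, h₃⟩ := h
    obtain ⟨i₁, i₂, i₃⟩ := ih h₃ fun p hp => ha p (List.mem_cons_of_mem _ hp)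
    have hpa := ha p List.mem_cons_self
    have hda : (⟨p.q.a, p.q.b, p.q.c - m⟩ : Quad).a ≠ 0 := hpa.ne'
    set d : Quad := ⟨p.q.a, p.q.b, p.q.c - m⟩ with hd
    have ev : ∀ x, d.eval x = p.q.eval x - m := by
      intro x; simp only [Quad.eval, hd]; ring
    set rest := (levelRoots m p.hi l).val with hrest
    have hval : (levelRoots m lo (p :: l)).val = match (rootsQuad d).val with
        | none => rest
        | some (r₁, r₂) => (consIfInside lo p.hi r₁ (consIfInside lo p.hi r₂ rest).val).val := by
      simp only [levelRoots, bind_val]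
      have e : (newQuad p.q.a p.q.b (TreeMIQP.sub p.q.c m).val).val = d := rfl
      rw [e]
      cases (rootsQuad d).val with
      | none => rfl
      | some r => rfl
    have i₁' : ∀ r ∈ rest, lo ≤ (r : EReal) ∧ F r = m := fun r hr =>
      ⟨h₁.le.trans (i₁ r hr).1, (i₁ r hr).2⟩
    have hroot : ∀ x : ℝ, lo ≤ x → (x : EReal) ≤ p.hi → (d.eval x = 0 ↔ F x = m) := by
      intro x hx hx'
      rw [ev, h₂ x hx hx', sub_eq_zero]
    rcases lt_or_ge d.disc 0 with hneg | hnn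
    · rw [rootsQuad_eq_none (Or.inr ⟨hda, hneg⟩)] at hval
      rw [hval]
      refine ⟨i₁', i₂, fun x hx hxm => ?_⟩
      rcases le_total (x : EReal) p.hi with hxp | hxp
      · have := Quad.slopeAt_sq_of_root ((hroot x hx hxp).2 hxm)
        nlinarith [sq_nonneg (d.slopeAt x)]
      · exact i₃ x hxp hxm
    · obtain ⟨r₁, r₂, hr, hle, e₁, e₂, hall, -⟩ := rootsQuad_spec (Or.inl hda) hnn
      rw [hr] at hval
      simp only [consIfInside_val] at hval
      rw [hval]
      have gen : ∀ (r : ℝ) (rs : List ℝ), d.eval r = 0 →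
          (∀ s ∈ rs, lo ≤ (s : EReal) ∧ F s = m) → ∀ s ∈ (if lo ≤ (r : EReal) ∧
            (r : EReal) ≤ p.hi then r :: rs else rs), lo ≤ (s : EReal) ∧ F s = m := by
        intro r rs hr0 hrs s hs
        split_ifs at hs with hc
        · rcases List.mem_cons.1 hs with rfl | hs
          · exact ⟨hc.1, (hroot _ hc.1 hc.2).1 hr0⟩
          · exact hrs s hs
        · exact hrs s hs
      have hmemif : ∀ (c : Prop) [Decidable c] (r : ℝ) (rs : List ℝ) (x : ℝ), x ∈ rs →
          x ∈ (if c then r :: rs else rs) := by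
        intro c _ r rs x hx
        split_ifs
        · exact List.mem_cons_of_mem _ hx
        · exact hx
      refine ⟨gen _ _ e₁ (gen _ _ e₂ i₁'), ?_, fun x hx hxm => ?_⟩
      · have hr₂ : (if lo ≤ (r₂ : EReal) ∧ (r₂ : EReal) ≤ p.hi then r₂ :: rest
            else rest).Pairwise (· ≤ ·) := by
          split_ifs with hc
          · exact List.pairwise_cons.2 ⟨fun s hs => coe_le_of_le_of_le hc.2 le_rfl (i₁ s hs).1, i₂⟩
          · exact i₂
        split_ifs with hc₁ hc₂ hc₂
        · rw [if_pos hc₂] at hr₂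
          refine List.pairwise_cons.2 ⟨fun s hs => ?_, hr₂⟩
          rcases List.mem_cons.1 hs with rfl | hs
          · exact hle
          · exact coe_le_of_le_of_le hc₁.2 le_rfl (i₁ s hs).1
        · exact List.pairwise_cons.2 ⟨fun s hs => coe_le_of_le_of_le hc₁.2 le_rfl (i₁ s hs).1, i₂⟩
        · rw [if_pos hc₂] at hr₂
          exact hr₂
        · exact i₂
      · rcases le_total (x : EReal) p.hi with hxp | hxp
        · rcases hall x ((hroot x hx hxp).2 hxm) with rfl | rfl
          · rw [if_pos ⟨hx, hxp⟩]
            exact List.mem_cons_self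
          · apply hmemif
            rw [if_pos ⟨hx, hxp⟩]
            exact List.mem_cons_self
        · exact hmemif _ _ _ _ (hmemif _ _ _ _ (i₃ x hxp hxm))

theorem lastRoot_spec (r : ℝ) (rs : List ℝ) (h : (r :: rs).Pairwise (· ≤ ·)) :
    (lastRoot r rs).val ∈ r :: rs ∧ ∀ s ∈ r :: rs, s ≤ (lastRoot r rs).val := by
  induction rs generalizing r with
  | nil => simp [lastRoot]
  | cons s rs ih =>
    have hval : (lastRoot r (s :: rs)).val = (lastRoot s rs).val := rfl
    rw [hval]
    obtain ⟨h₁, h₂⟩ := List.pairwise_cons.1 h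
    obtain ⟨i₁, i₂⟩ := ih s h₂
    refine ⟨List.mem_cons_of_mem _ i₁, fun x hx => ?_⟩
    rcases List.mem_cons.1 hx with rfl | hx
    · exact h₁ _ i₁
    · exact i₂ x hx

/-! ### Cutting and pasting -/

/-- The remaining pieces represent `F` to the right of `β`, and the first of them reaches down to
`β`. -/
theorem dropBelow_spec {F : ℝ → ℝ} {β : ℝ} {l : PWQ} {lo : EReal} (h : Rep F lo l) (hlo : lo ≤ β) :
    Rep F β (dropBelow β l).val ∧ (dropBelow β l).val <:+ l ∧
      ∀ p ∈ (dropBelow β l).val.head?, p.q.eval β = F β := by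
  induction l generalizing lo with
  | nil => rw [show lo = ⊤ from h] at hlo; exact absurd hlo (by simp)
  | cons p l ih =>
    have hval : (dropBelow β (p :: l)).val = if p.hi ≤ (β : EReal) then (dropBelow β l).val
        else p :: l := by
      simp only [dropBelow, bind_val, ite_val, isLeExt_val, pure_val]
    rw [hval]
    split_ifs with hp
    · obtain ⟨i₁, i₂, i₃⟩ := ih h.2.2 hp
      exact ⟨i₁, i₂.trans (List.suffix_cons _ _), i₃⟩
    · have hp := not_le.1 hp
      refine ⟨⟨hp, fun x hx => h.2.1 x (hlo.trans hx), h.2.2⟩, List.suffix_rfl, ?_⟩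
      intro q hq
      simp only [List.head?_cons, Option.mem_def, Option.some.injEq] at hq
      exact hq ▸ h.2.1 β hlo hp.le

/-- Cutting `F` at `β` and continuing with `right`, where the derivative jumps upwards. -/
theorem keepBelow_spec {F F' : ℝ → ℝ} {β : ℝ} {right l : PWQ} {lo : EReal} (h : Rep F lo l)
    (hlo : lo < β) (hF : ∀ x ≤ β, F x = F' x) (hright : Rep F' β right) (hk : Kinked l)
    (hkr : Kinked right) (hjump : ∀ p ∈ l, p.q.eval β = F β → ∀ r ∈ right.head?,
      p.q.slopeAt β < r.q.slopeAt β) :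
    Rep F' lo (keepBelow β right l).val ∧ Kinked (keepBelow β right l).val ∧
      (∀ r ∈ (keepBelow β right l).val.head?, ∀ p ∈ l.head?, r.q = p.q) ∧
      ∀ p ∈ (keepBelow β right l).val, p ∈ right ∨ ∃ r ∈ l, p.q = r.q := by
  induction l generalizing lo with
  | nil => rw [show lo = ⊤ from h] at hlo; exact absurd hlo (by simp)
  | cons p l ih =>
    have hval : (keepBelow β right (p :: l)).val = if p.hi < (β : EReal) then
        ⟨p.hi, p.q⟩ :: (keepBelow β right l).val else ⟨β, p.q⟩ :: right := by
      simp only [keepBelow, bind_val, ite_val, isLtExt_val, consPiece_val]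
    rw [hval]
    obtain ⟨h₁, h₂, h₃⟩ := h
    rw [Kinked, List.isChain_cons] at hk
    split_ifs with hp
    · obtain ⟨i₁, i₂, i₃, i₄⟩ := ih h₃ hp hk.2 fun q hq => hjump q (List.mem_cons_of_mem _ hq)
      refine ⟨⟨h₁, fun x hx hx' => (h₂ x hx hx').trans (hF x ?_), i₁⟩, ?_, ?_, ?_⟩
      · exact EReal.coe_le_coe_iff.1 (hx'.trans hp.le)
      · rw [Kinked, List.isChain_cons]
        refine ⟨fun r hr t ht => ?_, i₂⟩
        have hl : l ≠ [] := by
          rintro rfl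
          rw [show p.hi = ⊤ from h₃] at hp
          exact absurd hp (by simp)
        obtain ⟨q, l', rfl⟩ := List.exists_cons_of_ne_nil hl
        rw [i₃ r hr q (by simp)]
        exact hk.1 q (by simp) t ht
      · intro r hr q hq
        simp only [List.head?_cons, Option.mem_def, Option.some.injEq] at hr hq
        rw [← hr, ← hq]
      · intro q hq
        rcases List.mem_cons.1 hq with rfl | hq
        · exact Or.inr ⟨p, by simp, rfl⟩
        · rcases i₄ q hq with h | ⟨r, hr, h⟩
          · exact Or.inl h
          · exact Or.inr ⟨r, List.mem_cons_of_mem _ hr, h⟩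
    · have hp := not_lt.1 hp
      refine ⟨⟨hlo, fun x hx hx' => (h₂ x hx (hx'.trans hp)).trans
        (hF x (EReal.coe_le_coe_iff.1 hx')), hright⟩, ?_, ?_, ?_⟩
      · rw [Kinked, List.isChain_cons]
        refine ⟨fun r hr t ht => ?_, hkr⟩
        rw [← EReal.coe_injective ht]
        exact hjump p (by simp) (h₂ β hlo.le hp) r hr
      · intro r hr q hq
        simp only [List.head?_cons, Option.mem_def, Option.some.injEq] at hr hq
        rw [← hr, ← hq]
      · intro q hq
        rcases List.mem_cons.1 hq with rfl | hq
        · exact Or.inr ⟨p, by simp, rfl⟩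
        · exact Or.inl hq

/-! ### The breakpoint algorithm computes the conjugate -/

/-- The conjugate is the value at `β` of the conjugate of an active piece. -/
theorem MinRep.exists_isConj {g : ℝ → ℝ} {l : PWQ} (h : MinRep g l) : ∃ G, IsConj g G := by
  have hG := h.good
  have hcov : ∀ x : ℝ, ∃ k ∈ segs ⊥ l, k.lo ≤ x ∧ (x : EReal) ≤ k.hi := fun x =>
    segs_cover h.rep x bot_le
  choose a ha using exists_active hG hcov
  refine ⟨fun β => (a β).q.conj.eval β, fun β α => ?_, fun β => ⟨(a β).q.touch β, ?_⟩⟩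
  · obtain ⟨k, hk, hk₁, hk₂⟩ := hcov α
    rw [← (hG k hk).eq α hk₁ hk₂]
    exact (Quad.fenchel_le (hG k hk).pos β α).trans ((ha β).max k hk)
  · have haG := hG _ (ha β).mem
    rw [Quad.fenchel_touch haG.pos, haG.eq _ (ha β).touches.1 (ha β).touches.2]

/-- The conjugate of `g + c 𝟙` is the maximum of `g^* - c` and the constant `-g(0)`. -/
theorem IsConj.add_indicator {g G : ℝ → ℝ} (h : IsConj g G) {c : ℝ} (hc : 0 < c) :
    IsConj (fun α => g α + if α = 0 then 0 else c) fun β => max (G β - c) (-g 0) := by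
  refine ⟨fun β α => ?_, fun β => ?_⟩
  · by_cases hα : α = 0
    · subst hα
      refine le_max_of_le_right ?_
      simp
    · refine le_max_of_le_left ?_
      simp only [hα, if_false]
      linarith [h.le β α]
  · rcases le_total (G β - c) (-g 0) with hle | hle
    · exact ⟨0, by simp [max_eq_right hle]⟩
    · obtain ⟨α, hα⟩ := h.attained β
      refine ⟨α, ?_⟩
      have : α ≠ 0 := by
        rintro rfl
        linarith
      simp only [max_eq_left hle, this, if_false]
      linarith

theorem Quad.slopeAt_neg_of_lt {p : Quad} (h : 0 < p.a) {x y : ℝ} (hxy : x ≠ y)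
    (hle : p.eval y ≤ p.eval x) : p.slopeAt x * (y - x) < 0 := by
  have := p.eval_taylor x y
  have h2 : 0 < p.a * (y - x) ^ 2 :=
    mul_pos h (by have := sub_ne_zero.2 hxy.symm; positivity)
  linarith

/-- The breakpoint algorithm returns the conjugate of `g + c 𝟙`. The curvature of a piece of the
result is `0` or that of the conjugate of a piece of `g`. -/
theorem breakpointAlgorithm_spec {g G : ℝ → ℝ} {l : PWQ} (h : MinRep g l) (hconj : IsConj g G)
    (c : ℝ) :
    MaxRep (fun β => max (G β - c) (-g 0)) (breakpointAlgorithm l c).val ∧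
      ∀ p ∈ (breakpointAlgorithm l c).val, p.q.a = 0 ∨ ∃ r ∈ l, p.q.a = r.q.conj.a := by
  obtain ⟨hgs, hgsq⟩ := conjFromStack_scanPieces h hconj
  set gs := (conjFromStack ⊤ [] (scanPieces ⊥ l []).val).val with hgsdef
  have hH := hgs.shift c
  have hHq : ∀ p ∈ (shiftPW c gs).val, ∃ r ∈ l, p.q.a = r.q.conj.a := by
    intro p hp
    rw [shiftPW_val] at hp
    obtain ⟨p', hp', rfl⟩ := List.mem_map.1 hp
    obtain ⟨r, hr, hq⟩ := hgsq p' hp'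
    exact ⟨r, hr, by simp only [hq]⟩
  have hHa : ∀ p ∈ (shiftPW c gs).val, 0 < p.q.a := by
    intro p hp
    obtain ⟨r, hr, hq⟩ := hHq p hp
    rw [hq]
    exact Quad.conj_a_pos (h.pos r hr)
  set H := (shiftPW c gs).val with hHdef
  set F : ℝ → ℝ := fun x => G x - c with hF
  set m := -g 0 with hm
  have hg0 : (evalPW 0 l).val = g 0 := evalPW_val h.rep bot_le
  obtain ⟨r₁, r₂, r₃⟩ := levelRoots_spec (m := m) hH.rep hHa
  have hval : (breakpointAlgorithm l c).val = match (levelRoots m ⊥ H).val with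
      | [] => H
      | β₁ :: rs => if β₁ < (lastRoot β₁ rs).val then
          (keepBelow β₁ (⟨(lastRoot β₁ rs).val, ⟨0, 0, m⟩⟩ ::
            (dropBelow (lastRoot β₁ rs).val H).val) H).val else H := by
    simp only [breakpointAlgorithm, bind_val]
    rw [← hgsdef, ← hHdef, hg0]
    have e : (neg (g 0)).val = m := rfl
    rw [e]
    cases (levelRoots m ⊥ H).val with
    | nil => rfl
    | cons β rs =>
      simp only [bind_val, ite_val, isLt_val, toExt_val, consPiece_val, pure_val]
      rfl
  -- without two distinct roots the function never falls below the level
  have noroots : (∀ r ∈ (levelRoots m ⊥ H).val, ∀ s ∈ (levelRoots m ⊥ H).val, ¬ r < s) →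
      MaxRep (fun β => max (G β - c) (-g 0)) H := by
    intro hno
    have : (fun β => max (G β - c) (-g 0)) = F := by
      funext β
      refine max_eq_left ?_
      by_contra hcon
      obtain ⟨r, s, h₁, h₂, h₃, h₄⟩ := hH.exists_roots hHa (not_le.1 hcon)
      exact hno r (r₃ r bot_le h₃) s (r₃ s bot_le h₄) (h₁.trans h₂)
    rw [this]
    exact hH
  rw [hval]
  rcases hrs : (levelRoots m ⊥ H).val with - | ⟨β₁, rs⟩
  · exact ⟨noroots (by rw [hrs]; simp), fun p hp => Or.inr (hHq p hp)⟩
  rw [hrs] at r₁ r₂ noroots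
  obtain ⟨l₁, l₂⟩ := lastRoot_spec β₁ rs r₂
  simp only
  set β₂ := (lastRoot β₁ rs).val with hβ₂
  split_ifs with hlt
  · have e₁ : F β₁ = m := (r₁ β₁ List.mem_cons_self).2
    have e₂ : F β₂ = m := (r₁ β₂ l₁).2
    have below : ∀ x ≤ β₁, m ≤ F x := by
      intro x hx
      rcases hx.eq_or_lt with rfl | hx
      · exact e₁.ge
      by_contra hcon
      obtain ⟨r, s, h₁, h₂, h₃, h₄⟩ := hH.exists_roots hHa (not_le.1 hcon)
      have := (List.pairwise_cons.1 r₂).1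
      have hr := r₃ r bot_le h₃
      rw [hrs] at hr
      rcases List.mem_cons.1 hr with rfl | hr
      · exact lt_asymm hx h₁
      · linarith [this r hr]
    have above : ∀ x, β₂ ≤ x → m ≤ F x := by
      intro x hx
      rcases hx.eq_or_lt with rfl | hx
      · exact e₂.ge
      by_contra hcon
      obtain ⟨r, s, h₁, h₂, h₃, h₄⟩ := hH.exists_roots hHa (not_le.1 hcon)
      have hs := r₃ s bot_le h₄
      rw [hrs] at hs
      linarith [l₂ s hs]
    obtain ⟨d₁, d₂, d₃⟩ := dropBelow_spec (β := β₂) hH.rep bot_le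
    have hconst : ∀ x, (⟨0, 0, m⟩ : Quad).eval x = m := by intro x; simp [Quad.eval]
    have hsl : ∀ x, (⟨0, 0, m⟩ : Quad).slopeAt x = 0 := by intro x; simp [Quad.slopeAt]
    set F' : ℝ → ℝ := fun β => max (G β - c) (-g 0) with hF'
    have hright : Rep F' β₁ (⟨β₂, ⟨0, 0, m⟩⟩ :: (dropBelow β₂ H).val) := by
      refine ⟨EReal.coe_lt_coe_iff.2 hlt, fun x hx hx' => ?_, d₁.congr fun x hx => ?_⟩
      · rw [hconst]
        exact (max_eq_right (hH.le_of_mem_Icc hHa (EReal.coe_le_coe_iff.1 hx)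
          (EReal.coe_le_coe_iff.1 hx') e₁.le e₂.le)).symm
      · exact (max_eq_left (above x (EReal.coe_le_coe_iff.1 hx))).symm
    -- the graph of a piece through `β₂` lies below the level at `β₁`, hence rises at `β₂`
    have hkr : Kinked (⟨β₂, ⟨0, 0, m⟩⟩ :: (dropBelow β₂ H).val) := by
      rw [Kinked, List.isChain_cons]
      refine ⟨fun p hp t ht => ?_, hH.kinked.suffix d₂⟩
      have ht' := EReal.coe_injective ht
      subst ht'
      have hpH : p ∈ H := d₂.subset (List.mem_of_mem_head? hp)
      have := Quad.slopeAt_neg_of_lt (hHa p hpH) hlt.ne'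
        (by rw [d₃ p hp, e₂, ← e₁]; exact hH.le p hpH β₁)
      rw [hsl]
      nlinarith
    obtain ⟨k₁, k₂, -, k₄⟩ := keepBelow_spec (F' := F') hH.rep (EReal.bot_lt_coe β₁)
      (fun x hx => (max_eq_left (below x hx)).symm) hright hH.kinked hkr (by
        intro p hp hpe r hr
        simp only [List.head?_cons, Option.mem_def, Option.some.injEq] at hr
        rw [← hr, hsl]
        have := Quad.slopeAt_neg_of_lt (hHa p hp) hlt.ne
          (by rw [hpe, e₁, ← e₂]; exact hH.le p hp β₂)
        nlinarith)
    refine ⟨⟨k₁, fun p hp x => ?_, k₂⟩, fun p hp => ?_⟩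
    · rcases k₄ p hp with h | ⟨r, hr, hq⟩
      · rcases List.mem_cons.1 h with rfl | h
        · rw [hconst]
          exact le_max_right _ _
        · exact (hH.le p (d₂.subset h) x).trans (le_max_left _ _)
      · rw [hq]
        exact (hH.le r hr x).trans (le_max_left _ _)
    · rcases k₄ p hp with h | ⟨r, hr, hq⟩
      · rcases List.mem_cons.1 h with rfl | h
        · exact Or.inl rfl
        · exact Or.inr (hHq p (d₂.subset h))
      · rw [hq]
        exact Or.inr (hHq r hr)
  · refine ⟨noroots fun r hr s hs hrs' => hlt ?_, fun p hp => Or.inr (hHq p hp)⟩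
    have h1 : β₁ ≤ r := by
      rcases List.mem_cons.1 hr with rfl | hr
      · exact le_rfl
      · exact (List.pairwise_cons.1 r₂).1 r hr
    linarith [l₂ s hs]

/-! ### Rescaling the argument -/

theorem mul_inv_le_coe_iff_of_pos {κ : ℝ} (hκ : 0 < κ) (t : EReal) (x : ℝ) :
    t * ((1 / κ : ℝ) : EReal) ≤ x ↔ t ≤ ((κ * x : ℝ) : EReal) := by
  have hi : 0 < 1 / κ := by positivity
  induction t with
  | bot => rw [EReal.bot_mul_coe_of_pos hi]; simp [-EReal.coe_mul]
  | top => rw [EReal.top_mul_coe_of_pos hi]; simp [-EReal.coe_mul]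
  | coe t =>
    rw [← EReal.coe_mul, EReal.coe_le_coe_iff, EReal.coe_le_coe_iff, mul_one_div,
      div_le_iff₀ hκ, mul_comm]

theorem coe_le_mul_inv_iff_of_pos {κ : ℝ} (hκ : 0 < κ) (t : EReal) (x : ℝ) :
    (x : EReal) ≤ t * ((1 / κ : ℝ) : EReal) ↔ ((κ * x : ℝ) : EReal) ≤ t := by
  have hi : 0 < 1 / κ := by positivity
  induction t with
  | bot => rw [EReal.bot_mul_coe_of_pos hi]; simp [-EReal.coe_mul]
  | top => rw [EReal.top_mul_coe_of_pos hi]; simp [-EReal.coe_mul]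
  | coe t =>
    rw [← EReal.coe_mul, EReal.coe_le_coe_iff, EReal.coe_le_coe_iff, mul_one_div,
      le_div_iff₀ hκ, mul_comm]

theorem mul_inv_le_coe_iff_of_neg {κ : ℝ} (hκ : κ < 0) (t : EReal) (x : ℝ) :
    t * ((1 / κ : ℝ) : EReal) ≤ x ↔ ((κ * x : ℝ) : EReal) ≤ t := by
  have hi : 1 / κ < 0 := one_div_neg.2 hκ
  induction t with
  | bot => rw [EReal.bot_mul_coe_of_neg hi]; simp [-EReal.coe_mul]
  | top => rw [EReal.top_mul_coe_of_neg hi]; simp [-EReal.coe_mul]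
  | coe t =>
    rw [← EReal.coe_mul, EReal.coe_le_coe_iff, EReal.coe_le_coe_iff, mul_one_div,
      div_le_iff_of_neg hκ, mul_comm]

theorem coe_le_mul_inv_iff_of_neg {κ : ℝ} (hκ : κ < 0) (t : EReal) (x : ℝ) :
    (x : EReal) ≤ t * ((1 / κ : ℝ) : EReal) ↔ t ≤ ((κ * x : ℝ) : EReal) := by
  have hi : 1 / κ < 0 := one_div_neg.2 hκ
  induction t with
  | bot => rw [EReal.bot_mul_coe_of_neg hi]; simp [-EReal.coe_mul]
  | top => rw [EReal.top_mul_coe_of_neg hi]; simp [-EReal.coe_mul]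
  | coe t =>
    rw [← EReal.coe_mul, EReal.coe_le_coe_iff, EReal.coe_le_coe_iff, mul_one_div,
      le_div_iff_of_neg hκ, mul_comm]

/-- A strict inequality between extended reals is witnessed by a real number in between. -/
theorem ereal_lt_of_coe {s t : EReal} {x y : ℝ} (hxy : x < y) (hs : s ≤ x)
    (ht : (y : EReal) ≤ t) : s < t :=
  hs.trans_lt ((EReal.coe_lt_coe_iff.2 hxy).trans_le ht)

theorem mul_inv_lt_of_pos {κ : ℝ} (hκ : 0 < κ) {s t : EReal} (h : s < t) :
    s * ((1 / κ : ℝ) : EReal) < t * ((1 / κ : ℝ) : EReal) := by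
  obtain ⟨x, h₁, h₂⟩ := EReal.lt_iff_exists_real_btwn.1 h
  obtain ⟨y, h₃, h₄⟩ := EReal.lt_iff_exists_real_btwn.1 h₂
  refine ereal_lt_of_coe (x := x / κ) (y := y / κ) ?_ ?_ ?_
  · exact div_lt_div_of_pos_right (EReal.coe_lt_coe_iff.1 h₃) hκ
  · rw [mul_inv_le_coe_iff_of_pos hκ, mul_div_cancel₀ _ hκ.ne']
    exact h₁.le
  · rw [coe_le_mul_inv_iff_of_pos hκ, mul_div_cancel₀ _ hκ.ne']
    exact h₄.le

theorem mul_inv_lt_of_neg {κ : ℝ} (hκ : κ < 0) {s t : EReal} (h : s < t) :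
    t * ((1 / κ : ℝ) : EReal) < s * ((1 / κ : ℝ) : EReal) := by
  obtain ⟨x, h₁, h₂⟩ := EReal.lt_iff_exists_real_btwn.1 h
  obtain ⟨y, h₃, h₄⟩ := EReal.lt_iff_exists_real_btwn.1 h₂
  refine ereal_lt_of_coe (x := y / κ) (y := x / κ) ?_ ?_ ?_
  · exact div_lt_div_of_neg_of_lt hκ (EReal.coe_lt_coe_iff.1 h₃)
  · rw [mul_inv_le_coe_iff_of_neg hκ, mul_div_cancel₀ _ hκ.ne]
    exact h₄.le
  · rw [coe_le_mul_inv_iff_of_neg hκ, mul_div_cancel₀ _ hκ.ne]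
    exact h₁.le

namespace Quad

/-- The coefficients of `x ↦ p (κ x)`. -/
def scale (κ : ℝ) (p : Quad) : Quad := ⟨p.a * (κ * κ), p.b * κ, p.c⟩

theorem eval_scale (κ : ℝ) (p : Quad) (x : ℝ) : (p.scale κ).eval x = p.eval (κ * x) := by
  simp only [eval, scale]; ring

theorem slopeAt_scale (κ : ℝ) (p : Quad) (x : ℝ) :
    (p.scale κ).slopeAt x = κ * p.slopeAt (κ * x) := by
  simp only [slopeAt, scale]; ring

end Quad

@[simp] theorem scaleQuad_val (κ : ℝ) (p : Quad) : (scaleQuad κ p).val = p.scale κ := rfl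

theorem scalePos_val (κ inv : ℝ) (l : PWQ) :
    (scalePos κ inv l).val = l.map fun p => ⟨p.hi * (inv : EReal), p.q.scale κ⟩ := by
  induction l with
  | nil => rfl
  | cons p l ih =>
    simp only [scalePos, bind_val, consPiece_val, ih, List.map_cons, scaleQuad_val]
    rfl

theorem scalePos_rep {F : ℝ → ℝ} {κ : ℝ} (hκ : 0 < κ) {l : PWQ} {lo : EReal} (h : Rep F lo l) :
    Rep (fun x => F (κ * x)) (lo * ((1 / κ : ℝ) : EReal))
      (l.map fun p => ⟨p.hi * ((1 / κ : ℝ) : EReal), p.q.scale κ⟩) := by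
  induction l generalizing lo with
  | nil =>
    rw [show lo = ⊤ from h]
    exact EReal.top_mul_coe_of_pos (by positivity)
  | cons p l ih =>
    refine ⟨mul_inv_lt_of_pos hκ h.1, fun x hx hx' => ?_, ih h.2.2⟩
    rw [Quad.eval_scale]
    exact h.2.1 _ ((mul_inv_le_coe_iff_of_pos hκ _ _).1 hx)
      ((coe_le_mul_inv_iff_of_pos hκ _ _).1 hx')

/-- The pieces in `acc` represent `x ↦ F (κ x)` to the right of the image of `lo`, and every round
adds a piece on the left. -/
theorem scaleNeg_spec {F : ℝ → ℝ} {κ : ℝ} (hκ : κ < 0) {l acc : PWQ} {lo : EReal}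
    (h : Rep F lo l) (hk : Kinked l)
    (hacc : Rep (fun x => F (κ * x)) (lo * ((1 / κ : ℝ) : EReal)) acc) (hka : Kinked acc)
    (hjump : ∀ p ∈ l.head?, ∀ r ∈ acc.head?, ∀ t : ℝ, lo * ((1 / κ : ℝ) : EReal) = t →
      (p.q.scale κ).slopeAt t < r.q.slopeAt t) :
    Rep (fun x => F (κ * x)) ⊥ (scaleNeg κ (1 / κ) lo acc l).val ∧
      Kinked (scaleNeg κ (1 / κ) lo acc l).val := by
  induction l generalizing lo acc with
  | nil =>
    rw [show lo = ⊤ from h, EReal.top_mul_coe_of_neg (one_div_neg.2 hκ)] at hacc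
    exact ⟨hacc, hka⟩
  | cons p l ih =>
    have hval : (scaleNeg κ (1 / κ) lo acc (p :: l)).val =
        (scaleNeg κ (1 / κ) p.hi (⟨lo * ((1 / κ : ℝ) : EReal), p.q.scale κ⟩ :: acc) l).val := rfl
    rw [hval]
    obtain ⟨h₁, h₂, h₃⟩ := h
    rw [Kinked, List.isChain_cons] at hk
    refine ih h₃ hk.2 ⟨mul_inv_lt_of_neg hκ h₁, fun x hx hx' => ?_, hacc⟩ ?_ ?_
    · rw [Quad.eval_scale]
      exact h₂ _ ((coe_le_mul_inv_iff_of_neg hκ _ _).1 hx')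
        ((mul_inv_le_coe_iff_of_neg hκ _ _).1 hx)
    · rw [Kinked, List.isChain_cons]
      exact ⟨fun r hr t ht => hjump p (by simp) r hr t ht, hka⟩
    · intro q hq r hr t ht
      simp only [List.head?_cons, Option.mem_def, Option.some.injEq] at hr
      rw [← hr, Quad.slopeAt_scale, Quad.slopeAt_scale]
      have hp : p.hi = ((κ * t : ℝ) : EReal) :=
        le_antisymm ((coe_le_mul_inv_iff_of_neg hκ _ _).1 ht.ge)
          ((mul_inv_le_coe_iff_of_neg hκ _ _).1 ht.le)
      exact mul_lt_mul_of_neg_left (hk.1 q hq _ hp) hκ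

theorem mem_scaleNeg {κ inv : ℝ} {l acc : PWQ} {lo : EReal} {p : Piece}
    (hp : p ∈ (scaleNeg κ inv lo acc l).val) : p ∈ acc ∨ ∃ r ∈ l, p.q = r.q.scale κ := by
  induction l generalizing lo acc with
  | nil => exact Or.inl hp
  | cons r l ih =>
    rcases ih (lo := r.hi) (acc := ⟨lo * (inv : EReal), r.q.scale κ⟩ :: acc) hp with h | ⟨s, hs, h⟩
    · rcases List.mem_cons.1 h with rfl | h
      · exact Or.inr ⟨r, by simp, rfl⟩
      · exact Or.inl h
    · exact Or.inr ⟨s, List.mem_cons_of_mem _ hs, h⟩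

theorem MaxRep.scale {F : ℝ → ℝ} {l : PWQ} (h : MaxRep F l) {κ : ℝ} (hκ : κ ≠ 0) :
    MaxRep (fun x => F (κ * x)) (scalePW κ l).val ∧
      ∀ p ∈ (scalePW κ l).val, ∃ r ∈ l, p.q = r.q.scale κ := by
  have hval : (scalePW κ l).val = if 0 < κ then (scalePos κ (1 / κ) l).val else
      (scaleNeg κ (1 / κ) ⊥ [] l).val := by
    simp only [scalePW, bind_val, ite_val, isLt_val]
    rfl
  have hle : ∀ r ∈ l, ∀ x, (r.q.scale κ).eval x ≤ F (κ * x) := by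
    intro r hr x
    rw [Quad.eval_scale]
    exact h.le r hr _
  rw [hval]
  split_ifs with hpos
  · rw [scalePos_val]
    have hmem : ∀ p ∈ (l.map fun p => ⟨p.hi * ((1 / κ : ℝ) : EReal), p.q.scale κ⟩ : PWQ),
        ∃ r ∈ l, p.q = r.q.scale κ := by
      intro p hp
      obtain ⟨r, hr, rfl⟩ := List.mem_map.1 hp
      exact ⟨r, hr, rfl⟩
    refine ⟨⟨?_, fun p hp x => ?_, ?_⟩, hmem⟩
    · have := scalePos_rep hpos h.rep
      rwa [EReal.bot_mul_coe_of_pos (by positivity)] at this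
    · obtain ⟨r, hr, hq⟩ := hmem p hp
      rw [hq]
      exact hle r hr x
    · rw [Kinked, List.isChain_map]
      refine List.IsChain.imp (fun p q hpq t ht => ?_) h.kinked
      rw [Quad.slopeAt_scale, Quad.slopeAt_scale]
      have hp : p.hi = ((κ * t : ℝ) : EReal) :=
        le_antisymm ((mul_inv_le_coe_iff_of_pos hpos _ _).1 ht.le)
          ((coe_le_mul_inv_iff_of_pos hpos _ _).1 ht.ge)
      exact mul_lt_mul_of_pos_left (hpq _ hp) hpos
  · have hneg : κ < 0 := lt_of_le_of_ne (not_lt.1 hpos) hκ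
    obtain ⟨h₁, h₂⟩ := scaleNeg_spec hneg h.rep h.kinked (acc := [])
      (EReal.bot_mul_coe_of_neg (one_div_neg.2 hneg)) (by simp [Kinked]) (by simp)
    have hmem : ∀ p ∈ (scaleNeg κ (1 / κ) ⊥ [] l).val, ∃ r ∈ l, p.q = r.q.scale κ := fun p hp =>
      (mem_scaleNeg hp).resolve_left (by simp)
    refine ⟨⟨h₁, fun p hp x => ?_, h₂⟩, hmem⟩
    obtain ⟨r, hr, hq⟩ := hmem p hp
    rw [hq]
    exact hle r hr x

/-! ### Sums -/

/-- The coefficients of the sum of two quadratics. -/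
def Quad.sum (p q : Quad) : Quad := ⟨p.a + q.a, p.b + q.b, p.c + q.c⟩

theorem Quad.eval_sum (p q : Quad) (x : ℝ) : (p.sum q).eval x = p.eval x + q.eval x := by
  simp only [Quad.eval, Quad.sum]; ring

theorem Quad.slopeAt_sum (p q : Quad) (x : ℝ) :
    (p.sum q).slopeAt x = p.slopeAt x + q.slopeAt x := by
  simp only [Quad.slopeAt, Quad.sum]; ring

theorem addPW_cons_val (p q : Piece) (f g : PWQ) : (addPW (p :: f) (q :: g)).val =
    if p.hi < q.hi then ⟨p.hi, p.q.sum q.q⟩ :: (addPW f (q :: g)).val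
    else if q.hi < p.hi then ⟨q.hi, p.q.sum q.q⟩ :: (addPW (p :: f) g).val
    else ⟨p.hi, p.q.sum q.q⟩ :: (addPW f g).val := by
  rw [addPW]
  simp only [bind_val, ite_val, isLtExt_val, consPiece_val, addQuad_val]
  rfl

theorem addPW_nil_left (g : PWQ) : (addPW [] g).val = [] := by simp [addPW]
theorem addPW_nil_right (f : PWQ) : (addPW f []).val = [] := by cases f <;> simp [addPW]

theorem Rep.cons_of_lt_top {F : ℝ → ℝ} {lo : EReal} {l : PWQ} (h : Rep F lo l) (hlo : lo < ⊤) :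
    ∃ p l', l = p :: l' := by
  cases l with
  | nil => exact absurd h hlo.ne
  | cons p l => exact ⟨p, l, rfl⟩

theorem Rep.eq_nil_of_top {F : ℝ → ℝ} {l : PWQ} (h : Rep F ⊤ l) : l = [] := by
  cases l with
  | nil => rfl
  | cons p l => exact absurd h.1 (not_lt.2 le_top)

theorem Kinked.cons {p : Piece} {l : PWQ} (hl : Kinked l)
    (h : ∀ r ∈ l.head?, ∀ t : ℝ, p.hi = (t : EReal) → p.q.slopeAt t < r.q.slopeAt t) :
    Kinked (p :: l) := by
  rw [Kinked, List.isChain_cons]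
  exact ⟨h, hl⟩

/-- At a breakpoint of the sum the derivative of one summand jumps upwards, and that of the other
does not jump downwards, so that the sum is kinked. -/
theorem addPW_spec {F G : ℝ → ℝ} {f g : PWQ} {lo : EReal} (hf : Rep F lo f) (hg : Rep G lo g)
    (hkf : Kinked f) (hkg : Kinked g) :
    Rep (fun x => F x + G x) lo (addPW f g).val ∧ Kinked (addPW f g).val ∧
      (∀ r ∈ (addPW f g).val.head?, ∀ p ∈ f.head?, ∀ q ∈ g.head?, r.q = p.q.sum q.q) ∧
      ∀ r ∈ (addPW f g).val, ∃ p ∈ f, ∃ q ∈ g, r.q = p.q.sum q.q := by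
  induction hn : f.length + g.length using Nat.strong_induction_on generalizing f g lo with
  | _ n ih =>
    rcases f with - | ⟨p, f⟩
    · rw [addPW_nil_left]
      exact ⟨hf, by simp [Kinked], by simp, by simp⟩
    rcases g with - | ⟨q, g⟩
    · rw [addPW_nil_right]
      exact ⟨hg, by simp [Kinked], by simp, by simp⟩
    have hf' := hf
    have hg' := hg
    obtain ⟨f₁, f₂, f₃⟩ := hf
    obtain ⟨g₁, g₂, g₃⟩ := hg
    have hkf' := hkf
    have hkg' := hkg
    rw [Kinked, List.isChain_cons] at hkf hkg
    have hev : ∀ x : ℝ, lo ≤ x → (x : EReal) ≤ p.hi → (x : EReal) ≤ q.hi →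
        (p.q.sum q.q).eval x = F x + G x := fun x hx hp hq => by
      rw [Quad.eval_sum, f₂ x hx hp, g₂ x hx hq]
    rw [addPW_cons_val]
    split_ifs with h₁ h₂
    · have hgq : Rep G p.hi (q :: g) := ⟨h₁, fun x hx => g₂ x (f₁.le.trans hx), g₃⟩
      obtain ⟨i₁, i₂, i₃, i₄⟩ := ih (f.length + (q :: g).length) (by simp at hn ⊢; omega)
        f₃ hgq hkf.2 hkg' rfl
      refine ⟨⟨f₁, fun x hx hx' => hev x hx hx' (hx'.trans h₁.le), i₁⟩, i₂.cons ?_, ?_, ?_⟩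
      · intro r hr t ht
        obtain ⟨p', f', rfl⟩ := f₃.cons_of_lt_top (h₁.trans_le le_top)
        rw [i₃ r hr p' (by simp) q (by simp), Quad.slopeAt_sum, Quad.slopeAt_sum]
        have := hkf.1 p' (by simp) t ht
        linarith
      · simp
      · intro r hr
        rcases List.mem_cons.1 hr with rfl | hr
        · exact ⟨p, by simp, q, by simp, rfl⟩
        · obtain ⟨p', hp', h⟩ := i₄ r hr
          exact ⟨p', List.mem_cons_of_mem _ hp', h⟩
    · have hfp : Rep F q.hi (p :: f) := ⟨h₂, fun x hx => f₂ x (g₁.le.trans hx), f₃⟩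
      obtain ⟨i₁, i₂, i₃, i₄⟩ := ih ((p :: f).length + g.length) (by simp at hn ⊢; omega)
        hfp g₃ hkf' hkg.2 rfl
      refine ⟨⟨g₁, fun x hx hx' => hev x hx (hx'.trans h₂.le) hx', i₁⟩, i₂.cons ?_, ?_, ?_⟩
      · intro r hr t ht
        obtain ⟨q', g', rfl⟩ := g₃.cons_of_lt_top (h₂.trans_le le_top)
        rw [i₃ r hr p (by simp) q' (by simp), Quad.slopeAt_sum, Quad.slopeAt_sum]
        have := hkg.1 q' (by simp) t ht
        linarith
      · simp
      · intro r hr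
        rcases List.mem_cons.1 hr with rfl | hr
        · exact ⟨p, by simp, q, by simp, rfl⟩
        · obtain ⟨p', hp', q', hq', h⟩ := i₄ r hr
          exact ⟨p', hp', q', List.mem_cons_of_mem _ hq', h⟩
    · have hpq : p.hi = q.hi := le_antisymm (not_lt.1 h₂) (not_lt.1 h₁)
      rw [← hpq] at g₃
      obtain ⟨i₁, i₂, i₃, i₄⟩ := ih (f.length + g.length) (by simp at hn ⊢; omega)
        f₃ g₃ hkf.2 hkg.2 rfl
      refine ⟨⟨f₁, fun x hx hx' => hev x hx hx' (hpq ▸ hx'), i₁⟩, i₂.cons ?_, ?_, ?_⟩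
      · intro r hr t ht
        have hlt : p.hi < ⊤ := by rw [ht]; exact EReal.coe_lt_top t
        obtain ⟨p', f', rfl⟩ := f₃.cons_of_lt_top hlt
        obtain ⟨q', g', rfl⟩ := g₃.cons_of_lt_top hlt
        rw [i₃ r hr p' (by simp) q' (by simp), Quad.slopeAt_sum, Quad.slopeAt_sum]
        have h1 := hkf.1 p' (by simp) t ht
        have h2 := hkg.1 q' (by simp) t (hpq ▸ ht)
        simp only at ht ⊢
        linarith
      · simp
      · intro r hr
        rcases List.mem_cons.1 hr with rfl | hr
        · exact ⟨p, by simp, q, by simp, rfl⟩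
        · obtain ⟨p', hp', q', hq', h⟩ := i₄ r hr
          exact ⟨p', List.mem_cons_of_mem _ hp', q', List.mem_cons_of_mem _ hq', h⟩

theorem MaxRep.add {F G : ℝ → ℝ} {f g : PWQ} (hf : MaxRep F f) (hg : MaxRep G g) :
    MaxRep (fun x => F x + G x) (addPW f g).val ∧
      ∀ r ∈ (addPW f g).val, ∃ p ∈ f, ∃ q ∈ g, r.q = p.q.sum q.q := by
  obtain ⟨h₁, h₂, -, h₄⟩ := addPW_spec hf.rep hg.rep hf.kinked hg.kinked
  refine ⟨⟨h₁, fun r hr x => ?_, h₂⟩, h₄⟩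
  obtain ⟨p, hp, q, hq, h⟩ := h₄ r hr
  rw [h, Quad.eval_sum]
  exact add_le_add (hf.le p hp x) (hg.le q hq x)

/-- Curvatures add up: if `A v` bounds the curvatures of the pieces of `FS v`, then `Q u v ^ 2 * A
v` bounds those of `x ↦ FS v (-Q u v * x)`. -/
theorem sumConjugates_spec {n : ℕ} (Q : Matrix (Fin n) (Fin n) ℝ) (u : Fin n) (fs : Arr n PWQ)
    (FS : Fin n → ℝ → ℝ) (A : Fin n → ℝ) (vs : List (Fin n)) (hQ : ∀ v ∈ vs, Q u v ≠ 0)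
    (hfs : ∀ v ∈ vs, MaxRep (FS v) (fs v) ∧ ∀ p ∈ fs v, p.q.a ≤ A v) {F : ℝ → ℝ} {B : ℝ} {g : PWQ}
    (hg : MaxRep F g) (hB : ∀ p ∈ g, p.q.a ≤ B) :
    MaxRep (fun x => F x + (vs.map fun v => FS v (-Q u v * x)).sum)
        (sumConjugates Q u fs vs g).val ∧
      ∀ p ∈ (sumConjugates Q u fs vs g).val,
        p.q.a ≤ B + (vs.map fun v => Q u v ^ 2 * A v).sum := by
  induction vs generalizing F B g with
  | nil => simpa [sumConjugates] using ⟨hg, hB⟩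
  | cons v vs ih =>
    have hval : (sumConjugates Q u fs (v :: vs) g).val =
        (sumConjugates Q u fs vs (addPW g (scalePW (-Q u v) (fs v)).val).val).val := rfl
    rw [hval]
    obtain ⟨hv, hA⟩ := hfs v List.mem_cons_self
    obtain ⟨s₁, s₂⟩ := hv.scale (neg_ne_zero.2 (hQ v List.mem_cons_self))
    obtain ⟨a₁, a₂⟩ := hg.add s₁
    have hB' : ∀ p ∈ (addPW g (scalePW (-Q u v) (fs v)).val).val,
        p.q.a ≤ B + Q u v ^ 2 * A v := by
      intro p hp
      obtain ⟨q, hq, r, hr, h⟩ := a₂ p hp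
      obtain ⟨s, hs, h'⟩ := s₂ r hr
      rw [h, h']
      have h1 := hB q hq
      have h2 := mul_le_mul_of_nonneg_left (hA s hs) (sq_nonneg (Q u v))
      simp only [Quad.sum, Quad.scale]
      nlinarith
    obtain ⟨i₁, i₂⟩ := ih (fun w hw => hQ w (List.mem_cons_of_mem _ hw))
      (fun w hw => hfs w (List.mem_cons_of_mem _ hw)) a₁ hB'
    simp only [List.map_cons, List.sum_cons, ← add_assoc]
    exact ⟨i₁, i₂⟩

theorem Kinked.quad_ne {F : ℝ → ℝ} {l : PWQ} {lo : EReal} (hr : Rep F lo l) (h : Kinked l) :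
    l.IsChain fun p q => p.q ≠ q.q := by
  induction l generalizing lo with
  | nil => simp
  | cons p l ih =>
    rw [Kinked, List.isChain_cons] at h
    rw [List.isChain_cons]
    refine ⟨fun q hq heq => ?_, ih hr.2.2 h.2⟩
    have hbot : p.hi ≠ ⊥ := (bot_le.trans_lt hr.1).ne'
    have htop : p.hi ≠ ⊤ := by
      intro ht
      have := hr.2.2
      rw [ht] at this
      rw [this.eq_nil_of_top] at hq
      simp at hq
    have := h.1 q hq p.hi.toReal (EReal.coe_toReal htop hbot).symm
    rw [heq] at this
    exact lt_irrefl _ this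

/-- A quadratic minus a maximum of quadratics is a minimum of quadratics; these are strongly convex
if the curvatures of the conjugates are small enough. -/
theorem parametricCost_spec {n : ℕ} (Q : Matrix (Fin n) (Fin n) ℝ) (c : Arr n ℝ) (u : Fin n)
    (vs : List (Fin n)) (fs : Arr n PWQ) (FS : Fin n → ℝ → ℝ) (A : Fin n → ℝ)
    (hQ : ∀ v ∈ vs, Q u v ≠ 0)
    (hfs : ∀ v ∈ vs, MaxRep (FS v) (fs v) ∧ ∀ p ∈ fs v, p.q.a ≤ A v)
    (hpos : 0 < Q u u / 2 - (vs.map fun v => Q u v ^ 2 * A v).sum) :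
    MinRep (fun x => Q u u / 2 * x ^ 2 + c u * x - (vs.map fun v => FS v (-Q u v * x)).sum)
        (parametricCost Q c u vs fs).val ∧
      ∀ p ∈ (parametricCost Q c u vs fs).val,
        Q u u / 2 - (vs.map fun v => Q u v ^ 2 * A v).sum ≤ p.q.a := by
  have h0 : MaxRep (fun _ => 0) [⟨⊤, ⟨0, 0, 0⟩⟩] :=
    ⟨⟨bot_lt_top, fun x _ _ => by simp [Quad.eval], rfl⟩, by simp [Quad.eval], by simp [Kinked]⟩
  obtain ⟨h₁, h₂⟩ := sumConjugates_spec Q u fs FS A vs hQ hfs h0 (B := 0) (by simp)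
  set S := (sumConjugates Q u fs vs [⟨⊤, ⟨0, 0, 0⟩⟩]).val with hS
  have hval : (parametricCost Q c u vs fs).val =
      S.map fun p => ⟨p.hi, (⟨Q u u / 2, c u, 0⟩ : Quad).diff p.q⟩ := by
    rw [← subFromQuad_val]; rfl
  have ha : ∀ p ∈ (S.map fun p => ⟨p.hi, (⟨Q u u / 2, c u, 0⟩ : Quad).diff p.q⟩ : PWQ),
        Q u u / 2 - (vs.map fun v => Q u v ^ 2 * A v).sum ≤ p.q.a := by
    intro p hp
    obtain ⟨r, hr, rfl⟩ := List.mem_map.1 hp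
    have := h₂ r hr
    simp only [Quad.diff]
    linarith
  rw [hval]
  have ev : ∀ (q : Quad) x, ((⟨Q u u / 2, c u, 0⟩ : Quad).diff q).eval x =
      Q u u / 2 * x ^ 2 + c u * x - q.eval x := by
    intro q x; rw [Quad.eval_diff]; simp only [Quad.eval]; ring
  refine ⟨⟨?_, ?_, fun p hp => hpos.trans_le (ha p hp), ?_⟩, ha⟩
  · have := h₁.rep.map (φ := fun q => (⟨Q u u / 2, c u, 0⟩ : Quad).diff q)
      (ψ := fun x y => Q u u / 2 * x ^ 2 + c u * x - y) ev
    simpa using this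
  · intro p hp x
    obtain ⟨r, hr, rfl⟩ := List.mem_map.1 hp
    rw [ev]
    have := h₁.le r hr x
    simp only [zero_add] at this
    linarith
  · rw [List.isChain_map]
    refine List.IsChain.imp (fun p q hpq h => hpq ?_) (h₁.kinked.quad_ne h₁.rep)
    simp only [Quad.diff, Quad.mk.injEq] at h
    obtain ⟨e₁, e₂, e₃⟩ := h
    have : ∀ a b : Quad, a.a = b.a → a.b = b.b → a.c = b.c → a = b := by
      rintro ⟨⟩ ⟨⟩ h₁ h₂ h₃
      simp_all
    exact this _ _ (by linarith) (by linarith) (by linarith)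

/-! ### Minimization -/

theorem minLoop_spec (b c : ℝ) (l : PWQ) (hpos : ∀ p ∈ l, 0 < p.q.a) (best : ℝ × ℝ) :
    (minLoop b c l best).val.1 ≤ best.1 ∧
      (∀ p ∈ l, ∀ y, (minLoop b c l best).val.1 ≤ p.q.eval y + b * y + c) ∧
      ((minLoop b c l best).val = best ∨ ∃ p ∈ l, (minLoop b c l best).val.1 =
        p.q.eval (minLoop b c l best).val.2 + b * (minLoop b c l best).val.2 + c) := by
  induction l generalizing best with
  | nil => exact ⟨le_rfl, by simp, Or.inl rfl⟩
  | cons p l ih =>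
    set x := p.q.touch (-b) with hx
    set v := p.q.eval x + b * x + c with hv
    have hmin : ∀ y, v ≤ p.q.eval y + b * y + c := by
      intro y
      have h1 := Quad.fenchel_touch (hpos p (by simp)) (-b)
      have h2 := Quad.fenchel_le (hpos p (by simp)) (-b) y
      rw [hv, hx]
      linarith
    have hval : (minLoop b c (p :: l) best).val =
        if v < best.1 then (minLoop b c l (v, x)).val else (minLoop b c l best).val := by
      simp only [minLoop, bind_val, ite_val, isLt_val]
      rfl
    rw [hval]
    split_ifs with h
    · obtain ⟨i₁, i₂, i₃⟩ := ih (fun p hp => hpos p (List.mem_cons_of_mem _ hp)) (v, x)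
      refine ⟨i₁.trans h.le, fun q hq y => ?_, Or.inr ?_⟩
      · rcases List.mem_cons.1 hq with rfl | hq
        · exact i₁.trans (hmin y)
        · exact i₂ q hq y
      · rcases i₃ with h' | ⟨q, hq, h'⟩
        · exact ⟨p, by simp, by rw [h']⟩
        · exact ⟨q, List.mem_cons_of_mem _ hq, h'⟩
    · obtain ⟨i₁, i₂, i₃⟩ := ih (fun p hp => hpos p (List.mem_cons_of_mem _ hp)) best
      refine ⟨i₁, fun q hq y => ?_, ?_⟩
      · rcases List.mem_cons.1 hq with rfl | hq
        · exact i₁.trans ((not_lt.1 h).trans (hmin y))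
        · exact i₂ q hq y
      · rcases i₃ with h' | ⟨q, hq, h'⟩
        · exact Or.inl h'
        · exact Or.inr ⟨q, List.mem_cons_of_mem _ hq, h'⟩

/-- Comparing the unconstrained minima of all pieces with the value at `0` gives the minimum,
since every piece majorizes the function. -/
theorem minimize_spec {g : ℝ → ℝ} {l : PWQ} (h : MinRep g l) {c : ℝ} (hc : 0 < c) (b : ℝ) :
    (minimize l c b).val.1 = g (minimize l c b).val.2 +
        (if (minimize l c b).val.2 = 0 then 0 else c) + b * (minimize l c b).val.2 ∧
      ∀ y, (minimize l c b).val.1 ≤ g y + (if y = 0 then 0 else c) + b * y := by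
  have hval : (minimize l c b).val = (minLoop b c l (g 0, 0)).val := by
    have : (evalPW 0 l).val = g 0 := evalPW_val h.rep bot_le
    rw [← this]
    rfl
  obtain ⟨m₁, m₂, m₃⟩ := minLoop_spec b c l h.pos (g 0, 0)
  rw [hval]
  set r := (minLoop b c l (g 0, 0)).val with hr
  have lower : ∀ y, r.1 ≤ g y + (if y = 0 then 0 else c) + b * y := by
    intro y
    by_cases hy : y = 0
    · subst hy
      simpa using m₁
    · obtain ⟨p, hp, he⟩ := h.rep.exists_piece (x := y) bot_le
      have := m₂ p hp y
      simp only [hy, if_false]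
      linarith
  refine ⟨?_, lower⟩
  rcases m₃ with h' | ⟨p, hp, h'⟩
  · rw [h']; simp
  · refine le_antisymm (lower _) ?_
    have h1 := h.le p hp r.2
    have h2 : (if r.2 = 0 then (0 : ℝ) else c) ≤ c := by split_ifs <;> linarith
    linarith

/-! ### Lengths and costs of the list programs -/

theorem length_shiftPW (c : ℝ) (l : PWQ) : (shiftPW c l).val.length = l.length := by
  rw [shiftPW_val, List.length_map]

theorem length_scaleNeg (κ inv : ℝ) (lo : EReal) (acc l : PWQ) :
    (scaleNeg κ inv lo acc l).val.length = acc.length + l.length := by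
  induction l generalizing lo acc with
  | nil => rfl
  | cons p l ih =>
    refine (ih p.hi (⟨lo * (inv : EReal), p.q.scale κ⟩ :: acc)).trans ?_
    simp only [List.length_cons]; omega

theorem length_scalePW (κ : ℝ) (l : PWQ) : (scalePW κ l).val.length = l.length := by
  simp only [scalePW, bind_val, ite_val]
  split_ifs
  · rw [scalePos_val, List.length_map]
  · rw [length_scaleNeg]; simp

/-- Two lists with `j` and `k` breakpoints in `ℝ` have at most `j + k` breakpoints when merged; the
breakpoint `+∞` is common to both. -/
theorem length_addPW_le (f g : PWQ) : (addPW f g).val.length ≤ f.length + g.length - 1 := by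
  induction hn : f.length + g.length using Nat.strong_induction_on generalizing f g with
  | _ n ih =>
    rcases f with - | ⟨p, f⟩
    · simp [addPW_nil_left]
    rcases g with - | ⟨q, g⟩
    · simp [addPW_nil_right]
    rw [addPW_cons_val]
    simp only [List.length_cons] at hn
    have i₁ := ih _ (by simp only [List.length_cons]; omega) f (q :: g) rfl
    have i₂ := ih _ (by simp only [List.length_cons]; omega) (p :: f) g rfl
    have i₃ := ih _ (by omega) f g rfl
    simp only [List.length_cons] at i₁ i₂
    split_ifs <;> simp only [List.length_cons] <;> omega

/-- Cutting out the part between `β` and `γ` increases the number of pieces by at most one. -/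
theorem length_keepBelow_add_le {β γ : EReal} (h : β < γ) (right l : PWQ) :
    (keepBelow β right l).val.length + (dropBelow γ l).val.length ≤
      l.length + 1 + right.length := by
  induction l with
  | nil => simp [keepBelow, dropBelow]
  | cons p l ih =>
    have hk : (keepBelow β right (p :: l)).val = if p.hi < β then
        ⟨p.hi, p.q⟩ :: (keepBelow β right l).val else ⟨β, p.q⟩ :: right := by
      simp only [keepBelow, bind_val, ite_val, isLtExt_val, consPiece_val]
    have hd : (dropBelow γ (p :: l)).val = if p.hi ≤ γ then (dropBelow γ l).val else p :: l := by
      simp only [dropBelow, bind_val, ite_val, isLeExt_val, pure_val]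
    have hle : ∀ l : PWQ, (dropBelow γ l).val.length ≤ l.length := by
      intro l
      induction l with
      | nil => simp [dropBelow]
      | cons p l ih =>
        simp only [dropBelow, bind_val, ite_val, pure_val]
        split_ifs
        · simp only [List.length_cons]; omega
        · exact le_rfl
    rw [hk]
    split_ifs with c₁
    · rw [hd, if_pos (c₁.trans h).le]
      simp only [List.length_cons]; omega
    · have := hle (p :: l)
      simp only [List.length_cons] at this ⊢; omega

theorem length_conjFromStack (hi : EReal) (acc : PWQ) (st : List Cand) :
    (conjFromStack hi acc st).val.length = acc.length + st.length := by
  induction st generalizing hi acc with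
  | nil => rfl
  | cons e st ih =>
    refine (ih e.gam (⟨hi, e.seg.q.conj⟩ :: acc)).trans ?_
    simp only [List.length_cons]; omega

theorem cost_evalPW (x : ℝ) (l : PWQ) : Cost (evalPW x l) (8 * l.length + 1) := by
  induction l with
  | nil =>
    rw [evalPW]
    exact Cost.mono (Cost.step.bind (Cost.pure _)) (by simp)
  | cons p l ih =>
    rw [evalPW]
    refine Cost.mono (Cost.step.bind ((Cost.instr _).bind ((Cost.instr _).bind
      (Cost.ite (B := 8 * l.length + 5) (fun _ => (cost_evalQuad _ _).mono (by omega))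
        fun _ => ih.mono (by omega))))) ?_
    simp only [List.length_cons]; omega

theorem cost_addPW (f g : PWQ) : Cost (addPW f g) (15 * (f.length + g.length) + 1) := by
  induction hn : f.length + g.length using Nat.strong_induction_on generalizing f g with
  | _ n ih =>
    rcases f with - | ⟨p, f⟩
    · rw [addPW]
      exact Cost.mono (Cost.step.bind (Cost.pure _)) (by omega)
    rcases g with - | ⟨q, g⟩
    · rw [addPW]
      exact Cost.mono (Cost.step.bind (Cost.pure _)) (by omega)
    rw [addPW]
    simp only [List.length_cons] at hn
    have i₁ := ih _ (by simp only [List.length_cons]; omega) f (q :: g) rfl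
    have i₂ := ih _ (by simp only [List.length_cons]; omega) (p :: f) g rfl
    have i₃ := ih _ (by omega) f g rfl
    simp only [List.length_cons] at i₁ i₂
    refine Cost.mono (Cost.step.bind ((cost_addQuad _ _).bind ((Cost.instr _).bind (Cost.ite
      (B := 15 * (f.length + g.length + 1) + 7)
      (fun _ => Cost.mono (i₁.bind (Cost.store 5 _)) (by omega)) fun _ => ?_)))) (by omega)
    refine Cost.mono ((Cost.instr _).bind (Cost.ite (B := 15 * (f.length + g.length + 1) + 6)
      (fun _ => Cost.mono (i₂.bind (Cost.store 5 _)) (by omega))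
      fun _ => Cost.mono (i₃.bind (Cost.store 5 _)) (by omega))) (by omega)

theorem cost_scalePos (κ inv : ℝ) (l : PWQ) : Cost (scalePos κ inv l) (14 * l.length + 1) := by
  induction l with
  | nil =>
    rw [scalePos]
    exact Cost.mono (Cost.step.bind (Cost.pure _)) (by simp)
  | cons p l ih =>
    rw [scalePos]
    refine Cost.mono (Cost.step.bind ((Cost.instr _).bind ((cost_scaleQuad _ _).bind (ih.bind
      (Cost.store 5 _))))) ?_
    simp only [List.length_cons]; omega

theorem cost_scaleNeg (κ inv : ℝ) (lo : EReal) (acc l : PWQ) :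
    Cost (scaleNeg κ inv lo acc l) (14 * l.length + 1) := by
  induction l generalizing lo acc with
  | nil =>
    rw [scaleNeg]
    exact Cost.mono (Cost.step.bind (Cost.pure _)) (by simp)
  | cons p l ih =>
    rw [scaleNeg]
    refine Cost.mono (Cost.step.bind ((Cost.instr _).bind ((cost_scaleQuad _ _).bind
      ((Cost.store 5 _).bind (ih _ _))))) ?_
    simp only [List.length_cons]; omega

theorem cost_scalePW (κ : ℝ) (l : PWQ) : Cost (scalePW κ l) (14 * l.length + 4) := by
  unfold scalePW
  exact Cost.mono (Cost.step.bind ((Cost.instr _).bind ((Cost.instr _).bind (Cost.ite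
    (fun _ => cost_scalePos _ _ _) fun _ => cost_scaleNeg _ _ _ _ _)))) (by omega)

theorem cost_shiftPW (c : ℝ) (l : PWQ) : Cost (shiftPW c l) (10 * l.length + 1) := by
  induction l with
  | nil =>
    rw [shiftPW]
    exact Cost.mono (Cost.step.bind (Cost.pure _)) (by simp)
  | cons p l ih =>
    rw [shiftPW]
    refine Cost.mono (Cost.step.bind ((Cost.instr _).bind ((Cost.store 3 _).bind (ih.bind
      (Cost.store 5 _))))) ?_
    simp only [List.length_cons]; omega

theorem cost_subFromQuad (r : Quad) (l : PWQ) : Cost (subFromQuad r l) (13 * l.length + 1) := by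
  induction l with
  | nil =>
    rw [subFromQuad]
    exact Cost.mono (Cost.step.bind (Cost.pure _)) (by simp)
  | cons p l ih =>
    rw [subFromQuad]
    refine Cost.mono (Cost.step.bind ((cost_subQuad _ _).bind (ih.bind (Cost.store 5 _)))) ?_
    simp only [List.length_cons]; omega

/-- Deleting elements of the stack is paid for by the shrinking of the stack. -/
theorem cost_insertPiece (j : Seg) (st : List Cand) :
    (insertPiece j st).val.length ≤ st.length + 1 ∧
      Cost (insertPiece j st) (100 * (st.length + 2) - 100 * (insertPiece j st).val.length) := by
  induction st with
  | nil =>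
    refine ⟨le_rfl, ?_⟩
    rw [insertPiece]
    exact Cost.mono (Cost.step.bind (Cost.store 3 _)) (by simp)
  | cons i st ih =>
    have hval : (insertPiece j (i :: st)).val =
        if i.gam < (slope i.seg j).val then ⟨(slope i.seg j).val, j⟩ :: i :: st
        else (insertPiece j st).val := by
      simp only [insertPiece, bind_val, ite_val, isLtExt_val, store_val]
    rw [hval]
    split_ifs with h
    · refine ⟨by simp, ?_⟩
      rw [insertPiece]
      refine Cost.mono (Cost.step.bind ((cost_slope _ _).bind ((Cost.instr _).bind
        (Cost.ite (B := 3) (fun _ => Cost.store _ _)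
          fun h' => absurd ((isLtExt_val _ _).mpr h) h')))) ?_
      simp only [List.length_cons]; omega
    · obtain ⟨i₁, i₂⟩ := ih
      refine ⟨by simp only [List.length_cons]; omega, ?_⟩
      rw [insertPiece]
      refine Cost.mono (Cost.step.bind ((cost_slope _ _).bind ((Cost.instr _).bind (Cost.ite
        (fun h' => absurd ((isLtExt_val _ _).mp h') h) fun _ => i₂)))) ?_
      simp only [List.length_cons]; omega

theorem cost_scanPieces (lo : EReal) (l : PWQ) (st : List Cand) :
    (scanPieces lo l st).val.length ≤ st.length + l.length ∧
      Cost (scanPieces lo l st) (100 * st.length + 206 * l.length + 1) := by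
  suffices h : (scanPieces lo l st).val.length ≤ st.length + l.length ∧
      Cost (scanPieces lo l st) (100 * st.length + 206 * l.length + 1 -
        100 * (scanPieces lo l st).val.length) from ⟨h.1, h.2.mono (by omega)⟩
  induction l generalizing lo st with
  | nil =>
    refine ⟨le_rfl, ?_⟩
    rw [scanPieces]
    exact Cost.mono (Cost.step.bind (Cost.pure _)) (by simp)
  | cons p l ih =>
    have hval : (scanPieces lo (p :: l) st).val =
        (scanPieces p.hi l (insertPiece ⟨lo, p.hi, p.q⟩ st).val).val := rfl
    obtain ⟨c₁, c₂⟩ := cost_insertPiece ⟨lo, p.hi, p.q⟩ st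
    obtain ⟨i₁, i₂⟩ := ih p.hi (insertPiece ⟨lo, p.hi, p.q⟩ st).val
    rw [hval]
    refine ⟨by simp only [List.length_cons]; omega, ?_⟩
    rw [scanPieces]
    refine Cost.mono (Cost.step.bind ((Cost.store 5 _).bind (c₂.bind i₂))) ?_
    simp only [List.length_cons]; omega

theorem cost_conjFromStack (hi : EReal) (acc : PWQ) (st : List Cand) :
    Cost (conjFromStack hi acc st) (18 * st.length + 1) := by
  induction st generalizing hi acc with
  | nil =>
    rw [conjFromStack]
    exact Cost.mono (Cost.step.bind (Cost.pure _)) (by simp)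
  | cons e st ih =>
    rw [conjFromStack]
    refine Cost.mono (Cost.step.bind ((cost_conjQuad _).bind ((Cost.store 5 _).bind (ih _ _)))) ?_
    simp only [List.length_cons]; omega

theorem cost_consIfInside (lo hi : EReal) (r : ℝ) (rs : List ℝ) :
    Cost (consIfInside lo hi r rs) 6 := by
  unfold consIfInside
  exact Cost.mono (Cost.step.bind ((Cost.instr _).bind ((Cost.instr _).bind (Cost.ite (B := 3)
    (fun _ => Cost.mono ((Cost.instr _).bind (Cost.ite (B := 2) (fun _ => Cost.store _ _)
      fun _ => (Cost.pure _).mono (by simp))) (by simp))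
    fun _ => (Cost.pure _).mono (by simp))))) (by simp)

theorem length_consIfInside (lo hi : EReal) (r : ℝ) (rs : List ℝ) :
    (consIfInside lo hi r rs).val.length ≤ rs.length + 1 := by
  rw [consIfInside_val]
  split_ifs <;> simp

theorem cost_levelRoots (m : ℝ) (lo : EReal) (l : PWQ) :
    (levelRoots m lo l).val.length ≤ 2 * l.length ∧
      Cost (levelRoots m lo l) (34 * l.length + 1) := by
  induction l generalizing lo with
  | nil =>
    refine ⟨le_rfl, ?_⟩
    rw [levelRoots]
    exact Cost.mono (Cost.step.bind (Cost.pure _)) (by simp)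
  | cons p l ih =>
    obtain ⟨i₁, i₂⟩ := ih p.hi
    constructor
    · simp only [levelRoots, bind_val]
      cases (rootsQuad (newQuad p.q.a p.q.b (TreeMIQP.sub p.q.c m).val).val).val with
      | none => simp only [pure_val, List.length_cons]; omega
      | some r =>
        simp only [bind_val, List.length_cons]
        have h₁ := length_consIfInside lo p.hi r.2 (levelRoots m p.hi l).val
        have h₂ := length_consIfInside lo p.hi r.1
          (consIfInside lo p.hi r.2 (levelRoots m p.hi l).val).val
        omega
    · rw [levelRoots]
      refine Cost.mono (Cost.step.bind ((Cost.instr _).bind ((Cost.store 3 _).bind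
        ((cost_rootsQuad _).bind (i₂.bind (B₂ := 12) ?_)))))
        (by simp only [List.length_cons]; omega)
      split
      · exact (Cost.pure _).mono (by simp)
      · exact (cost_consIfInside _ _ _ _).bind (cost_consIfInside _ _ _ _)

theorem cost_lastRoot (r : ℝ) (rs : List ℝ) : Cost (lastRoot r rs) (rs.length + 1) := by
  induction rs generalizing r with
  | nil =>
    rw [lastRoot]
    exact Cost.mono (Cost.step.bind (Cost.pure _)) (by simp)
  | cons s rs ih =>
    rw [lastRoot]
    exact Cost.mono (Cost.step.bind (ih s)) (by simp only [List.length_cons]; omega)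

theorem cost_keepBelow (β : EReal) (right l : PWQ) :
    Cost (keepBelow β right l) (7 * l.length + 1) := by
  induction l with
  | nil =>
    rw [keepBelow]
    exact Cost.mono (Cost.step.bind (Cost.pure _)) (by simp)
  | cons p l ih =>
    rw [keepBelow]
    refine Cost.mono (Cost.step.bind ((Cost.instr _).bind (Cost.ite (B := 7 * l.length + 6)
      (fun _ => Cost.mono (ih.bind (Cost.store 5 _)) (by omega))
      fun _ => (Cost.store 5 _).mono (by omega)))) ?_
    simp only [List.length_cons]; omega

theorem cost_dropBelow (β : EReal) (l : PWQ) : Cost (dropBelow β l) (2 * l.length + 1) := by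
  induction l with
  | nil =>
    rw [dropBelow]
    exact Cost.mono (Cost.step.bind (Cost.pure _)) (by simp)
  | cons p l ih =>
    rw [dropBelow]
    refine Cost.mono (Cost.step.bind ((Cost.instr _).bind (Cost.ite
      (fun _ => ih) fun _ => (Cost.pure _).mono (by omega)))) ?_
    simp only [List.length_cons]; omega

/-- The breakpoint algorithm takes linear time and adds at most two pieces, since every piece enters
and leaves the stack at most once and the constant piece cuts at most one piece in two. -/
theorem cost_breakpointAlgorithm (l : PWQ) (c : ℝ) :
    (breakpointAlgorithm l c).val.length ≤ l.length + 2 ∧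
      Cost (breakpointAlgorithm l c) (300 * l.length + 30) := by
  obtain ⟨s₁, s₂⟩ := cost_scanPieces ⊥ l []
  set st := (scanPieces ⊥ l []).val with hst
  simp only [List.length_nil] at s₁ s₂
  have g₁ := length_conjFromStack ⊤ [] st
  have g₂ := cost_conjFromStack ⊤ [] st
  set gs := (conjFromStack ⊤ [] st).val with hgs
  simp only [List.length_nil] at g₁
  have h₁ := length_shiftPW c gs
  have h₂ := cost_shiftPW c gs
  set H := (shiftPW c gs).val with hH
  set m := (neg (evalPW 0 l).val).val with hm
  obtain ⟨r₁, r₂⟩ := cost_levelRoots m ⊥ H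
  constructor
  · simp only [breakpointAlgorithm, bind_val, ← hst, ← hgs, ← hH, ← hm]
    rcases (levelRoots m ⊥ H).val with - | ⟨β, rs⟩
    · simp only [pure_val]; omega
    · simp only [bind_val, ite_val, isLt_val, pure_val]
      split_ifs with hlt
      · have := length_keepBelow_add_le (EReal.coe_lt_coe_iff.2 hlt)
          (⟨(lastRoot β rs).val, ⟨0, 0, m⟩⟩ :: (dropBelow (lastRoot β rs).val H).val) H
        simp only [List.length_cons] at this
        refine le_trans ?_ (show H.length + 2 ≤ _ by omega)
        exact Nat.le_of_add_le_add_right (this.trans (by omega))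
      · omega
  · unfold breakpointAlgorithm
    refine Cost.mono (Cost.step.bind (s₂.bind (g₂.bind (h₂.bind ((cost_evalPW 0 l).bind
      ((Cost.instr _).bind (r₂.bind (B₂ := 12 * H.length + 14) ?_))))))) (by omega)
    split
    · exact (Cost.pure _).mono (by omega)
    · have hlen : (shiftPW c gs).val.length = H.length := rfl
      rename_i β rs hrs
      rw [hrs, List.length_cons] at r₁
      refine Cost.mono ((cost_lastRoot _ _).bind ((Cost.instr _).bind (Cost.ite
        (B := 9 * H.length + 12) (fun _ => ?_)
        fun _ => (Cost.pure _).mono (by omega)))) (by omega)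
      exact Cost.mono ((Cost.instr _).bind ((Cost.instr _).bind ((cost_dropBelow _ _).bind
        ((Cost.store 3 _).bind ((Cost.store 5 _).bind (cost_keepBelow _ _ _)))))) (by omega)

theorem cost_minLoop (b c : ℝ) (l : PWQ) (best : ℝ × ℝ) :
    Cost (minLoop b c l best) (17 * l.length + 1) := by
  induction l generalizing best with
  | nil =>
    rw [minLoop]
    exact Cost.mono (Cost.step.bind (Cost.pure _)) (by simp)
  | cons p l ih =>
    rw [minLoop]
    refine Cost.mono (Cost.step.bind ((Cost.instr _).bind ((cost_tangentPoint _ _).bind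
      ((cost_evalQuad _ _).bind ((Cost.instr _).bind ((Cost.instr _).bind ((Cost.instr _).bind
      ((Cost.instr _).bind (Cost.ite (B := 17 * l.length + 3)
        (fun _ => Cost.mono ((Cost.store 2 _).bind (ih _)) (by omega))
        fun _ => (ih _).mono (by omega)))))))))) ?_
    simp only [List.length_cons]; omega

theorem cost_minimize (l : PWQ) (c b : ℝ) : Cost (minimize l c b) (25 * l.length + 5) := by
  unfold minimize
  exact Cost.mono (Cost.step.bind ((cost_evalPW 0 l).bind ((Cost.store 2 _).bind
    (cost_minLoop _ _ _ _)))) (by omega)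

theorem length_sumConjugates_le {n : ℕ} (Q : Matrix (Fin n) (Fin n) ℝ) (u : Fin n)
    (fs : Arr n PWQ) (vs : List (Fin n)) (hne : ∀ v ∈ vs, fs v ≠ []) (g : PWQ) :
    (sumConjugates Q u fs vs g).val.length ≤
      g.length + (vs.map fun v => (fs v).length - 1).sum := by
  induction vs generalizing g with
  | nil => exact le_rfl
  | cons v vs ih =>
    have hval : (sumConjugates Q u fs (v :: vs) g).val =
        (sumConjugates Q u fs vs (addPW g (scalePW (-Q u v) (fs v)).val).val).val := rfl
    have i := ih (fun w hw => hne w (List.mem_cons_of_mem _ hw))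
      (addPW g (scalePW (-Q u v) (fs v)).val).val
    have h := length_addPW_le g (scalePW (-Q u v) (fs v)).val
    rw [length_scalePW] at h
    have := List.length_pos_iff.2 (hne v List.mem_cons_self)
    rw [hval]
    simp only [List.map_cons, List.sum_cons]
    omega

/-- Every summand costs a merge with a list of at most `N` pieces. -/
theorem cost_sumConjugates {n : ℕ} (Q : Matrix (Fin n) (Fin n) ℝ) (u : Fin n)
    (fs : Arr n PWQ) (N : ℕ) (vs : List (Fin n)) (g : PWQ)
    (hN : g.length + (vs.map fun v => (fs v).length).sum ≤ N) :
    Cost (sumConjugates Q u fs vs g) (vs.length * (29 * N + 9) + 1) := by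
  induction vs generalizing g with
  | nil =>
    rw [sumConjugates]
    exact Cost.mono (Cost.step.bind (Cost.pure _)) (by omega)
  | cons v vs ih =>
    simp only [List.map_cons, List.sum_cons] at hN
    have h := length_addPW_le g (scalePW (-Q u v) (fs v)).val
    rw [length_scalePW] at h
    have ha := cost_addPW g (scalePW (-Q u v) (fs v)).val
    rw [length_scalePW] at ha
    rw [sumConjugates]
    refine Cost.mono (Cost.step.bind ((Cost.instr _).bind ((Cost.instr _).bind ((Cost.instr _).bind
      ((cost_scalePW _ _).bind (ha.bind (ih _ ?_))))))) ?_
    · omega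
    · simp only [List.length_cons, Nat.add_mul]
      change 1 + (1 + (1 + (1 + (14 * (fs v).length + 4 + _)))) ≤ _
      omega

theorem cost_parametricCost {n : ℕ} (Q : Matrix (Fin n) (Fin n) ℝ) (c : Arr n ℝ) (u : Fin n)
    (vs : List (Fin n)) (fs : Arr n PWQ) (hne : ∀ v ∈ vs, fs v ≠ []) (N : ℕ)
    (hN : 1 + (vs.map fun v => (fs v).length).sum ≤ N) :
    (parametricCost Q c u vs fs).val.length ≤ 1 + (vs.map fun v => (fs v).length - 1).sum ∧
      Cost (parametricCost Q c u vs fs) ((vs.length + 1) * (29 * N + 30)) := by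
  have h := length_sumConjugates_le Q u fs vs hne [⟨⊤, ⟨0, 0, 0⟩⟩]
  have hc := cost_sumConjugates Q u fs N vs [⟨⊤, ⟨0, 0, 0⟩⟩] hN
  set S := (sumConjugates Q u fs vs [⟨⊤, ⟨0, 0, 0⟩⟩]).val with hS
  have hsum : (vs.map fun v => (fs v).length - 1).sum ≤ (vs.map fun v => (fs v).length).sum :=
    List.sum_le_sum fun v _ => Nat.sub_le _ _
  simp only [List.length_singleton] at h
  constructor
  · have hval : (parametricCost Q c u vs fs).val =
        (subFromQuad ⟨Q u u / 2, c u, 0⟩ S).val := rfl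
    rw [hval, subFromQuad_val, List.length_map]
    exact h
  · unfold parametricCost
    refine Cost.mono (Cost.step.bind ((Cost.store 3 _).bind ((Cost.store 5 _).bind (hc.bind
      ((Cost.instr _).bind ((Cost.instr _).bind ((Cost.instr _).bind ((Cost.store 3 _).bind
      (cost_subFromQuad _ _))))))))) ?_
    change _ + (_ + (_ + (_ + (_ + (_ + (_ + (_ + (13 * S.length + 1)))))))) ≤ _
    nlinarith

/-! ### Costs of the labeling -/

theorem cost_neighbours {n : ℕ} (Q : Matrix (Fin n) (Fin n) ℝ) (u v : Fin n) (l : List (Fin n)) :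
    Cost (neighbours Q u v l) (7 * l.length + 1) := by
  induction l with
  | nil =>
    rw [neighbours]
    exact Cost.mono (Cost.step.bind (Cost.pure _)) (by simp)
  | cons w l ih =>
    rw [neighbours]
    refine Cost.mono (Cost.step.bind (ih.bind ((Cost.instr _).bind (Cost.ite (B := 5)
      (fun _ => (Cost.pure _).mono (by simp)) fun _ => Cost.mono ((Cost.instr _).bind
      (Cost.ite (B := 4) (fun _ => (Cost.pure _).mono (by simp))
      fun _ => Cost.mono ((Cost.instr _).bind
      ((Cost.instr _).bind (Cost.ite (B := 2) (fun _ => (Cost.pure _).mono (by simp))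
        fun _ => Cost.store _ _))) (by simp))) (by simp))))) ?_
    simp only [List.length_cons]; omega

open Classical in
theorem neighbours_val {n : ℕ} (Q : Matrix (Fin n) (Fin n) ℝ) (u v : Fin n) (l : List (Fin n)) :
    (neighbours Q u v l).val = l.filter fun w => decide (w ≠ u ∧ w ≠ v ∧ Q u w ≠ 0) := by
  induction l with
  | nil => rfl
  | cons w l ih =>
    simp only [neighbours, bind_val, ite_val, sameNode, instr_val, decide_eq_true_eq, entry,
      isEq_val, store_val, pure_val, ih, List.filter_cons]
    split_ifs <;> simp_all

theorem pushPairs_val {n : ℕ} (u : Fin n) (ws : List (Fin n)) (st : List (Fin n × Fin n)) :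
    (pushPairs u ws st).val = (ws.reverse.map fun w => (w, u)) ++ st := by
  induction ws generalizing st with
  | nil => rfl
  | cons w ws ih =>
    refine (ih ((w, u) :: st)).trans ?_
    simp

theorem cost_pushPairs {n : ℕ} (u : Fin n) (ws : List (Fin n)) (st : List (Fin n × Fin n)) :
    Cost (pushPairs u ws st) (4 * ws.length + 1) := by
  induction ws generalizing st with
  | nil =>
    rw [pushPairs]
    exact Cost.mono (Cost.step.bind (Cost.pure _)) (by simp)
  | cons w ws ih =>
    rw [pushPairs]
    refine Cost.mono (Cost.step.bind ((Cost.store 3 _).bind (ih _))) ?_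
    simp only [List.length_cons]; omega

theorem pushNodes_val {n : ℕ} (ws J : List (Fin n)) :
    (pushNodes ws J).val = ws.reverse ++ J := by
  induction ws generalizing J with
  | nil => rfl
  | cons w ws ih =>
    refine (ih (w :: J)).trans ?_
    simp

theorem cost_pushNodes {n : ℕ} (ws J : List (Fin n)) :
    Cost (pushNodes ws J) (3 * ws.length + 1) := by
  induction ws generalizing J with
  | nil =>
    rw [pushNodes]
    exact Cost.mono (Cost.step.bind (Cost.pure _)) (by simp)
  | cons w ws ih =>
    rw [pushNodes]
    refine Cost.mono (Cost.step.bind ((Cost.store 2 _).bind (ih _))) ?_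
    simp only [List.length_cons]; omega

theorem cost_labelLoop {n : ℕ} (Q : Matrix (Fin n) (Fin n) ℝ) (k : ℕ)
    (st : List (Fin n × Fin n)) (T : Rooted n) :
    Cost (labelLoop Q k st T) (k * (11 * n + 7) + 1) := by
  induction k generalizing st T with
  | zero => rw [labelLoop]; exact Cost.mono (Cost.step.bind (Cost.pure _)) (by omega)
  | succ k ih =>
    rcases st with - | ⟨⟨u, v⟩, st⟩
    · rw [labelLoop]; exact Cost.mono (Cost.step.bind (Cost.pure _)) (by omega)
    have hn := cost_neighbours Q u v (List.finRange n)
    rw [List.length_finRange] at hn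
    have hl : (neighbours Q u v (List.finRange n)).val.length ≤ n := by
      rw [neighbours_val]
      exact (List.length_filter_le _ _).trans (by simp)
    rw [labelLoop]
    refine Cost.mono (Cost.step.bind (hn.bind ((cost_pushPairs _ _ _).bind ((Cost.store 2 _).bind
      ((Cost.instr _).bind ((Cost.instr _).bind (ih _ _))))))) ?_
    rw [Nat.add_mul]
    omega

theorem cost_topologicalLabeling {n : ℕ} (Q : Matrix (Fin n) (Fin n) ℝ) (root : Fin n) :
    Cost (topologicalLabeling Q root) (n * (11 * n + 9) + 5) := by
  unfold topologicalLabeling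
  refine Cost.mono (Cost.step.bind ((Cost.store n _).bind ((Cost.store n _).bind
    ((Cost.store 3 _).bind (cost_labelLoop _ _ _ _))))) ?_
  simp only [Nat.mul_add]; omega

theorem cost_backwardPass {n : ℕ} (Q : Matrix (Fin n) (Fin n) ℝ) (lam : Arr n ℝ) (T : Rooted n)
    (f : Arr n PWQ) (N : ℕ) (hf : ∀ u, (f u).length ≤ N) (hp : ∀ u, (T.par u).length ≤ N)
    (k : ℕ) (J : List (Fin n)) (x : Arr n ℝ) :
    Cost (backwardPass Q lam T f k J x) (k * (28 * N + 15) + 1) := by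
  induction k generalizing J x with
  | zero => rw [backwardPass]; exact Cost.mono (Cost.step.bind (Cost.pure _)) (by omega)
  | succ k ih =>
    rcases J with - | ⟨u, J⟩
    · rw [backwardPass]; exact Cost.mono (Cost.step.bind (Cost.pure _)) (by omega)
    rw [backwardPass]
    refine Cost.mono (Cost.step.bind ((Cost.instr _).bind ((Cost.instr _).bind ((Cost.instr _).bind
      ((Cost.instr _).bind ((Cost.instr _).bind ((Cost.instr _).bind ((cost_minimize _ _ _).bind
      ((Cost.instr _).bind ((Cost.instr _).bind ((cost_pushNodes _ _).bind (ih _ _)))))))))))) ?_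
    have h₁ := hf u
    have h₂ := hp u
    change _ + (_ + (_ + (_ + (_ + (_ + (_ + (25 * (f u).length + 5 + (_ + (_ +
      (3 * (T.par u).length + 1 + _)))))))))) ≤ _
    rw [Nat.add_mul]
    omega

/-! ### Rooted trees -/

/-- The support graph of the symmetric matrix `Q` is a tree oriented towards `root`: `ch v` is the
child of `v`, with the convention that the root is its own child, and `d` is a rank function that
decreases from a node to its child (the distance to the root, say). -/
structure Oriented {n : ℕ} (Q : Matrix (Fin n) (Fin n) ℝ) (root : Fin n) (ch : Fin n → Fin n)
    (d : Fin n → ℕ) : Prop where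
  symm : ∀ u v, Q u v = Q v u
  ch_root : ch root = root
  lt : ∀ v, v ≠ root → d (ch v) < d v
  ne_zero : ∀ v, v ≠ root → Q (ch v) v ≠ 0
  adj : ∀ u v, u ≠ v → Q u v ≠ 0 → (u ≠ root ∧ ch u = v) ∨ (v ≠ root ∧ ch v = u)

theorem exists_oriented {n : ℕ} {Q : Matrix (Fin n) (Fin n) ℝ} (hQ : Q.PosDef)
    (hT : (supportGraph Q).IsTree) (root : Fin n) : ∃ ch d, Oriented Q root ch d := by
  classical
  have hsymm : ∀ u v, Q u v = Q v u := fun u v => by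
    have := hQ.isHermitian.apply v u
    simpa using this
  have hadj : ∀ u v, (supportGraph Q).Adj u v ↔ u ≠ v ∧ Q u v ≠ 0 := by
    intro u v
    rw [supportGraph, SimpleGraph.fromRel_adj, hsymm v u, or_self]
  choose p hp hpl using hT.connected.exists_path_of_dist root
  have hnil : ∀ v, v ≠ root → ¬(p v).Nil := fun v hv => SimpleGraph.Walk.not_nil_of_ne hv.symm
  have hpen : ∀ v, v ≠ root → (supportGraph Q).Adj (p v).penultimate v :=
    fun v hv => (p v).adj_penultimate (hnil v hv)
  have hlt : ∀ v, v ≠ root →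
      (supportGraph Q).dist root (p v).penultimate < (supportGraph Q).dist root v := by
    intro v hv
    have h₁ := SimpleGraph.dist_le (p v).dropLast
    have h₂ := (p v).length_dropLast_add_one (hnil v hv)
    rw [hpl v] at h₂
    omega
  -- A neighbour closer to the root prolongs to a shortest path, and paths are unique.
  have huniq : ∀ u v, (supportGraph Q).Adj u v →
      (supportGraph Q).dist root u < (supportGraph Q).dist root v →
      v ≠ root ∧ (p v).penultimate = u := by
    intro u v huv hd
    refine ⟨fun h => by simp [h] at hd, ?_⟩
    have hlen : ((p u).concat huv).length = (supportGraph Q).dist root v := by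
      rw [SimpleGraph.Walk.length_concat, hpl u]
      rcases hT.dist_eq_dist_add_one_of_adj root huv with h | h <;> omega
    have hpath := SimpleGraph.Walk.isPath_of_length_eq_dist _ hlen
    rw [(hT.existsUnique_path root v).unique (hp v) hpath, SimpleGraph.Walk.penultimate_concat]
  refine ⟨fun v => if v = root then root else (p v).penultimate,
    fun v => (supportGraph Q).dist root v, hsymm, by simp, fun v hv => ?_, fun v hv => ?_,
    fun u v huv h => ?_⟩
  · simpa [hv] using hlt v hv
  · simpa [hv] using ((hadj _ _).1 (hpen v hv)).2
  · have ha : (supportGraph Q).Adj u v := (hadj u v).2 ⟨huv, h⟩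
    rcases lt_or_gt_of_ne (hT.dist_ne_of_adj root ha) with hlt | hlt
    · obtain ⟨h₁, h₂⟩ := huniq u v ha hlt
      exact Or.inr ⟨h₁, by rw [if_neg h₁, h₂]⟩
    · obtain ⟨h₁, h₂⟩ := huniq v u ha.symm hlt
      exact Or.inl ⟨h₁, by rw [if_neg h₁, h₂]⟩

/-- A recursive definition along a well-founded relation. -/
theorem exists_recursive {α β : Type} [Inhabited β] {r : α → α → Prop} (hr : WellFounded r)
    (Φ : α → (α → β) → β) (hΦ : ∀ u f g, (∀ v, r v u → f v = g v) → Φ u f = Φ u g) :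
    ∃ f : α → β, ∀ u, f u = Φ u f := by
  classical
  refine ⟨hr.fix fun u rec => Φ u fun v => if h : r v u then rec v h else default, fun u => ?_⟩
  rw [hr.fix_eq]
  exact hΦ u _ _ fun v hv => by simp [hv]

section Oriented

variable {n : ℕ} {Q : Matrix (Fin n) (Fin n) ℝ} {root : Fin n} {ch : Fin n → Fin n}
  {d : Fin n → ℕ}

/-- The parents of `u`. -/
def parents (root : Fin n) (ch : Fin n → Fin n) (u : Fin n) : Finset (Fin n) :=
  Finset.univ.filter fun v => v ≠ root ∧ ch v = u

theorem mem_parents {u v : Fin n} : v ∈ parents root ch u ↔ v ≠ root ∧ ch v = u := by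
  simp [parents]

open Classical in
/-- The list of the parents of `u` in the form in which the search collects it. -/
def parentList (Q : Matrix (Fin n) (Fin n) ℝ) (ch : Fin n → Fin n) (u : Fin n) : List (Fin n) :=
  (List.finRange n).filter fun w => decide (w ≠ u ∧ w ≠ ch u ∧ Q u w ≠ 0)

theorem nodup_parentList (u : Fin n) : (parentList Q ch u).Nodup :=
  (List.nodup_finRange n).filter _

theorem Oriented.ne_ch (h : Oriented Q root ch d) {v : Fin n} (hv : v ≠ root) : v ≠ ch v :=
  fun e => (h.lt v hv).ne (congrArg d e.symm)

theorem Oriented.mem_parentList (h : Oriented Q root ch d) {u w : Fin n} :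
    w ∈ parentList Q ch u ↔ w ≠ root ∧ ch w = u := by
  simp only [parentList, List.mem_filter, List.mem_finRange, true_and, decide_eq_true_eq]
  constructor
  · rintro ⟨h₁, h₂, h₃⟩
    rcases h.adj u w (Ne.symm h₁) h₃ with ⟨-, h'⟩ | h'
    · exact absurd h'.symm h₂
    · exact h'
  · rintro ⟨h₁, rfl⟩
    refine ⟨h.ne_ch h₁, fun e => ?_, h.ne_zero w h₁⟩
    by_cases hr : ch w = root
    · rw [hr, h.ch_root] at e
      exact h₁ e
    · have i₁ := h.lt w h₁
      have i₂ := h.lt _ hr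
      rw [← e] at i₂
      omega

theorem Oriented.parentList_toFinset (h : Oriented Q root ch d) (u : Fin n) :
    (parentList Q ch u).toFinset = parents root ch u := by
  ext v
  rw [List.mem_toFinset, h.mem_parentList, mem_parents]

theorem Oriented.sum_parentList {M : Type} [AddCommMonoid M] (h : Oriented Q root ch d)
    (u : Fin n) (g : Fin n → M) :
    ((parentList Q ch u).map g).sum = ∑ v ∈ parents root ch u, g v := by
  rw [← h.parentList_toFinset u, List.sum_toFinset _ (nodup_parentList u)]

theorem Oriented.length_parentList (h : Oriented Q root ch d) (u : Fin n) :
    (parentList Q ch u).length = (parents root ch u).card := by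
  rw [← h.parentList_toFinset u, List.toFinset_card_of_nodup (nodup_parentList u)]

/-- Every node but the root is a parent exactly once. -/
theorem sum_parents {M : Type} [AddCommMonoid M] (root : Fin n) (ch : Fin n → Fin n)
    (g : Fin n → Fin n → M) :
    ∑ u, ∑ v ∈ parents root ch u, g u v = ∑ v with v ≠ root, g (ch v) v := by
  simp only [parents, Finset.sum_filter]
  rw [Finset.sum_comm]
  refine Finset.sum_congr rfl fun v _ => ?_
  by_cases hv : v = root
  · simp [hv]
  · simp [hv]

/-- A set of nodes that contains the root and, with a node, all its parents contains all nodes. -/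
theorem Oriented.mem_of_closed (h : Oriented Q root ch d) (S : List (Fin n)) (hroot : root ∈ S)
    (hS : ∀ v, v ≠ root → ch v ∈ S → v ∈ S) (u : Fin n) : u ∈ S := by
  induction hk : d u using Nat.strong_induction_on generalizing u with
  | _ k ih =>
    by_cases hu : u = root
    · rwa [hu]
    · exact hS u hu (ih _ (hk ▸ h.lt u hu) _ rfl)

theorem mem_of_nodup_of_le_length {S : List (Fin n)} (hS : S.Nodup) (hn : n ≤ S.length)
    (u : Fin n) : u ∈ S := by
  rw [← List.mem_toFinset, Finset.eq_univ_of_card S.toFinset]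
  · exact Finset.mem_univ u
  · rw [List.toFinset_card_of_nodup hS, Fintype.card_fin]
    exact le_antisymm (by simpa using hS.length_le_card) hn

theorem Oriented.wellFounded_ch (h : Oriented Q root ch d) :
    WellFounded fun v u => v ≠ root ∧ ch v = u := by
  refine Subrelation.wf (r := fun v u : Fin n => Finset.univ.sup d - d v < Finset.univ.sup d - d u)
    ?_ (measure fun v => Finset.univ.sup d - d v).wf
  rintro v u ⟨hv, rfl⟩
  have := h.lt v hv
  have := Finset.le_sup (f := d) (Finset.mem_univ v)
  show _ < _
  omega

/-- Expansion of a quadratic form along the tree. -/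
theorem Oriented.quadratic_form (h : Oriented Q root ch d) (x : Fin n → ℝ) :
    x ⬝ᵥ Matrix.mulVec Q x =
      ∑ u, Q u u * x u ^ 2 + 2 * ∑ v with v ≠ root, Q (ch v) v * x (ch v) * x v := by
  have hpt : ∀ i j, x i * (Q i j * x j) = (if i = j then Q i i * x i ^ 2 else 0) +
      ((if j ∈ parents root ch i then Q i j * x i * x j else 0) +
      if i ∈ parents root ch j then Q j i * x j * x i else 0) := by
    intro i j
    by_cases hij : i = j
    · subst hij
      have : i ∉ parents root ch i := fun hm =>
        h.ne_ch (mem_parents.1 hm).1 (mem_parents.1 hm).2.symm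
      rw [if_pos rfl, if_neg this]; ring
    rw [if_neg hij]
    by_cases h₁ : j ∈ parents root ch i
    · have h₂ : i ∉ parents root ch j := by
        intro h₂
        obtain ⟨a₁, a₂⟩ := mem_parents.1 h₁
        obtain ⟨b₁, b₂⟩ := mem_parents.1 h₂
        have l₁ := h.lt j a₁
        have l₂ := h.lt i b₁
        rw [a₂] at l₁
        rw [b₂] at l₂
        omega
      rw [if_pos h₁, if_neg h₂]; ring
    · rw [if_neg h₁]
      by_cases h₂ : i ∈ parents root ch j
      · rw [if_pos h₂, h.symm j i]; ring
      · rw [if_neg h₂]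
        have : Q i j = 0 := by
          by_contra hne
          rcases h.adj i j hij hne with h' | h'
          · exact h₂ (mem_parents.2 h')
          · exact h₁ (mem_parents.2 h')
        rw [this]; ring
  have hsum : ∀ g : Fin n → Fin n → ℝ, ∑ i, ∑ j, (if j ∈ parents root ch i then g i j else 0) =
      ∑ v with v ≠ root, g (ch v) v := by
    intro g
    rw [← sum_parents]
    exact Finset.sum_congr rfl fun i _ => by rw [Finset.sum_ite_mem, Finset.univ_inter]
  simp only [dotProduct, Matrix.mulVec, Finset.mul_sum]
  simp only [hpt, Finset.sum_add_distrib]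
  rw [hsum fun i j => Q i j * x i * x j]
  rw [Finset.sum_comm (f := fun i j => if i ∈ parents root ch j then Q j i * x j * x i else 0),
    hsum fun i j => Q i j * x i * x j]
  simp only [Finset.sum_ite_eq, Finset.mem_univ, if_true, ← Finset.mul_sum]
  ring

/-- The pivots of the elimination of the variables in topological order are positive: the pivot
`D u` is the value of the quadratic form at the vector that is `1` at `u`, is optimal given that
value above `u`, and vanishes elsewhere. -/
theorem Oriented.exists_pivots (h : Oriented Q root ch d) (hQ : Q.PosDef) :
    ∃ D : Fin n → ℝ, (∀ u, D u = Q u u - ∑ v ∈ parents root ch u, Q u v ^ 2 / D v) ∧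
      ∀ u, 0 < D u := by
  obtain ⟨D, hD⟩ := exists_recursive h.wellFounded_ch
    (fun u D => Q u u - ∑ v ∈ parents root ch u, Q u v ^ 2 / (D v : ℝ)) (by
      intro u f g hfg
      congr 1
      exact Finset.sum_congr rfl fun v hv => by rw [hfg v (mem_parents.1 hv)])
  refine ⟨D, hD, fun u => ?_⟩
  obtain ⟨x, hx⟩ := exists_recursive (β := ℝ) (measure d).wf
    (fun v x => if v = u then 1 else if v = root then 0 else -(Q (ch v) v * x (ch v)) / D v) (by
      intro v f g hfg
      split_ifs with h₁ h₂
      · rfl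
      · rfl
      · rw [hfg (ch v) (h.lt v h₂)])
  have hxu : x u = 1 := by rw [hx, if_pos rfl]
  have hlow : ∀ w, d w < d u → x w = 0 := by
    intro w hw
    induction hk : d w using Nat.strong_induction_on generalizing w with
    | _ k ih =>
      rw [hx, if_neg (fun e => by rw [e] at hw; exact lt_irrefl _ hw)]
      split_ifs with hr
      · rfl
      · have hlt := h.lt w hr
        rw [ih _ (hk ▸ hlt) (ch w) (hlt.trans hw) rfl]
        simp
  have hQD : ∑ v, Q v v * x v ^ 2 = ∑ v, D v * x v ^ 2 +
      ∑ v with v ≠ root, Q (ch v) v ^ 2 / D v * x (ch v) ^ 2 := by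
    rw [← sum_parents root ch fun u v => Q u v ^ 2 / D v * x u ^ 2, ← Finset.sum_add_distrib]
    refine Finset.sum_congr rfl fun v _ => ?_
    rw [hD v, ← Finset.sum_mul]; ring
  have hsplit : ∑ v, D v * x v ^ 2 = D root * x root ^ 2 + ∑ v with v ≠ root, D v * x v ^ 2 := by
    rw [Finset.filter_ne']
    exact (Finset.add_sum_erase _ (fun v => D v * x v ^ 2) (Finset.mem_univ root)).symm
  have hform : x ⬝ᵥ Matrix.mulVec Q x = D root * x root ^ 2 + ∑ v with v ≠ root,
      (D v * x v ^ 2 + Q (ch v) v ^ 2 / D v * x (ch v) ^ 2 +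
        2 * (Q (ch v) v * x (ch v) * x v)) := by
    rw [h.quadratic_form, hQD, hsplit, Finset.mul_sum]
    simp only [Finset.sum_add_distrib]
    ring
  -- A vanishing denominator does no harm: then the summand of `v` is `0` as well.
  have hterm : ∀ v, v ≠ root → v ≠ u → D v * x v ^ 2 + Q (ch v) v ^ 2 / D v * x (ch v) ^ 2 +
      2 * (Q (ch v) v * x (ch v) * x v) = 0 := by
    intro v hv hvu
    have hxv : x v = -(Q (ch v) v * x (ch v)) / D v := by rw [hx, if_neg hvu, if_neg hv]
    by_cases h0 : D v = 0
    · simp [hxv, h0]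
    · rw [hxv]; field_simp; ring
  have hval : x ⬝ᵥ Matrix.mulVec Q x = D u := by
    rw [hform]
    by_cases hu : u = root
    · rw [Finset.sum_eq_zero, ← hu, hxu]
      · ring
      · intro v hv
        have hv' := (Finset.mem_filter.1 hv).2
        exact hterm v hv' (hu ▸ hv')
    · have hr : x root = 0 := by
        rw [hx, if_neg (Ne.symm hu), if_pos rfl]
      rw [Finset.sum_eq_single_of_mem u (by simp [hu]) fun v hv hvu =>
        hterm v (Finset.mem_filter.1 hv).2 hvu, hr, hxu, hlow _ (h.lt u hu)]
      ring
  have hx0 : x ≠ 0 := fun e => by simp [e] at hxu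
  have := hQ.dotProduct_mulVec_pos hx0
  rwa [star_trivial, hval] at this

/-- Sizes of subtrees. -/
theorem Oriented.exists_sizes (h : Oriented Q root ch d) :
    ∃ s : Fin n → ℕ, ∀ u, 1 + ∑ v ∈ parents root ch u, s v ≤ s u ∧ s u ≤ n := by
  classical
  have hmono : ∀ (k : ℕ) w, d (ch^[k] w) ≤ d w := by
    have h1 : ∀ w, d (ch w) ≤ d w := by
      intro w
      by_cases hw : w = root
      · rw [hw, h.ch_root]
      · exact (h.lt w hw).le
    intro k
    induction k with
    | zero => exact fun w => le_rfl
    | succ k ih => exact fun w => (ih (ch w)).trans (h1 w)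
  let S : Fin n → Finset (Fin n) := fun u => Finset.univ.filter fun w => ∃ k : ℕ, ch^[k] w = u
  have hS : ∀ {u w}, w ∈ S u ↔ ∃ k : ℕ, ch^[k] w = u := by intro u w; simp [S]
  refine ⟨fun u => (S u).card, fun u => ⟨?_, by simpa using Finset.card_le_univ (S u)⟩⟩
  have hdisj : ∀ v ∈ parents root ch u, ∀ v' ∈ parents root ch u, ∀ (k j : ℕ) w,
      ch^[k] w = v → ch^[k + j] w = v' → v = v' := by
    intro v hv v' hv' k j w hk hj
    rw [add_comm, Function.iterate_add_apply, hk] at hj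
    rcases j with - | j
    · exact hj
    · rw [Function.iterate_succ_apply, (mem_parents.1 hv).2] at hj
      have h₁ := hmono j u
      have h₂ := h.lt v' (mem_parents.1 hv').1
      rw [hj] at h₁
      rw [(mem_parents.1 hv').2] at h₂
      omega
  rw [← Finset.card_biUnion, add_comm, ← Finset.card_insert_of_notMem (a := u)]
  · refine Finset.card_le_card fun w hw => ?_
    rcases Finset.mem_insert.1 hw with rfl | hw
    · exact hS.2 ⟨0, rfl⟩
    · obtain ⟨v, hv, hw⟩ := Finset.mem_biUnion.1 hw
      obtain ⟨k, hk⟩ := hS.1 hw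
      exact hS.2 ⟨k + 1, by rw [Function.iterate_succ_apply', hk, (mem_parents.1 hv).2]⟩
  · intro hu
    obtain ⟨v, hv, hw⟩ := Finset.mem_biUnion.1 hu
    obtain ⟨k, hk⟩ := hS.1 hw
    have h₁ := hmono k u
    have h₂ := h.lt v (mem_parents.1 hv).1
    rw [hk] at h₁
    rw [(mem_parents.1 hv).2] at h₂
    omega
  · intro v hv v' hv' hne
    refine Finset.disjoint_left.2 fun w hw hw' => hne ?_
    obtain ⟨k, hk⟩ := hS.1 hw
    obtain ⟨k', hk'⟩ := hS.1 hw'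
    rcases le_total k k' with hle | hle
    · exact hdisj v hv v' hv' k (k' - k) w hk (by rwa [Nat.add_sub_cancel' hle])
    · exact (hdisj v' hv' v hv k' (k - k') w hk' (by rwa [Nat.add_sub_cancel' hle])).symm

end Oriented

/-! ### Correctness of the labeling and of the second phase -/

section Passes

variable {n : ℕ} {Q : Matrix (Fin n) (Fin n) ℝ} {root : Fin n} {ch : Fin n → Fin n}
  {d : Fin n → ℕ}

/-- What the graph search has to deliver: a topological order of all nodes, with the children and
the parents of all nodes. -/
structure IsLabeling (Q : Matrix (Fin n) (Fin n) ℝ) (root : Fin n) (ch : Fin n → Fin n)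
    (T : Rooted n) : Prop where
  nodup : T.order.Nodup
  mem : ∀ u, u ∈ T.order
  topo : T.order.Pairwise fun a b => b ≠ root → ch b ≠ a
  child : ∀ u, T.child u = ch u
  par : ∀ u, T.par u = parentList Q ch u

/-- State of the graph search: `st` is the stack, and the nodes visited so far are those of
`T.order`.  The visited nodes form a subtree, and the stack holds its parents. -/
structure LabelInv (Q : Matrix (Fin n) (Fin n) ℝ) (root : Fin n) (ch : Fin n → Fin n)
    (st : List (Fin n × Fin n)) (T : Rooted n) : Prop where
  nodup : (st.map Prod.fst ++ T.order).Nodup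
  snd_eq : ∀ p ∈ st, p.2 = ch p.1
  root_mem : root ∈ st.map Prod.fst ++ T.order
  closed : ∀ v, v ≠ root → ch v ∈ T.order → v ∈ st.map Prod.fst ++ T.order
  ch_mem : ∀ v ∈ st.map Prod.fst ++ T.order, v ≠ root → ch v ∈ T.order
  topo : T.order.Pairwise fun a b => b ≠ root → ch b ≠ a
  child : ∀ u ∈ T.order, T.child u = ch u
  par : ∀ u ∈ T.order, T.par u = parentList Q ch u

theorem LabelInv.isLabeling {st : List (Fin n × Fin n)} {T : Rooted n}
    (h : LabelInv Q root ch st T) (hall : ∀ u, u ∈ T.order) : IsLabeling Q root ch T :=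
  ⟨(List.nodup_append.1 h.nodup).2.1, hall, h.topo, fun u => h.child u (hall u),
    fun u => h.par u (hall u)⟩

theorem Oriented.labelLoop_spec (h : Oriented Q root ch d) (k : ℕ) (st : List (Fin n × Fin n))
    (T : Rooted n) (hI : LabelInv Q root ch st T) (hk : n ≤ k + T.order.length) :
    IsLabeling Q root ch (labelLoop Q k st T).val := by
  induction k generalizing st T with
  | zero =>
    exact hI.isLabeling (mem_of_nodup_of_le_length (List.nodup_append.1 hI.nodup).2.1 (by omega))
  | succ k ih =>
    rcases st with - | ⟨⟨u, v⟩, st⟩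
    · exact hI.isLabeling (h.mem_of_closed _ (by simpa using hI.root_mem)
        (by simpa using hI.closed))
    have hv : v = ch u := hI.snd_eq (u, v) List.mem_cons_self
    subst hv
    have hps : (neighbours Q u (ch u) (List.finRange n)).val = parentList Q ch u :=
      neighbours_val Q u (ch u) _
    have hval : (labelLoop Q (k + 1) ((u, ch u) :: st) T).val = (labelLoop Q k
        ((parentList Q ch u).reverse.map (fun w => (w, u)) ++ st) ⟨u :: T.order,
          Function.update T.child u (ch u), Function.update T.par u (parentList Q ch u)⟩).val := by
      rw [← pushPairs_val, ← hps]
      rfl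
    rw [hval]
    have hnd := hI.nodup
    simp only [List.map_cons, List.cons_append, List.nodup_cons] at hnd
    obtain ⟨hu, hnd⟩ := hnd
    have huo : u ∉ T.order := fun h => hu (List.mem_append_right _ h)
    have hmap : (((parentList Q ch u).reverse.map (fun w => (w, u)) ++ st).map Prod.fst) =
        (parentList Q ch u).reverse ++ st.map Prod.fst := by
      simp [Function.comp_def]
    have hmem : ∀ w, w ∈ (parentList Q ch u).reverse ++ st.map Prod.fst ++ (u :: T.order) ↔
        w ∈ parentList Q ch u ∨ w ∈ ((u, ch u) :: st).map Prod.fst ++ T.order := by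
      intro w
      simp only [List.mem_append, List.mem_reverse, List.mem_cons, List.map_cons]
      tauto
    have hnew : ∀ w ∈ parentList Q ch u, w ∉ ((u, ch u) :: st).map Prod.fst ++ T.order := by
      intro w hw hw'
      obtain ⟨h₁, h₂⟩ := h.mem_parentList.1 hw
      exact huo (h₂ ▸ hI.ch_mem w hw' h₁)
    refine ih _ _ ⟨?_, ?_, ?_, ?_, ?_, ?_, ?_, ?_⟩ (by simp only [List.length_cons]; omega)
    · rw [hmap, List.append_assoc]
      refine List.nodup_append.2 ⟨List.nodup_reverse.2 (nodup_parentList u), ?_, ?_⟩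
      · rw [List.nodup_middle]
        exact List.nodup_cons.2 ⟨hu, hnd⟩
      · rintro a ha b hb rfl
        refine hnew a (List.mem_reverse.1 ha) ?_
        simp only [List.mem_append, List.mem_cons, List.map_cons] at hb ⊢
        tauto
    · intro p hp
      rcases List.mem_append.1 hp with hp | hp
      · obtain ⟨w, hw, rfl⟩ := List.mem_map.1 hp
        exact (h.mem_parentList.1 (List.mem_reverse.1 hw)).2.symm
      · exact hI.snd_eq p (List.mem_cons_of_mem _ hp)
    · rw [hmap, hmem]
      exact Or.inr hI.root_mem
    · intro w hw hc
      rw [hmap, hmem]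
      rcases List.mem_cons.1 hc with hc | hc
      · exact Or.inl (h.mem_parentList.2 ⟨hw, hc⟩)
      · exact Or.inr (hI.closed w hw hc)
    · intro w hw hr
      rw [hmap, hmem] at hw
      rcases hw with hw | hw
      · exact List.mem_cons.2 (Or.inl (h.mem_parentList.1 hw).2)
      · exact List.mem_cons_of_mem _ (hI.ch_mem w hw hr)
    · refine List.pairwise_cons.2 ⟨fun b hb hr e => huo ?_, hI.topo⟩
      exact e ▸ hI.ch_mem b (List.mem_append_right _ hb) hr
    · intro w hw
      rcases List.mem_cons.1 hw with rfl | hw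
      · exact Function.update_self ..
      · exact (Function.update_of_ne (fun e : w = u => huo (e ▸ hw)) _ _).trans (hI.child w hw)
    · intro w hw
      rcases List.mem_cons.1 hw with rfl | hw
      · exact Function.update_self ..
      · exact (Function.update_of_ne (fun e : w = u => huo (e ▸ hw)) _ _).trans (hI.par w hw)

theorem Oriented.topologicalLabeling_spec (h : Oriented Q root ch d) :
    IsLabeling Q root ch (topologicalLabeling Q root).val := by
  refine h.labelLoop_spec n [(root, root)] ⟨[], fun _ => root, fun _ => []⟩ ⟨?_, ?_, ?_, ?_, ?_,
    ?_, ?_, ?_⟩ (by simp)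
  · simp
  · simp [h.ch_root]
  · simp
  · simp
  · simp
  · simp
  · simp
  · simp

/-- `V` is the list of the nodes whose value has been computed, and `J` holds their parents. -/
theorem Oriented.backwardPass_spec (h : Oriented Q root ch d) (lam : Arr n ℝ) {T : Rooted n}
    (hT : IsLabeling Q root ch T) (f : Arr n PWQ) (k : ℕ) (J V : List (Fin n)) (x : Arr n ℝ)
    (hnd : (J ++ V).Nodup) (hroot : root ∈ V)
    (hclosed : ∀ v, v ≠ root → ch v ∈ V → v ∈ J ++ V)
    (hch : ∀ v ∈ J ++ V, v ≠ root → ch v ∈ V) (hk : n ≤ k + V.length)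
    (hx : ∀ v ∈ V, v ≠ root → x v = (minimize (f v) (lam v) (Q (ch v) v * x (ch v))).val.2) :
    (backwardPass Q lam T f k J x).val root = x root ∧
    ∀ v, v ≠ root → (backwardPass Q lam T f k J x).val v =
      (minimize (f v) (lam v) (Q (ch v) v * (backwardPass Q lam T f k J x).val (ch v))).val.2 := by
  induction k generalizing J V x with
  | zero =>
    have hall := mem_of_nodup_of_le_length (List.nodup_append.1 hnd).2.1
      (show n ≤ V.length by omega)
    exact ⟨rfl, fun v hv => hx v (hall v) hv⟩
  | succ k ih =>
    rcases J with - | ⟨u, J⟩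
    · have hall := h.mem_of_closed V hroot (by simpa using hclosed)
      exact ⟨rfl, fun v hv => hx v (hall v) hv⟩
    simp only [List.cons_append, List.nodup_cons] at hnd
    obtain ⟨hu, hnd⟩ := hnd
    have huV : u ∉ V := fun h => hu (List.mem_append_right _ h)
    have hur : u ≠ root := fun e => huV (e ▸ hroot)
    set y := Function.update x u (minimize (f u) (lam u) (Q (ch u) u * x (ch u))).val.2 with hy
    have hval : (backwardPass Q lam T f (k + 1) (u :: J) x).val =
        (backwardPass Q lam T f k ((parentList Q ch u).reverse ++ J) y).val := by
      rw [hy, ← pushNodes_val, ← hT.par u, ← hT.child u]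
      rfl
    have hold : ∀ v ∈ V, y v = x v := fun v hv =>
      Function.update_of_ne (fun e : v = u => huV (e ▸ hv)) _ _
    have hmem : ∀ w, w ∈ (parentList Q ch u).reverse ++ J ++ (u :: V) ↔
        w ∈ parentList Q ch u ∨ w ∈ (u :: J) ++ V := by
      intro w
      simp only [List.mem_append, List.mem_reverse, List.mem_cons]
      tauto
    have hnew : ∀ w ∈ parentList Q ch u, w ∉ (u :: J) ++ V := by
      intro w hw hw'
      obtain ⟨h₁, h₂⟩ := h.mem_parentList.1 hw
      exact huV (h₂ ▸ hch w hw' h₁)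
    have key := ih ((parentList Q ch u).reverse ++ J) (u :: V) y ?_ (List.mem_cons_of_mem _ hroot)
      ?_ ?_ (by simp only [List.length_cons]; omega) ?_
    · rw [hval]
      exact ⟨key.1.trans (hold root hroot), key.2⟩
    · rw [List.append_assoc]
      refine List.nodup_append.2 ⟨List.nodup_reverse.2 (nodup_parentList u), ?_, ?_⟩
      · rw [List.nodup_middle]
        exact List.nodup_cons.2 ⟨hu, hnd⟩
      · rintro a ha b hb rfl
        refine hnew a (List.mem_reverse.1 ha) ?_
        simp only [List.mem_append, List.mem_cons] at hb ⊢
        tauto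
    · intro w hw hc
      rw [hmem]
      rcases List.mem_cons.1 hc with hc | hc
      · exact Or.inl (h.mem_parentList.2 ⟨hw, hc⟩)
      · exact Or.inr (hclosed w hw hc)
    · intro w hw hr
      rw [hmem] at hw
      rcases hw with hw | hw
      · exact List.mem_cons.2 (Or.inl (h.mem_parentList.1 hw).2)
      · exact List.mem_cons_of_mem _ (hch w hw hr)
    · intro w hw hr
      have hcV : ch w ∈ V := by
        refine hch w ?_ hr
        rcases List.mem_cons.1 hw with rfl | hw
        · exact List.mem_cons_self
        · exact List.mem_append_right _ hw
      rw [hold _ hcV]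
      rcases List.mem_cons.1 hw with rfl | hw
      · exact Function.update_self ..
      · rw [hold w hw]
        exact hx w hw hr

end Passes

/-! ### The first phase -/

section Forward

variable {n : ℕ} {Q : Matrix (Fin n) (Fin n) ℝ} {root : Fin n} {ch : Fin n → Fin n}
  {d : Fin n → ℕ}

/-- The facts about the parametric cost of `u` and its conjugate: `F u` is the parametric cost
without its indicator term, `FS u` is the conjugate of the parametric cost, and `f u`, `fs u` are
the lists that represent them.  `D` are the pivots of the elimination, which bound curvatures, and
`s` are the sizes of the subtrees, which bound numbers of pieces. -/
structure NodeSpec (Q : Matrix (Fin n) (Fin n) ℝ) (c lam : Fin n → ℝ) (root : Fin n)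
    (ch : Fin n → Fin n) (D : Fin n → ℝ) (s : Fin n → ℕ) (f fs : Arr n PWQ)
    (F FS : Fin n → ℝ → ℝ) (u : Fin n) : Prop where
  minRep : MinRep (F u) (f u)
  maxRep : MaxRep (FS u) (fs u)
  isConj : IsConj (fun α => F u α + if α = 0 then 0 else lam u) (FS u)
  formula : ∀ α, F u α = Q u u / 2 * α ^ 2 + c u * α -
    ∑ v ∈ parents root ch u, FS v (-Q u v * α)
  curvature : ∀ p ∈ fs u, p.q.a ≤ 1 / (2 * D u)
  length_le : (f u).length + 1 ≤ 2 * s u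
  length_conj_le : (fs u).length ≤ 2 * s u + 1

theorem NodeSpec.congr {c lam D : Fin n → ℝ} {s : Fin n → ℕ} {f fs f' fs' : Arr n PWQ}
    {F FS F' FS' : Fin n → ℝ → ℝ} {u : Fin n} (h : NodeSpec Q c lam root ch D s f fs F FS u)
    (hf : f' u = f u) (hfs : fs' u = fs u) (hF : F' u = F u) (hFS : FS' u = FS u)
    (hpar : ∀ v ∈ parents root ch u, FS' v = FS v) :
    NodeSpec Q c lam root ch D s f' fs' F' FS' u := by
  refine ⟨?_, ?_, ?_, fun α => ?_, ?_, ?_, ?_⟩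
  · rw [hF, hf]; exact h.minRep
  · rw [hFS, hfs]; exact h.maxRep
  · rw [hF, hFS]; exact h.isConj
  · rw [hF, h.formula α]
    congr 1
    exact Finset.sum_congr rfl fun v hv => by rw [hpar v hv]
  · rw [hfs]; exact h.curvature
  · rw [hf]; exact h.length_le
  · rw [hfs]; exact h.length_conj_le

/-- One round of the first phase. -/
theorem Oriented.round_spec (h : Oriented Q root ch d) {c lam D : Fin n → ℝ} {s : Fin n → ℕ}
    (hlam : ∀ i, 0 < lam i)
    (hD : ∀ u, D u = Q u u - ∑ v ∈ parents root ch u, Q u v ^ 2 / D v) (hDpos : ∀ u, 0 < D u)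
    (hs : ∀ u, 1 + ∑ v ∈ parents root ch u, s v ≤ s u ∧ s u ≤ n) {f fs : Arr n PWQ}
    {F FS : Fin n → ℝ → ℝ} {u : Fin n}
    (hpar : ∀ v ∈ parents root ch u, NodeSpec Q c lam root ch D s f fs F FS v) :
    (∃ Fu FSu : ℝ → ℝ, NodeSpec Q c lam root ch D s
      (Function.update f u (parametricCost Q c u (parentList Q ch u) fs).val)
      (Function.update fs u
        (breakpointAlgorithm (parametricCost Q c u (parentList Q ch u) fs).val (lam u)).val)
      (Function.update F u Fu) (Function.update FS u FSu) u) ∧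
    Cost (parametricCost Q c u (parentList Q ch u) fs)
      (((parentList Q ch u).length + 1) * (87 * n + 30)) ∧
    Cost (breakpointAlgorithm (parametricCost Q c u (parentList Q ch u) fs).val (lam u))
      (600 * n + 30) := by
  have hmem : ∀ v ∈ parentList Q ch u, v ∈ parents root ch u := fun v hv =>
    mem_parents.2 (h.mem_parentList.1 hv)
  have hpiv : Q u u / 2 - ((parentList Q ch u).map fun v => Q u v ^ 2 * (1 / (2 * D v))).sum =
      D u / 2 := by
    rw [h.sum_parentList, hD u, sub_div, Finset.sum_div]
    congr 1
    refine Finset.sum_congr rfl fun v _ => ?_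
    have := (hDpos v).ne'
    field_simp
  obtain ⟨p₁, p₂⟩ := parametricCost_spec Q c u (parentList Q ch u) fs FS (fun v => 1 / (2 * D v))
    (fun v hv => by
      obtain ⟨h₁, h₂⟩ := h.mem_parentList.1 hv
      exact h₂ ▸ h.ne_zero v h₁)
    (fun v hv => ⟨(hpar v (hmem v hv)).maxRep, (hpar v (hmem v hv)).curvature⟩)
    (by rw [hpiv]; exact half_pos (hDpos u))
  rw [hpiv] at p₂
  generalize hFu : (fun x => Q u u / 2 * x ^ 2 + c u * x -
    ((parentList Q ch u).map fun v => FS v (-Q u v * x)).sum) = Fu at p₁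
  have hs1 : ∀ v, 1 ≤ s v := fun v => (Nat.le_add_right _ _).trans (hs v).1
  have hlen : ((parentList Q ch u).map fun v => (fs v).length).sum ≤
      3 * ∑ v ∈ parents root ch u, s v := by
    rw [h.sum_parentList, Finset.mul_sum]
    refine Finset.sum_le_sum fun v hv => ?_
    have := (hpar v hv).length_conj_le
    have := hs1 v
    omega
  have hlen' : ((parentList Q ch u).map fun v => (fs v).length - 1).sum ≤
      2 * ∑ v ∈ parents root ch u, s v := by
    rw [h.sum_parentList, Finset.mul_sum]
    refine Finset.sum_le_sum fun v hv => ?_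
    have := (hpar v hv).length_conj_le
    omega
  obtain ⟨hs₁, hs₂⟩ := hs u
  obtain ⟨l₁, l₂⟩ := cost_parametricCost Q c u (parentList Q ch u) fs
    (fun v hv => (hpar v (hmem v hv)).maxRep.rep.ne_nil) (3 * n) (by omega)
  set fu := (parametricCost Q c u (parentList Q ch u) fs).val with hfu
  obtain ⟨b₁, b₂⟩ := cost_breakpointAlgorithm fu (lam u)
  obtain ⟨G, hG⟩ := p₁.exists_isConj
  obtain ⟨m₁, m₂⟩ := breakpointAlgorithm_spec p₁ hG (lam u)
  refine ⟨⟨Fu, fun β => max (G β - lam u) (-Fu 0), ?_, ?_, ?_, fun α => ?_, ?_, ?_, ?_⟩,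
    l₂.mono (by rw [show 29 * (3 * n) = 87 * n by ring]), b₂.mono (by omega)⟩
  · rw [Function.update_self, Function.update_self]; exact p₁
  · rw [Function.update_self, Function.update_self]; exact m₁
  · rw [Function.update_self, Function.update_self]; exact hG.add_indicator (hlam u)
  · rw [Function.update_self, ← hFu]
    dsimp only
    rw [h.sum_parentList]
    congr 1
    refine Finset.sum_congr rfl fun v hv => ?_
    obtain ⟨h₁, h₂⟩ := mem_parents.1 hv
    rw [Function.update_of_ne (h₂ ▸ h.ne_ch h₁)]
  · rw [Function.update_self]
    intro p hp
    rcases m₂ p hp with h0 | ⟨r, hr, hpr⟩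
    · rw [h0]
      have := hDpos u
      positivity
    · rw [hpr]
      have hr' := p₂ r hr
      have hDu := hDpos u
      show 1 / (4 * r.q.a) ≤ _
      exact one_div_le_one_div_of_le (by positivity) (by linarith)
  · rw [Function.update_self]; omega
  · rw [Function.update_self]; omega

/-- The nodes of `done` have been treated, the nodes of `us` remain. -/
theorem Oriented.forwardPass_spec (h : Oriented Q root ch d) {c lam D : Fin n → ℝ}
    {s : Fin n → ℕ} (hlam : ∀ i, 0 < lam i)
    (hD : ∀ u, D u = Q u u - ∑ v ∈ parents root ch u, Q u v ^ 2 / D v) (hDpos : ∀ u, 0 < D u)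
    (hs : ∀ u, 1 + ∑ v ∈ parents root ch u, s v ≤ s u ∧ s u ≤ n) (us : List (Fin n))
    (done : Set (Fin n)) (f fs : Arr n PWQ) (F FS : Fin n → ℝ → ℝ)
    (hnd : us.Nodup) (hdisj : ∀ u ∈ us, u ∉ done) (hall : ∀ u, u ∈ us ∨ u ∈ done)
    (htopo : us.Pairwise fun a b => b ≠ root → ch b ≠ a)
    (hdone : ∀ u ∈ done, NodeSpec Q c lam root ch D s f fs F FS u)
    (hclosed : ∀ u ∈ done, ∀ v ∈ parents root ch u, v ∈ done) :
    (∃ fs' F' FS', ∀ u, NodeSpec Q c lam root ch D s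
      (forwardPass Q c lam (parentList Q ch) us f fs).val fs' F' FS' u) ∧
    Cost (forwardPass Q c lam (parentList Q ch) us f fs)
      ((us.map fun u => (parentList Q ch u).length + 1).sum * (687 * n + 66) + 1) := by
  induction us generalizing done f fs F FS with
  | nil =>
    refine ⟨⟨fs, F, FS, fun u => hdone u ((hall u).resolve_left (by simp))⟩, ?_⟩
    rw [forwardPass]
    exact Cost.mono (Cost.step.bind (Cost.pure _)) (by simp)
  | cons u us ih =>
    obtain ⟨hu, hnd⟩ := List.nodup_cons.1 hnd
    obtain ⟨ht, htopo⟩ := List.pairwise_cons.1 htopo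
    have hud : u ∉ done := hdisj u List.mem_cons_self
    have hpar : ∀ v ∈ parents root ch u, v ∈ done := by
      intro v hv
      obtain ⟨h₁, h₂⟩ := mem_parents.1 hv
      rcases hall v with hv' | hv'
      · rcases List.mem_cons.1 hv' with rfl | hv'
        · exact absurd h₂.symm (h.ne_ch h₁)
        · exact absurd h₂ (ht v hv' h₁)
      · exact hv'
    obtain ⟨⟨Fu, FSu, hspec⟩, c₁, c₂⟩ :=
      h.round_spec hlam hD hDpos hs fun v hv => hdone v (hpar v hv)
    have key := ih (insert u done) (hnd := hnd) (htopo := htopo) ?_ ?_ (f := Function.update f u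
      (parametricCost Q c u (parentList Q ch u) fs).val) (fs := Function.update fs u
        (breakpointAlgorithm (parametricCost Q c u (parentList Q ch u) fs).val (lam u)).val)
      (F := Function.update F u Fu) (FS := Function.update FS u FSu) ?_ ?_
    · refine ⟨key.1, ?_⟩
      rw [forwardPass]
      refine Cost.mono (Cost.step.bind ((Cost.instr _).bind (c₁.bind ((Cost.instr _).bind
        (c₂.bind ((Cost.instr _).bind ((Cost.instr _).bind key.2))))))) ?_
      have := Nat.mul_le_mul_left (parentList Q ch u).length
        (show 87 * n + 30 ≤ 687 * n + 66 by omega)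
      simp only [List.map_cons, List.sum_cons, Nat.add_mul]
      omega
    · intro v hv hv'
      rcases Set.mem_insert_iff.1 hv' with rfl | hv'
      · exact hu hv
      · exact hdisj v (List.mem_cons_of_mem _ hv) hv'
    · intro v
      rcases hall v with hv | hv
      · rcases List.mem_cons.1 hv with rfl | hv
        · exact Or.inr (Set.mem_insert _ _)
        · exact Or.inl hv
      · exact Or.inr (Set.mem_insert_of_mem _ hv)
    · intro v hv
      rcases Set.mem_insert_iff.1 hv with rfl | hv
      · exact hspec
      · have hne : ∀ w ∈ done, w ≠ u := fun w hw e => hud (e ▸ hw)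
        exact (hdone v hv).congr (Function.update_of_ne (hne v hv) _ _)
          (Function.update_of_ne (hne v hv) _ _) (Function.update_of_ne (hne v hv) _ _)
          (Function.update_of_ne (hne v hv) _ _) fun w hw =>
          Function.update_of_ne (hne w (hclosed v hv w hw)) _ _
    · intro v hv w hw
      rcases Set.mem_insert_iff.1 hv with rfl | hv
      · exact Set.mem_insert_of_mem _ (hpar w hw)
      · exact Set.mem_insert_of_mem _ (hclosed v hv w hw)

/-- The lists of parents have at most `n` elements in total. -/
theorem Oriented.sum_length_parentList (h : Oriented Q root ch d) {us : List (Fin n)}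
    (hnd : us.Nodup) : (us.map fun u => (parentList Q ch u).length + 1).sum ≤ 2 * n := by
  rw [← List.sum_toFinset _ hnd]
  refine (Finset.sum_le_sum_of_subset (Finset.subset_univ _)).trans ?_
  rw [Finset.sum_add_distrib]
  have h₁ : ∑ u, (parentList Q ch u).length ≤ n := by
    simp only [h.length_parentList, Finset.card_eq_sum_ones]
    rw [sum_parents root ch fun _ _ => 1, ← Finset.card_eq_sum_ones]
    exact (Finset.card_le_univ _).trans (by simp)
  have h₂ : ∑ _u : Fin n, 1 = n := by simp
  omega

end Forward

/-! ### Optimality and complexity -/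

section Optimality

variable {n : ℕ} {Q : Matrix (Fin n) (Fin n) ℝ} {root : Fin n} {ch : Fin n → Fin n}
  {d : Fin n → ℕ}

theorem lam_dotProduct_supportVector (lam x : Fin n → ℝ) :
    lam ⬝ᵥ supportVector x = ∑ u, if x u = 0 then 0 else lam u := by
  simp only [dotProduct, supportVector]
  exact Finset.sum_congr rfl fun u _ => by split_ifs <;> simp

theorem feasible_supportVector (x : Fin n → ℝ) : Feasible x (supportVector x) := by
  constructor
  · intro i
    unfold supportVector
    split_ifs <;> simp
  · intro i
    unfold supportVector
    split_ifs with hi <;> simp [hi]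

/-- Among the feasible points with given `x`, the support vector has the least cost. -/
theorem objective_supportVector_le {c lam : Fin n → ℝ} (hlam : ∀ i, 0 < lam i) {x z : Fin n → ℝ}
    (h : Feasible x z) : objective Q c lam x (supportVector x) ≤ objective Q c lam x z := by
  unfold objective
  rw [lam_dotProduct_supportVector]
  refine add_le_add_right (Finset.sum_le_sum fun i _ => ?_) _
  split_ifs with hi
  · rcases h.1 i with hz | hz
    · rw [hz, mul_zero]
    · rw [hz, mul_one]; exact (hlam i).le
  · have := (mul_eq_zero.1 (h.2 i)).resolve_left hi
    rw [show z i = 1 by linarith, mul_one]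

/-- The objective is the parametric cost of the root plus, for every other node, the gap in
Fenchel's inequality between its parametric cost and the conjugate. -/
theorem Oriented.objective_eq (h : Oriented Q root ch d) {c lam : Fin n → ℝ}
    {F FS : Fin n → ℝ → ℝ}
    (hF : ∀ u α, F u α = Q u u / 2 * α ^ 2 + c u * α -
      ∑ v ∈ parents root ch u, FS v (-Q u v * α)) (x : Fin n → ℝ) :
    objective Q c lam x (supportVector x) =
      (F root (x root) + if x root = 0 then 0 else lam root) +
      ∑ v with v ≠ root, (F v (x v) + (if x v = 0 then 0 else lam v) +
        Q (ch v) v * x (ch v) * x v + FS v (-Q (ch v) v * x (ch v))) := by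
  unfold objective
  rw [lam_dotProduct_supportVector, h.quadratic_form]
  have hsum : ∑ u, (F u (x u) + if x u = 0 then 0 else lam u) =
      ∑ u, (Q u u * x u ^ 2) / 2 + c ⬝ᵥ x + ∑ u, (if x u = 0 then 0 else lam u) -
      ∑ v with v ≠ root, FS v (-Q (ch v) v * x (ch v)) := by
    rw [← sum_parents root ch fun u v => FS v (-Q u v * x u)]
    simp only [hF, Finset.sum_add_distrib, Finset.sum_sub_distrib, dotProduct]
    have : ∀ u, Q u u / 2 * x u ^ 2 = Q u u * x u ^ 2 / 2 := fun u => by ring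
    simp only [this]
    ring
  have hsplit : ∑ u, (F u (x u) + if x u = 0 then 0 else lam u) =
      (F root (x root) + if x root = 0 then 0 else lam root) +
      ∑ v with v ≠ root, (F v (x v) + if x v = 0 then 0 else lam v) := by
    rw [Finset.filter_ne']
    exact (Finset.add_sum_erase _ (fun u => F u (x u) + if x u = 0 then 0 else lam u)
      (Finset.mem_univ root)).symm
  rw [Finset.sum_add_distrib, Finset.sum_add_distrib, ← add_assoc, ← add_assoc, ← hsplit, hsum,
    ← Finset.sum_div]
  ring

theorem treeAlgorithm_spec {c lam : Fin n → ℝ} (hQ : Q.PosDef)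
    (hT : (supportGraph Q).IsTree) (hlam : ∀ i, 0 < lam i) :
    IsOptimal Q c lam (treeAlgorithm Q c lam root).val.x
        (supportVector (treeAlgorithm Q c lam root).val.x) ∧
      (treeAlgorithm Q c lam root).val.cost = objective Q c lam
        (treeAlgorithm Q c lam root).val.x (supportVector (treeAlgorithm Q c lam root).val.x) ∧
      Cost (treeAlgorithm Q c lam root) (2000 * n ^ 2) := by
  obtain ⟨ch, d, h⟩ := exists_oriented hQ hT root
  obtain ⟨D, hD, hDpos⟩ := h.exists_pivots hQ
  obtain ⟨s, hs⟩ := h.exists_sizes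
  have hn : 1 ≤ n := Fin.pos root
  have hL := h.topologicalLabeling_spec
  have cL := cost_topologicalLabeling Q root
  set T := (topologicalLabeling Q root).val with hTdef
  have hparT : T.par = parentList Q ch := funext hL.par
  obtain ⟨⟨fs', F, FS, hspec⟩, cF⟩ := h.forwardPass_spec (c := c) hlam hD hDpos hs T.order ∅
    (fun _ => []) (fun _ => []) (fun _ _ => 0) (fun _ _ => 0) hL.nodup (by simp)
    (fun u => Or.inl (hL.mem u)) hL.topo (by simp) (by simp)
  rw [← hparT] at cF hspec
  set f := (forwardPass Q c lam T.par T.order (fun _ => []) (fun _ => [])).val with hf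
  set x₀ := Function.update (fun _ : Fin n => (0 : ℝ)) root
    (minimize (f root) (lam root) 0).val.2 with hx₀
  set J := (pushNodes (T.par root) []).val with hJ
  have hJval : J = (parentList Q ch root).reverse := by
    rw [hJ, pushNodes_val, hL.par root, List.append_nil]
  have hJmem : ∀ v, v ∈ J ↔ v ≠ root ∧ ch v = root := fun v => by
    rw [hJval, List.mem_reverse, h.mem_parentList]
  obtain ⟨hxr, hx⟩ := h.backwardPass_spec lam hL f n J [root] x₀
    (List.nodup_append.2 ⟨by rw [hJval]; exact List.nodup_reverse.2 (nodup_parentList root),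
      by simp, fun a ha b hb e => ((hJmem a).1 ha).1 (e.trans (List.mem_singleton.1 hb))⟩)
    (by simp)
    (fun v hv hc => List.mem_append_left _ ((hJmem v).2 ⟨hv, List.mem_singleton.1 hc⟩))
    (fun v hv hr => by
      rcases List.mem_append.1 hv with hv | hv
      · exact List.mem_singleton.2 ((hJmem v).1 hv).2
      · exact absurd (List.mem_singleton.1 hv) hr)
    (by omega) (fun v hv hr => absurd (List.mem_singleton.1 hv) hr)
  have cB := cost_backwardPass Q lam T f (2 * n) (fun u => by
      have := (hspec u).length_le
      have := (hs u).2
      omega)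
    (fun u => by
      rw [hL.par u, h.length_parentList]
      exact (Finset.card_le_univ _).trans (by rw [Fintype.card_fin]; omega)) n J x₀
  set x := (backwardPass Q lam T f n J x₀).val with hxdef
  have hval : (treeAlgorithm Q c lam root).val =
      ⟨x, (minimize (f root) (lam root) 0).val.1⟩ := rfl
  rw [hval]
  obtain ⟨r₁, r₂⟩ := minimize_spec (hspec root).minRep (hlam root) 0
  have hxroot : x root = (minimize (f root) (lam root) 0).val.2 := by
    rw [hxr, hx₀, Function.update_self]
  rw [← hxroot] at r₁
  set m := (minimize (f root) (lam root) 0).val.1 with hm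
  -- Fenchel's inequality makes every gap nonnegative.
  have hlower : ∀ y : Fin n → ℝ, m ≤ objective Q c lam y (supportVector y) := by
    intro y
    rw [h.objective_eq fun u => (hspec u).formula]
    refine le_add_of_le_of_nonneg (by simpa using r₂ (y root)) (Finset.sum_nonneg fun v _ => ?_)
    have : -Q (ch v) v * y (ch v) * y v - (F v (y v) + if y v = 0 then 0 else lam v) ≤
      FS v (-Q (ch v) v * y (ch v)) := (hspec v).isConj.le _ _
    linarith
  -- The computed values attain equality in Fenchel's inequality.
  have hattained : m = objective Q c lam x (supportVector x) := by
    rw [h.objective_eq fun u => (hspec u).formula, Finset.sum_eq_zero, add_zero]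
    · linarith
    · intro v hv
      have hv' := (Finset.mem_filter.1 hv).2
      obtain ⟨m₁, m₂⟩ := minimize_spec (hspec v).minRep (hlam v) (Q (ch v) v * x (ch v))
      rw [← hx v hv'] at m₁
      have h₁ : -Q (ch v) v * x (ch v) * x v - (F v (x v) + if x v = 0 then 0 else lam v) ≤
        FS v (-Q (ch v) v * x (ch v)) := (hspec v).isConj.le _ _
      obtain ⟨α, hα⟩ : ∃ α, FS v (-Q (ch v) v * x (ch v)) = -Q (ch v) v * x (ch v) * α -
        (F v α + if α = 0 then 0 else lam v) := (hspec v).isConj.attained _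
      have h₂ := m₂ α
      linarith
  refine ⟨⟨feasible_supportVector x, fun x' z' hxz => ?_⟩, hattained, ?_⟩
  · rw [← hattained]
    exact (hlower x').trans (objective_supportVector_le hlam hxz)
  · have cM := cost_minimize (f root) (lam root) 0
    have cP := cost_pushNodes (T.par root) []
    have l₁ := (hspec root).length_le
    have l₂ := (hs root).2
    have l₃ : (T.par root).length ≤ n := by
      rw [hL.par root, h.length_parentList]
      exact (Finset.card_le_univ _).trans (by rw [Fintype.card_fin])
    have hsum := Nat.mul_le_mul_right (687 * n + 66) (h.sum_length_parentList hL.nodup)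
    unfold treeAlgorithm
    refine Cost.mono (Cost.step.bind (cL.bind ((Cost.store n _).bind ((Cost.store n _).bind
      (cF.bind ((Cost.instr _).bind ((Cost.instr _).bind (cM.bind ((Cost.store n _).bind
      ((Cost.instr _).bind ((Cost.instr _).bind (cP.bind (cB.bind (Cost.pure _)))))))))))))) ?_
    have hn2 : n ≤ n ^ 2 := Nat.le_self_pow two_ne_zero n
    rw [← hparT] at hsum
    linarith

end Optimality

end TreeMIQP

end

theorem mainTheorem1 :
    ∃ C : ℕ, ∀ (n : ℕ) (Q : Matrix (Fin n) (Fin n) ℝ) (c lam : Fin n → ℝ) (root : Fin n),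
      Q.PosDef → (TreeMIQP.supportGraph Q).IsTree → (∀ i, 0 < lam i) →
        let out := TreeMIQP.treeAlgorithm Q c lam root
        TreeMIQP.IsOptimal Q c lam out.val.x (TreeMIQP.supportVector out.val.x) ∧
        out.val.cost =
          TreeMIQP.objective Q c lam out.val.x (TreeMIQP.supportVector out.val.x) ∧
        out.time ≤ C * n ^ 2 ∧
        out.mem ≤ C * n ^ 2 := by
  refine ⟨2000, fun n Q c lam root hQ hT hlam => ?_⟩
  obtain ⟨h₁, h₂, h₃⟩ := TreeMIQP.treeAlgorithm_spec (root := root) (c := c) hQ hT hlam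
  exact ⟨h₁, h₂, h₃.time_le, h₃.mem_le⟩
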